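/- Let $H$ be a non-zero separable real Hilbert space, $E$ a real Banach space, $T>0$ and $p\in[1,2)$. Then $E$ has type $p$ if and only if $$\Lambda^{\frac1p-\frac12}_{p,p}(0,T;\gamma(H,E))\hookrightarrow \gamma(L^2(0,T;H),E)\quad\text{continuously},$$ in the sense that there is an injective bounded linear operator $J$ from the first space to the second such that every $\Phi$ represents $J\Phi$. Here the following definitions are used. (a) $E$ has type $p$ if there is a constant $C$ such that $\big(\mathbb E\|\sum_{n=1}^N r_n x_n\|^2\big)^{1/2}\le C\big(\sum_{n=1}^N\|x_n\|^p\big)^{1/p}$ for all $N$ and all $x_1,\dots,x_N\in E$, where $r_1,\dots,r_N$ are independent Rademacher (symmetric $\pm1$-valued) random variables. (b) For a separable real Hilbert space $\mathcal H$, $\gamma(\mathcal H,E)$ is the space of all bounded linear operators $R:\mathcal H\to E$ that are $\gamma$-radonifying, i.e. for which the Gaussian sum $\sum_n g_n\,Rh_n$ converges in $L^2(\Omega';E)$ for some (equivalently, every) orthonormal basis $(h_n)$ of $\mathcal H$, where $(g_n)$ are independent standard Gaussian random variables. Its norm is $\|R\|_{\gamma(\mathcal H,E)}=\big(\mathbb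 E\|\sum_n g_n\,Rh_n\|^2\big)^{1/2}$, which does not depend on the basis. (c) For $I=(0,T)$, $s\in(0,1)$, $p,q\in[1,\infty)$, a Banach space $F$ and $\phi\in L^p(I;F)$ put $$\varrho_p(\phi,t)=\sup_{|h|\le t}\Big(\int_{\{r\in I:\ r+h\in I\}}\|\phi(r+h)-\phi(r)\|^p\,dr\Big)^{1/p},\qquad t>0.$$ Then $\Lambda^s_{p,q}(0,T;F)$ is the space of all $\phi\in L^p(I;F)$ for which the following norm is finite: $$\|\phi\|_{\Lambda^s_{p,q}(0,T;F)}=\Big(\int_0^T\|\phi(t)\|^p\,dt\Big)^{1/p}+\Big(\int_0^1\big(t^{-s}\varrho_p(\phi,t)\big)^q\,\frac{dt}{t}\Big)^{1/q}.$$ (d) A function $\Phi:(0,T)\to\mathcal L(H,E)$ represents $R\in\gamma(L^2(0,T;H),E)$ if $t\mapsto\Phi(t)h$ is strongly measurable (up to a null set) for every $h\in H$ and, for every $x^*\in E^*$, one has $\Phi^*x^*\in L^2(0,T;H)$ and $\langle Rf,x^*\rangle=\int_0^T[f(t),\Phi^*(t)x^*]_H\,dt$ for all $f\in L^2(0,T;H)$.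 -/

import Mathlib

set_option linter.unusedSectionVars false

open MeasureTheory ProbabilityTheory Set
open scoped ENNReal NNReal

noncomputable section

/-! ## Type of a Banach space -/

/-- `E` has (Rademacher) type `p`: there is a constant `C` such that
`(𝔼 ‖∑ rₙ xₙ‖²)^(1/2) ≤ C (∑ ‖xₙ‖^p)^(1/p)` for all finite sequences in `E`. The expectation over
the Rademacher variables `r₁, …, r_N` is the average over all choices of signs. -/
def HasType (E : Type*) [NormedAddCommGroup E] [NormedSpace ℝ E] (p : ℝ) : Prop :=
  ∃ C : ℝ, ∀ (N : ℕ) (x : Fin N → E),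
    Real.sqrt ((2 ^ N : ℝ)⁻¹ * ∑ r : Fin N → ℤˣ, ‖∑ n, (((r n : ℤ) : ℝ)) • x n‖ ^ 2)
      ≤ C * (∑ n, ‖x n‖ ^ p) ^ (1 / p)

/-! ## Gamma-radonifying operators -/

/-- The joint law on `ι → ℝ` of a family of independent standard Gaussian variables indexed by `ι`;
under it, the coordinates are independent standard Gaussian variables. -/
def gaussianSeq (ι : Type*) : Measure (ι → ℝ) :=
  Measure.infinitePi fun _ : ι => gaussianReal 0 1

instance instIsProbabilityMeasureGaussianSeq (ι : Type*) :
    IsProbabilityMeasure (gaussianSeq ι) := by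
  unfold gaussianSeq; infer_instance

section Gamma

variable {H : Type*} [NormedAddCommGroup H] [InnerProductSpace ℝ H]
variable {E : Type*} [NormedAddCommGroup E] [NormedSpace ℝ E]

theorem memLp_coord_gaussianSeq {ι : Type*} (i : ι) :
    MemLp (fun ω : ι → ℝ => ω i) 2 (gaussianSeq ι) := by
  have h := memLp_id_gaussianReal (μ := 0) (v := 1) 2
  have h2 : MeasurePreserving (Function.eval i) (gaussianSeq ι) (gaussianReal 0 1) :=
    measurePreserving_eval_infinitePi (fun _ : ι => gaussianReal 0 1) i
  exact h.comp_measurePreserving h2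

theorem memLp_coord_smul_gaussianSeq {ι : Type*} (i : ι) (x : E) :
    MemLp (fun ω : ι → ℝ => ω i • x) 2 (gaussianSeq ι) := by
  refine ((memLp_coord_gaussianSeq (ι := ι) i).norm.mul_const ‖x‖).of_le ?_ ?_
  · exact (by fun_prop : Measurable fun ω : ι → ℝ => ω i).aestronglyMeasurable.smul_const x
  · filter_upwards with ω
    simp [norm_smul]

/-- The random variable `gᵢ x` as an element of `L²(Ω; E)`, where `gᵢ` is the `i`-th of a family of
independent standard Gaussian variables. -/
def gaussianTerm {ι : Type*} (i : ι) (x : E) : Lp E 2 (gaussianSeq ι) :=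
  (memLp_coord_smul_gaussianSeq i x).toLp _

theorem gaussianTerm_add {ι : Type*} (i : ι) (x y : E) :
    gaussianTerm i (x + y) = gaussianTerm i x + gaussianTerm i y := by
  unfold gaussianTerm
  rw [← MemLp.toLp_add]
  congr 1
  ext ω
  simp

theorem gaussianTerm_smul {ι : Type*} (i : ι) (c : ℝ) (x : E) :
    gaussianTerm i (c • x) = c • gaussianTerm i x := by
  unfold gaussianTerm
  rw [← MemLp.toLp_const_smul]
  congr 1
  ext ω
  simp [smul_comm c]

/-- The Gaussian sum `∑ gᵢ R bᵢ` in `L²(Ω; E)`. -/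
def gaussianSum {w : Set H} (b : HilbertBasis w ℝ H) (R : H →L[ℝ] E) :
    Lp E 2 (gaussianSeq w) :=
  ∑' i, gaussianTerm i (R (b i))

/-- `R` is gamma-radonifying: the Gaussian sum `∑ gᵢ R bᵢ` converges in `L²(Ω; E)` for every
orthonormal basis `b` of `H`. -/
def IsRadonifying (R : H →L[ℝ] E) : Prop :=
  ∀ (w : Set H) (b : HilbertBasis w ℝ H), Summable fun i => gaussianTerm i (R (b i))

variable (H E) in
/-- The linear space of gamma-radonifying operators from `H` to `E`. -/
def radonifyingSubmodule : Submodule ℝ (H →L[ℝ] E) where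
  carrier := {R | IsRadonifying R}
  zero_mem' := by
    intro w b
    have h0 : ∀ i : w, gaussianTerm i (0 : E) = 0 := fun i => by
      simpa using gaussianTerm_smul i 0 (0 : E)
    simp [h0, summable_zero]
  add_mem' := by
    intro R S hR hS w b
    simpa [gaussianTerm_add] using (hR w b).add (hS w b)
  smul_mem' := by
    intro c R hR w b
    simpa [gaussianTerm_smul] using (hR w b).const_smul c

variable (H E) in
/-- The space `γ(H, E)` of gamma-radonifying operators, normed below by the `L²`-norm of the
Gaussian sum. -/
def Gamma : Type _ := radonifyingSubmodule H E

instance instAddCommGroupGamma : AddCommGroup (Gamma H E) :=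
  inferInstanceAs (AddCommGroup (radonifyingSubmodule H E))

instance instModuleGamma : Module ℝ (Gamma H E) :=
  inferInstanceAs (Module ℝ (radonifyingSubmodule H E))

/-- The operator underlying an element of `γ(H, E)`. -/
def Gamma.toCLM : Gamma H E →ₗ[ℝ] (H →L[ℝ] E) := (radonifyingSubmodule H E).subtype

theorem Gamma.isRadonifying (R : Gamma H E) : IsRadonifying R.toCLM := R.2

theorem Gamma.toCLM_injective : Function.Injective (Gamma.toCLM : Gamma H E → H →L[ℝ] E) :=
  Subtype.val_injective

/-- The index set of a fixed orthonormal basis of `H`. -/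
def basisSet (H : Type*) [NormedAddCommGroup H] [InnerProductSpace ℝ H] [CompleteSpace H] : Set H :=
  (exists_hilbertBasis ℝ H).choose

/-- A fixed orthonormal basis of `H`. -/
def stdBasis (H : Type*) [NormedAddCommGroup H] [InnerProductSpace ℝ H] [CompleteSpace H] :
    HilbertBasis (basisSet H) ℝ H :=
  (exists_hilbertBasis ℝ H).choose_spec.choose

variable [CompleteSpace H]

/-- `‖R‖ = (𝔼 ‖∑ gᵢ R bᵢ‖²)^(1/2)`; the value does not depend on the orthonormal basis `b`. -/
instance instNormGamma : Norm (Gamma H E) := ⟨fun R => ‖gaussianSum (stdBasis H) R.toCLM‖⟩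

theorem Gamma.norm_def (R : Gamma H E) : ‖R‖ = ‖gaussianSum (stdBasis H) R.toCLM‖ := rfl

theorem gaussianSum_add (R S : Gamma H E) {w : Set H} (b : HilbertBasis w ℝ H) :
    gaussianSum b (R + S).toCLM = gaussianSum b R.toCLM + gaussianSum b S.toCLM := by
  unfold gaussianSum
  rw [← (R.isRadonifying w b).tsum_add (S.isRadonifying w b)]
  simp [gaussianTerm_add]

theorem gaussianSum_smul (c : ℝ) (R : Gamma H E) {w : Set H} (b : HilbertBasis w ℝ H) :
    gaussianSum b (c • R).toCLM = c • gaussianSum b R.toCLM := by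
  unfold gaussianSum
  rw [← (R.isRadonifying w b).tsum_const_smul c]
  simp [gaussianTerm_smul]

variable [CompleteSpace E]

theorem integrable_coord_smul {ι : Type*} (j : ι) (F : Lp E 2 (gaussianSeq ι)) :
    Integrable (fun ω => ω j • F ω) (gaussianSeq ι) :=
  memLp_one_iff_integrable.1 ((Lp.memLp F).smul (memLp_coord_gaussianSeq j))

theorem norm_integral_coord_smul_le {ι : Type*} (j : ι) (F : Lp E 2 (gaussianSeq ι)) :
    ‖∫ ω, ω j • F ω ∂(gaussianSeq ι)‖
      ≤ (eLpNorm (fun ω : ι → ℝ => ω j) 2 (gaussianSeq ι)).toReal * ‖F‖ := by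
  have h1 := eLpNorm_smul_le_mul_eLpNorm (r := 1) (Lp.memLp F).1
    (memLp_coord_gaussianSeq j).1 (p := 2) (q := 2)
  rw [Lp.norm_def, ← ENNReal.toReal_mul]
  refine (norm_integral_le_lintegral_norm _).trans (ENNReal.toReal_mono
    (ENNReal.mul_lt_top (memLp_coord_gaussianSeq j).2 (Lp.memLp F).2).ne (le_trans ?_ h1))
  rw [eLpNorm_one_eq_lintegral_enorm]
  simp only [ofReal_norm]
  rfl

/-- Pairing of a random variable in `L²(Ω; E)` with the `j`-th Gaussian variable. -/
def gaussianCoord {ι : Type*} (j : ι) : Lp E 2 (gaussianSeq ι) →L[ℝ] E :=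
  LinearMap.mkContinuous
    { toFun := fun F => ∫ ω, ω j • F ω ∂(gaussianSeq ι)
      map_add' := by
        intro F G
        rw [← integral_add (integrable_coord_smul j F) (integrable_coord_smul j G)]
        refine integral_congr_ae ?_
        filter_upwards [Lp.coeFn_add F G] with ω h
        rw [h, Pi.add_apply, smul_add]
      map_smul' := by
        intro c F
        simp only [RingHom.id_apply]
        rw [← integral_smul]
        refine integral_congr_ae ?_
        filter_upwards [Lp.coeFn_smul c F] with ω h
        rw [h, Pi.smul_apply, smul_comm] }
    _ (norm_integral_coord_smul_le j)

theorem gaussianCoord_term {ι : Type*} [DecidableEq ι] (i j : ι) (x : E) :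
    gaussianCoord j (gaussianTerm i x) = if i = j then x else 0 := by
  have h1 : gaussianCoord j (gaussianTerm i x) = ∫ ω, (ω j * ω i) • x ∂(gaussianSeq ι) := by
    show ∫ ω, ω j • (gaussianTerm i x) ω ∂(gaussianSeq ι) = _
    refine integral_congr_ae ?_
    filter_upwards [(memLp_coord_smul_gaussianSeq i x).coeFn_toLp] with ω h
    simp only [gaussianTerm, h, mul_smul]
  have hm : ∀ k : ι, MeasurePreserving (Function.eval k) (gaussianSeq ι) (gaussianReal 0 1) :=
    fun k => measurePreserving_eval_infinitePi (fun _ : ι => gaussianReal 0 1) k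
  have hmean : ∀ k : ι, ∫ ω, ω k ∂(gaussianSeq ι) = 0 := fun k => by
    have h := integral_map (hm k).measurable.aemeasurable
      (f := fun y : ℝ => y) (by fun_prop) (μ := gaussianSeq ι)
    rw [(hm k).map_eq, integral_id_gaussianReal] at h
    exact h.symm
  rw [h1, integral_smul_const]
  by_cases hij : i = j
  · subst hij
    have hv : ∫ ω, ω i * ω i ∂(gaussianSeq ι) = 1 := by
      have h := integral_map (hm i).measurable.aemeasurable
        (f := fun y : ℝ => y * y) (by fun_prop) (μ := gaussianSeq ι)
      rw [(hm i).map_eq] at h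
      have h2 := variance_id_gaussianReal (μ := 0) (v := 1)
      rw [variance_eq_integral (by fun_prop)] at h2
      simp only [id, integral_id_gaussianReal, sub_zero, NNReal.coe_one, pow_two] at h2
      exact h.symm.trans h2
    simp [hv]
  · have hind : IndepFun (fun ω : ι → ℝ => ω j) (fun ω => ω i) (gaussianSeq ι) :=
      (iIndepFun_infinitePi (P := fun _ : ι => gaussianReal 0 1) (X := fun _ y => y)
        (by fun_prop)).indepFun (Ne.symm hij)
    have h := hind.integral_fun_mul_eq_mul_integral
      (memLp_coord_gaussianSeq j).1 (memLp_coord_gaussianSeq i).1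
    simp only [hmean, mul_zero] at h
    simp [h, hij]

theorem Gamma.eq_zero_of_norm_eq_zero (R : Gamma H E) (h : ‖R‖ = 0) : R = 0 := by
  classical
  rw [Gamma.norm_def, norm_eq_zero] at h
  have hb : ∀ j, R.toCLM (stdBasis H j) = 0 := by
    intro j
    have h2 := (gaussianCoord (E := E) j).map_tsum (R.isRadonifying _ (stdBasis H))
    simp only [gaussianCoord_term] at h2
    unfold gaussianSum at h
    rw [h, map_zero, tsum_ite_eq j (fun z => R.toCLM (stdBasis H z))] at h2
    exact h2.symm
  apply Gamma.toCLM_injective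
  rw [map_zero]
  refine ContinuousLinearMap.ext_on (s := Set.range (stdBasis H)) ?_ ?_
  · have hd := (stdBasis H).dense_span
    rw [Submodule.dense_iff_topologicalClosure_eq_top]
    exact hd
  · rintro _ ⟨j, rfl⟩
    simp [hb]

theorem Gamma.normedSpaceCore : NormedSpace.Core ℝ (Gamma H E) where
  norm_nonneg R := norm_nonneg (gaussianSum (stdBasis H) R.toCLM)
  norm_smul c R := by
    rw [Gamma.norm_def, Gamma.norm_def, gaussianSum_smul, norm_smul]
  norm_triangle R S := by
    rw [Gamma.norm_def, gaussianSum_add]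
    exact norm_add_le _ _
  norm_eq_zero_iff R := by
    refine ⟨R.eq_zero_of_norm_eq_zero, ?_⟩
    rintro rfl
    have := gaussianSum_smul 0 (0 : Gamma H E) (stdBasis H)
    rw [zero_smul, zero_smul] at this
    rw [Gamma.norm_def, this, norm_zero]

instance instNormedAddCommGroupGamma : NormedAddCommGroup (Gamma H E) :=
  NormedAddCommGroup.ofCore Gamma.normedSpaceCore

instance instNormedSpaceGamma : NormedSpace ℝ (Gamma H E) :=
  NormedSpace.ofCore Gamma.normedSpaceCore

end Gamma

/-! ## Besov spaces on an interval -/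

section Besov

variable {F : Type*} [NormedAddCommGroup F]

/-- Lebesgue measure on the interval `(0, T)`. -/
abbrev intervalMeasure (T : ℝ) : Measure ℝ := volume.restrict (Ioo 0 T)

/-- The translate of `φ : (0, T) → F` by `h`, extended by `0`. -/
def translateZero (T h : ℝ) (φ : ℝ → F) : ℝ → F :=
  {t | t + h ∈ Ioo 0 T}.indicator fun t => φ (t + h)

/-- The set of all `r ∈ (0, T)` with `r + h ∈ (0, T)`. -/
def shiftDomain (T h : ℝ) : Set ℝ := {r | r ∈ Ioo 0 T ∧ r + h ∈ Ioo 0 T}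

/-- The `L^p`-modulus of continuity of `φ : (0, T) → F`. -/
def modulus (T : ℝ) (p : ℝ≥0∞) (φ : ℝ → F) (t : ℝ) : ℝ≥0∞ :=
  ⨆ (h : ℝ) (_ : |h| ≤ t),
    eLpNorm (fun r => translateZero T h φ r - φ r) p (volume.restrict (shiftDomain T h))

/-- The measure `dt / t` on `(0, 1)`. -/
def logMeasure : Measure ℝ :=
  (volume.restrict (Ioo 0 1)).withDensity fun t => ENNReal.ofReal t⁻¹

/-- The norm `‖φ‖_{L^p(0,T;F)} + ‖t ↦ t^(-s) ϱ_p(φ, t)‖_{L^q((0,1), dt/t)}`, with values in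
`[0, ∞]`. -/
def besovENorm (T s : ℝ) (p q : ℝ≥0∞) (φ : ℝ → F) : ℝ≥0∞ :=
  eLpNorm φ p (intervalMeasure T) +
    eLpNorm (fun t => ENNReal.ofReal (t ^ (-s)) * modulus T p φ t) q logMeasure

theorem modulus_congr_ae {T : ℝ} {p : ℝ≥0∞} {φ ψ : ℝ → F} (h : φ =ᵐ[intervalMeasure T] ψ) :
    modulus T p φ = modulus T p ψ := by
  ext t
  refine iSup_congr fun h' => iSup_congr fun _ => eLpNorm_congr_ae ?_
  have hI : MeasurableSet (Ioo (0 : ℝ) T) := measurableSet_Ioo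
  have h1 := (ae_restrict_iff' hI).1 h
  have h2 := (measurePreserving_add_right volume h').quasiMeasurePreserving.ae h1
  have hS : MeasurableSet (shiftDomain T h') :=
    hI.inter ((by fun_prop : Measurable fun r : ℝ => r + h') hI)
  refine (ae_restrict_iff' hS).2 ?_
  filter_upwards [h1, h2] with r hr1 hr2 hr
  have hr' : r ∈ {t | t + h' ∈ Ioo 0 T} := hr.2
  simp only [translateZero, indicator_of_mem hr', hr1 hr.1, hr2 hr.2]

theorem besovENorm_congr_ae {T s : ℝ} {p q : ℝ≥0∞} {φ ψ : ℝ → F}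
    (h : φ =ᵐ[intervalMeasure T] ψ) : besovENorm T s p q φ = besovENorm T s p q ψ := by
  unfold besovENorm
  rw [eLpNorm_congr_ae h, modulus_congr_ae h]

theorem measurable_modulus (T : ℝ) (p : ℝ≥0∞) (φ : ℝ → F) : Measurable (modulus T p φ) := by
  refine Monotone.measurable fun t u htu => ?_
  exact iSup_mono fun h => iSup_const_mono fun ht => le_trans ht htu

theorem measurable_weighted_modulus (T s : ℝ) (p : ℝ≥0∞) (φ : ℝ → F) :
    Measurable fun t : ℝ => ENNReal.ofReal (t ^ (-s)) * modulus T p φ t :=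
  (by fun_prop : Measurable fun t : ℝ => ENNReal.ofReal (t ^ (-s))).mul (measurable_modulus T p φ)

theorem stronglyMeasurable_translateZero (T h : ℝ) {φ : ℝ → F} (hφ : StronglyMeasurable φ) :
    StronglyMeasurable (translateZero T h φ) := by
  refine (hφ.comp_measurable (by fun_prop)).indicator ?_
  exact (by fun_prop : Measurable fun t : ℝ => t + h) measurableSet_Ioo

theorem modulus_add_le {T : ℝ} {p : ℝ≥0∞} (hp : 1 ≤ p) {φ ψ : ℝ → F} (hφ : StronglyMeasurable φ)
    (hψ : StronglyMeasurable ψ) (t : ℝ) :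
    modulus T p (φ + ψ) t ≤ modulus T p φ t + modulus T p ψ t := by
  refine iSup₂_le fun h ht => ?_
  have e : (fun r => translateZero T h (φ + ψ) r - (φ + ψ) r) =
      (fun r => translateZero T h φ r - φ r) + fun r => translateZero T h ψ r - ψ r := by
    ext r
    by_cases hr : r ∈ {t | t + h ∈ Ioo 0 T}
    · simp only [translateZero, indicator_of_mem hr, Pi.add_apply]
      abel
    · simp only [translateZero, indicator_of_notMem hr, Pi.add_apply]
      abel
  rw [e]
  refine (eLpNorm_add_le ((stronglyMeasurable_translateZero T h hφ).sub hφ).aestronglyMeasurable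
    ((stronglyMeasurable_translateZero T h hψ).sub hψ).aestronglyMeasurable hp).trans ?_
  exact add_le_add (le_iSup₂_of_le h ht le_rfl) (le_iSup₂_of_le h ht le_rfl)

theorem besovENorm_add_le {T s : ℝ} {p q : ℝ≥0∞} (hp : 1 ≤ p) (hq : 1 ≤ q) {φ ψ : ℝ → F}
    (hφ : StronglyMeasurable φ) (hψ : StronglyMeasurable ψ) :
    besovENorm T s p q (φ + ψ) ≤ besovENorm T s p q φ + besovENorm T s p q ψ := by
  unfold besovENorm
  rw [add_add_add_comm]
  refine add_le_add (eLpNorm_add_le hφ.aestronglyMeasurable hψ.aestronglyMeasurable hp) ?_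
  refine (eLpNorm_mono_enorm (g := (fun t => ENNReal.ofReal (t ^ (-s)) * modulus T p φ t) +
    fun t => ENNReal.ofReal (t ^ (-s)) * modulus T p ψ t) fun t => ?_).trans
    (eLpNorm_add_le (measurable_weighted_modulus T s p φ).aestronglyMeasurable
      (measurable_weighted_modulus T s p ψ).aestronglyMeasurable hq)
  simp only [enorm_eq_self, Pi.add_apply, ← mul_add]
  gcongr
  exact modulus_add_le hp hφ hψ t

variable [NormedSpace ℝ F]

theorem modulus_smul (T : ℝ) (p : ℝ≥0∞) (c : ℝ) (φ : ℝ → F) (t : ℝ) :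
    modulus T p (c • φ) t = ‖c‖ₑ * modulus T p φ t := by
  unfold modulus
  simp only [ENNReal.mul_iSup]
  refine iSup_congr fun h => iSup_congr fun _ => ?_
  rw [← eLpNorm_const_smul]
  congr 1
  ext r
  by_cases hr : r ∈ {t | t + h ∈ Ioo 0 T}
  · simp only [translateZero, indicator_of_mem hr, Pi.smul_apply, smul_sub]
  · simp only [translateZero, indicator_of_notMem hr, Pi.smul_apply, smul_sub, smul_zero]

theorem eLpNorm_nnreal_mul (c : ℝ≥0) (g : ℝ → ℝ≥0∞) (q : ℝ≥0∞) (μ : Measure ℝ) :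
    eLpNorm (fun t => (c : ℝ≥0∞) * g t) q μ = c * eLpNorm g q μ := by
  have key : ∀ (d : ℝ≥0) (g : ℝ → ℝ≥0∞),
      eLpNorm (fun t => (d : ℝ≥0∞) * g t) q μ ≤ d * eLpNorm g q μ := fun d g =>
    eLpNorm_le_nnreal_smul_eLpNorm_of_ae_le_mul' (ae_of_all _ fun t => le_rfl) q
  rcases eq_or_ne c 0 with rfl | hc
  · simp
  have hc' : (c : ℝ≥0∞) ≠ 0 := by simpa using hc
  refine le_antisymm (key c g) ?_
  have h := key c⁻¹ fun t => (c : ℝ≥0∞) * g t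
  simp only [ENNReal.coe_inv hc, ← mul_assoc, ENNReal.inv_mul_cancel hc' ENNReal.coe_ne_top,
    one_mul] at h
  calc (c : ℝ≥0∞) * eLpNorm g q μ
      ≤ c * ((c : ℝ≥0∞)⁻¹ * eLpNorm (fun t => (c : ℝ≥0∞) * g t) q μ) := by gcongr
    _ = _ := by rw [← mul_assoc, ENNReal.mul_inv_cancel hc' ENNReal.coe_ne_top, one_mul]

theorem besovENorm_smul (T s : ℝ) (p q : ℝ≥0∞) (c : ℝ) (φ : ℝ → F) :
    besovENorm T s p q (c • φ) = ‖c‖ₑ * besovENorm T s p q φ := by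
  unfold besovENorm
  rw [eLpNorm_const_smul, mul_add]
  congr 1
  simp only [modulus_smul, mul_left_comm _ ‖c‖ₑ]
  exact eLpNorm_nnreal_mul ‖c‖₊ _ q _

theorem besovENorm_coe_smul (T s : ℝ) (p q : ℝ≥0∞) (c : ℝ) (f : Lp F p (intervalMeasure T)) :
    besovENorm T s p q (c • f : Lp F p (intervalMeasure T)) = ‖c‖ₑ * besovENorm T s p q f := by
  rw [besovENorm_congr_ae (Lp.coeFn_smul c f)]
  exact besovENorm_smul T s p q c f

variable (T s : ℝ) (p q : ℝ≥0∞) [hp : Fact (1 ≤ p)] [hq : Fact (1 ≤ q)]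

theorem besovENorm_coe_add_le (f g : Lp F p (intervalMeasure T)) :
    besovENorm T s p q (f + g : Lp F p (intervalMeasure T))
      ≤ besovENorm T s p q f + besovENorm T s p q g := by
  rw [besovENorm_congr_ae (Lp.coeFn_add f g)]
  exact besovENorm_add_le hp.out hq.out (Lp.stronglyMeasurable f) (Lp.stronglyMeasurable g)

variable (F) in
/-- The linear space of all `φ ∈ L^p(0, T; F)` with finite Besov norm. -/
def besovSubmodule : Submodule ℝ (Lp F p (intervalMeasure T)) where
  carrier := {f | besovENorm T s p q f < ∞}
  zero_mem' := by
    have h := besovENorm_coe_smul T s p q 0 (0 : Lp F p (intervalMeasure T))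
    rw [zero_smul, enorm_zero, zero_mul] at h
    show besovENorm T s p q _ < ∞
    rw [h]
    exact ENNReal.zero_lt_top
  add_mem' := by
    intro f g hf hg
    exact (besovENorm_coe_add_le T s p q f g).trans_lt (ENNReal.add_lt_top.2 ⟨hf, hg⟩)
  smul_mem' := by
    intro c f hf
    show besovENorm T s p q _ < ∞
    rw [besovENorm_coe_smul]
    exact ENNReal.mul_lt_top enorm_lt_top hf

variable (F) in
/-- The Besov space `Λ^s_{p,q}(0, T; F)`, normed below by `besovENorm`. -/
def Besov : Type _ := besovSubmodule F T s p q

instance instAddCommGroupBesov : AddCommGroup (Besov F T s p q) :=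
  inferInstanceAs (AddCommGroup (besovSubmodule F T s p q))

instance instModuleBesov : Module ℝ (Besov F T s p q) :=
  inferInstanceAs (Module ℝ (besovSubmodule F T s p q))

variable {T s p q}

/-- The element of `L^p(0, T; F)` underlying an element of the Besov space. -/
def Besov.toLp : Besov F T s p q →ₗ[ℝ] Lp F p (intervalMeasure T) :=
  (besovSubmodule F T s p q).subtype

theorem Besov.besovENorm_lt_top (f : Besov F T s p q) : besovENorm T s p q f.toLp < ∞ := f.2

theorem Besov.toLp_injective :
    Function.Injective (Besov.toLp : Besov F T s p q → Lp F p (intervalMeasure T)) :=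
  Subtype.val_injective

instance instNormBesov : Norm (Besov F T s p q) :=
  ⟨fun f => (besovENorm T s p q f.toLp).toReal⟩

theorem Besov.norm_def (f : Besov F T s p q) : ‖f‖ = (besovENorm T s p q f.toLp).toReal := rfl

theorem Besov.norm_smul' (c : ℝ) (f : Besov F T s p q) : ‖c • f‖ = ‖c‖ * ‖f‖ := by
  rw [Besov.norm_def, Besov.norm_def, map_smul, besovENorm_coe_smul, ENNReal.toReal_mul,
    toReal_enorm]

theorem Besov.normedSpaceCore : NormedSpace.Core ℝ (Besov F T s p q) where
  norm_nonneg _ := ENNReal.toReal_nonneg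
  norm_smul := Besov.norm_smul'
  norm_triangle f g := by
    rw [Besov.norm_def, Besov.norm_def, Besov.norm_def, map_add,
      ← ENNReal.toReal_add f.besovENorm_lt_top.ne g.besovENorm_lt_top.ne]
    exact ENNReal.toReal_mono
      (ENNReal.add_lt_top.2 ⟨f.besovENorm_lt_top, g.besovENorm_lt_top⟩).ne
      (besovENorm_coe_add_le T s p q _ _)
  norm_eq_zero_iff f := by
    constructor
    · intro h
      rw [Besov.norm_def, ENNReal.toReal_eq_zero_iff] at h
      have h0 := h.resolve_right f.besovENorm_lt_top.ne
      have h1 : eLpNorm f.toLp p (intervalMeasure T) = 0 := (add_eq_zero.1 h0).1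
      apply Besov.toLp_injective
      rw [map_zero, ← norm_eq_zero, Lp.norm_def, h1, ENNReal.toReal_zero]
    · rintro rfl
      simpa using Besov.norm_smul' 0 (0 : Besov F T s p q)

instance instNormedAddCommGroupBesov : NormedAddCommGroup (Besov F T s p q) :=
  NormedAddCommGroup.ofCore Besov.normedSpaceCore

instance instNormedSpaceBesov : NormedSpace ℝ (Besov F T s p q) :=
  NormedSpace.ofCore Besov.normedSpaceCore

end Besov

/-! ## Operators represented by a function -/

/-- `Φ : (0, T) → L(H, E)` represents the operator `R : L²(0, T; H) → E`: the function `Φ` is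
`H`-strongly measurable and, for every `x' ∈ E'`, the function `Φ' x'` belongs to `L²(0, T; H)` and
`⟨R f, x'⟩ = ∫₀ᵀ ⟪f t, Φ(t)' x'⟫ dt` for all `f`. Here `Φ(t)' x' ∈ H` is the Riesz representative of
the functional `x' ∘ Φ(t)`. -/
def Represents {H E : Type*} [NormedAddCommGroup H] [InnerProductSpace ℝ H] [CompleteSpace H]
    [NormedAddCommGroup E] [NormedSpace ℝ E] (T : ℝ) (Φ : ℝ → H →L[ℝ] E)
    (R : Lp H 2 (intervalMeasure T) →L[ℝ] E) : Prop :=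
  (∀ h : H, AEStronglyMeasurable (fun t => Φ t h) (intervalMeasure T)) ∧
  ∀ x' : StrongDual ℝ E,
    MemLp (fun t => (InnerProductSpace.toDual ℝ H).symm (x' ∘L Φ t)) 2 (intervalMeasure T) ∧
    ∀ f : Lp H 2 (intervalMeasure T),
      x' (R f) = ∫ t, inner ℝ (f t) ((InnerProductSpace.toDual ℝ H).symm (x' ∘L Φ t))
        ∂(intervalMeasure T)

end

/-! Type implies embedding. Expand `Φ` in the Haar system of `L²(0, T)`. The operator represented by
`Φ` is the sum of `h_j ⊗ S_j`, with `S_j ∈ γ(H, E)` the `j`-th Haar coefficient, and its Gaussian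
sum is that of the vectors `S_j b_i`, for an orthonormal basis `b` of `H`. The blocks with fixed `j`
are independent and symmetric, so type `p` bounds the whole sum by a multiple of `(∑ ‖S_j‖^p)^(1/p)`
(`norm_sum_sigma_gaussianTerm_le`, `summable_sigma_gaussianTerm`). A Haar coefficient on an interval
of length `2τ` is `(2τ)^(-1/2)` times the integral of `Φ(t) - Φ(t + τ)` over the left half. By
Hölder, the `p`-th powers of one generation add up to at most `τ^(p/2 - 1) ϱ_p(Φ, τ)^p`. Since `-sp
= p/2 - 1` for `s = 1/p - 1/2`, summing over dyadic `τ` gives a discretized Besov norm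
(`tsum_haarIncr_rpow_le`).

The operator is built from its coefficients by `exists_gamma_of_isBessel`, which needs only Bessel's
inequality and rests on the comparison of Gaussian sums `eLpNorm_gaussian_le`. That it is
represented by `Φ` is not automatic: `Φ* x'` is a priori only integrable, and
`ae_eq_of_hasSum_haarIncr` identifies it with an `L²`-function through its Haar coefficients. Haar
functions never occur explicitly; coefficients are differences of a primitive at dyadic points.
Injectivity of `J` is `Represents.ae_eq_zero`, where separability of `H` enters.

Embedding implies type. For `x_1, …, x_N` in `E` and a unit vector `y` of `H`, take the step
function with values `⟪y, ·⟫ x_n` on `N` disjoint intervals of length `δ`. Its Besov norm is at most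
a constant times `√δ (∑ ‖x_n‖^p)^(1/p)` (`besovENorm_stepFun_le`), and its operator sends the
normalized indicators times `y` to `√δ x_n`. The factor `√δ` cancels, which bounds the Gaussian sum
of the `x_n`, and Gaussian sums dominate Rademacher sums (`sum_sign_le_gaussian`). -/

noncomputable section

/-! ## Finite Gaussian sums -/

section FiniteGaussian

variable {ι κ : Type*} {E : Type*} [NormedAddCommGroup E] [NormedSpace ℝ E]

theorem measurePreserving_comp_gaussianSeq {f : κ → ι} (hf : Function.Injective f) :
    MeasurePreserving (fun (ω : ι → ℝ) k => ω (f k)) (gaussianSeq ι) (gaussianSeq κ) := by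
  refine ⟨by fun_prop, ?_⟩
  have h : iIndepFun (fun (k : κ) (ω : ι → ℝ) => ω (f k)) (gaussianSeq ι) :=
    (iIndepFun_infinitePi (P := fun _ : ι => gaussianReal 0 1) (X := fun _ y => y)
      (by fun_prop)).precomp hf
  rw [(iIndepFun_iff_map_fun_eq_infinitePi_map (by fun_prop)).1 h, gaussianSeq]
  congr 1
  ext1 k
  exact (measurePreserving_eval_infinitePi (fun _ : ι => gaussianReal 0 1) (f k)).map_eq

theorem measurePreserving_sign_gaussianSeq {s : ι → ℝ} (hs : ∀ i, s i = 1 ∨ s i = -1) :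
    MeasurePreserving (fun (ω : ι → ℝ) i => s i * ω i) (gaussianSeq ι) (gaussianSeq ι) := by
  refine ⟨by fun_prop, ?_⟩
  rw [gaussianSeq, Measure.infinitePi_map_pi _ (f := fun i y => s i * y) (by fun_prop)]
  congr 1
  ext1 i
  rw [gaussianReal_map_const_mul]
  rcases hs i with h | h <;> simp [h]

theorem integral_cexp_gaussianSeq [Fintype κ] (a : κ → ℝ) :
    ∫ ω, Complex.exp (((∑ k, a k * ω k : ℝ) : ℂ) * Complex.I) ∂(gaussianSeq κ) =
      Complex.exp (((-(∑ k, a k ^ 2) / 2 : ℝ) : ℂ)) := by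
  have h1 : ∀ ω : κ → ℝ, Complex.exp (((∑ k, a k * ω k : ℝ) : ℂ) * Complex.I) =
      ∏ k, Complex.exp (((a k * ω k : ℝ) : ℂ) * Complex.I) := fun ω => by
    rw [← Complex.exp_sum, Complex.ofReal_sum, Finset.sum_mul]
  simp_rw [h1]
  rw [gaussianSeq, Measure.infinitePi_eq_pi, integral_fintype_prod_eq_prod
    (fun k y => Complex.exp (((a k * y : ℝ) : ℂ) * Complex.I))]
  have h2 : ∀ k, ∫ y, Complex.exp (((a k * y : ℝ) : ℂ) * Complex.I) ∂(gaussianReal 0 1) =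
      Complex.exp (((-(a k ^ 2) / 2 : ℝ) : ℂ)) := fun k => by
    have := charFun_gaussianReal (μ := 0) (v := 1) (a k)
    rw [charFun_apply_real] at this
    push_cast
    rw [this]
    congr 1
    push_cast
    ring
  simp_rw [h2]
  rw [← Complex.exp_sum, ← Complex.ofReal_sum]
  congr 2
  rw [← Finset.sum_div, Finset.sum_neg_distrib]

/-- The hypothesis says `MᵀM + BᵀB = 1`, so the centred Gaussian vector `Mᵀγ + Bᵀγ'` has identity
covariance. The laws are compared through characteristic functions. -/
theorem measurePreserving_gaussianSeq_of_covariance {κ' : Type*} [Fintype ι] [Fintype κ]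
    [Fintype κ'] (M : Matrix κ ι ℝ) (B : Matrix κ' ι ℝ)
    (h : ∀ v : ι → ℝ, ∑ k, (∑ j, M k j * v j) ^ 2 + ∑ k, (∑ j, B k j * v j) ^ 2 = ∑ j, v j ^ 2) :
    MeasurePreserving (fun (z : (κ → ℝ) × (κ' → ℝ)) j => ∑ k, z.1 k * M k j + ∑ k, z.2 k * B k j)
      ((gaussianSeq κ).prod (gaussianSeq κ')) (gaussianSeq ι) := by
  have hm : Measurable
      (fun (z : (κ → ℝ) × (κ' → ℝ)) j => ∑ k, z.1 k * M k j + ∑ k, z.2 k * B k j) := by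
    fun_prop
  refine ⟨hm, ?_⟩
  have hL : Measurable (WithLp.toLp 2 : (ι → ℝ) → EuclideanSpace ℝ ι) := by fun_prop
  have hL' : Measurable (WithLp.ofLp : EuclideanSpace ℝ ι → (ι → ℝ)) := by fun_prop
  -- Characteristic functions refer to an inner product, so both laws are transported to
  -- `EuclideanSpace ℝ ι`.
  suffices hs : ((((gaussianSeq κ).prod (gaussianSeq κ')).map
      (fun z j => ∑ k, z.1 k * M k j + ∑ k, z.2 k * B k j)).map
        (WithLp.toLp 2 : (ι → ℝ) → EuclideanSpace ℝ ι)) =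
      (gaussianSeq ι).map (WithLp.toLp 2 : (ι → ℝ) → EuclideanSpace ℝ ι) by
    have := congrArg (Measure.map (WithLp.ofLp : EuclideanSpace ℝ ι → (ι → ℝ))) hs
    rw [Measure.map_map hL' hL, Measure.map_map hL' hL] at this
    simpa [Function.comp_def] using this
  have : IsProbabilityMeasure (((gaussianSeq κ).prod (gaussianSeq κ')).map
      (fun z j => ∑ k, z.1 k * M k j + ∑ k, z.2 k * B k j)) :=
    Measure.isProbabilityMeasure_map hm.aemeasurable
  apply Measure.ext_of_charFun
  ext t
  rw [charFun_apply, charFun_apply, integral_map hL.aemeasurable (by fun_prop),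
    integral_map hL.aemeasurable (by fun_prop), integral_map hm.aemeasurable (by fun_prop)]
  simp only [PiLp.inner_apply, RCLike.inner_apply, conj_trivial]
  rw [integral_cexp_gaussianSeq, ← h]
  have e : ∀ z : (κ → ℝ) × (κ' → ℝ),
      Complex.exp (((∑ j, t j * (∑ k, z.1 k * M k j + ∑ k, z.2 k * B k j) : ℝ) : ℂ) * Complex.I) =
      Complex.exp (((∑ k, (∑ j, M k j * t j) * z.1 k : ℝ) : ℂ) * Complex.I) *
      Complex.exp (((∑ k, (∑ j, B k j * t j) * z.2 k : ℝ) : ℂ) * Complex.I) := fun z => by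
    rw [← Complex.exp_add, ← add_mul, ← Complex.ofReal_add]
    congr 3
    simp only [mul_add, Finset.sum_add_distrib, Finset.mul_sum, Finset.sum_mul]
    congr 1 <;>
    · rw [Finset.sum_comm]
      refine Finset.sum_congr rfl fun _ _ => Finset.sum_congr rfl fun _ _ => by ring
  simp_rw [e]
  rw [integral_prod_mul
    (fun γ : κ → ℝ => Complex.exp (((∑ k, (∑ j, M k j * t j) * γ k : ℝ) : ℂ) * Complex.I))
    (fun γ : κ' → ℝ => Complex.exp (((∑ k, (∑ j, B k j * t j) * γ k : ℝ) : ℂ) * Complex.I)),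
    integral_cexp_gaussianSeq, integral_cexp_gaussianSeq, ← Complex.exp_add, ← Complex.ofReal_add]
  congr 2
  ring

theorem sum_sq_mulVec [Fintype ι] [Fintype κ] (N : Matrix κ ι ℝ) (v : ι → ℝ) :
    ∑ k, (∑ j, N k j * v j) ^ 2 = v ⬝ᵥ (N.transpose * N).mulVec v := by
  rw [← Matrix.mulVec_mulVec, Matrix.dotProduct_mulVec, Matrix.vecMul_transpose]
  simp [dotProduct, Matrix.mulVec, pow_two]

open scoped MatrixOrder in
-- `1 - MᵀM` is positive semidefinite, and `B` is its square root.
theorem exists_matrix_complement [Fintype ι] [Fintype κ] (M : Matrix κ ι ℝ)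
    (h : ∀ v : ι → ℝ, ∑ k, (∑ j, M k j * v j) ^ 2 ≤ ∑ j, v j ^ 2) :
    ∃ B : Matrix ι ι ℝ, ∀ v : ι → ℝ,
      ∑ k, (∑ j, M k j * v j) ^ 2 + ∑ k, (∑ j, B k j * v j) ^ 2 = ∑ j, v j ^ 2 := by
  classical
  have h0 : ∀ v : ι → ℝ, ∑ j, v j ^ 2 = v ⬝ᵥ (1 : Matrix ι ι ℝ).mulVec v := fun v => by
    simp [dotProduct, pow_two]
  have hpos : (1 - M.transpose * M).PosSemidef := by
    refine Matrix.PosSemidef.of_dotProduct_mulVec_nonneg ?_ fun v => ?_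
    · simp [Matrix.IsHermitian, Matrix.conjTranspose_eq_transpose_of_trivial,
        Matrix.transpose_sub, Matrix.transpose_mul]
    · have := h v
      rw [sum_sq_mulVec, h0] at this
      simpa [Matrix.sub_mulVec, dotProduct_sub] using this
  obtain ⟨B, hB⟩ : ∃ B : Matrix ι ι ℝ, 1 - M.transpose * M = star B * B := by
    refine ⟨CFC.sqrt (1 - M.transpose * M), ?_⟩
    rw [(CFC.sqrt_nonneg _).isSelfAdjoint.star_eq, CFC.sqrt_mul_sqrt_self _ hpos.nonneg]
  refine ⟨B, fun v => ?_⟩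
  rw [sum_sq_mulVec, sum_sq_mulVec, h0, ← dotProduct_add, ← Matrix.add_mulVec]
  congr 2
  rw [Matrix.star_eq_conjTranspose, Matrix.conjTranspose_eq_transpose_of_trivial] at hB
  rw [← hB]
  abel

theorem aestronglyMeasurable_sum_smul (F : Finset ι) (x : ι → E) (μ : Measure (ι → ℝ)) :
    AEStronglyMeasurable (fun ω : ι → ℝ => ∑ j ∈ F, ω j • x j) μ :=
  Finset.aestronglyMeasurable_fun_sum _ fun j _ =>
    (measurable_pi_apply j).aestronglyMeasurable.smul_const (x j)

/-- Complete `M` by `B` so that `Mᵀγ + Bᵀγ'` and `Mᵀγ - Bᵀγ'` are both standard Gaussian. The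
left-hand sum is the average of the right-hand sum evaluated at these two vectors, and the triangle
inequality concludes. -/
theorem eLpNorm_gaussian_le [Fintype ι] [Fintype κ] (M : Matrix κ ι ℝ)
    (h : ∀ v : ι → ℝ, ∑ k, (∑ j, M k j * v j) ^ 2 ≤ ∑ j, v j ^ 2) (x : ι → E) :
    eLpNorm (fun γ : κ → ℝ => ∑ k, γ k • ∑ j, M k j • x j) 2 (gaussianSeq κ) ≤
      eLpNorm (fun ω : ι → ℝ => ∑ j, ω j • x j) 2 (gaussianSeq ι) := by
  obtain ⟨B, hB⟩ := exists_matrix_complement M h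
  have hP := measurePreserving_gaussianSeq_of_covariance M B hB
  have hB' : ∀ v : ι → ℝ,
      ∑ k, (∑ j, M k j * v j) ^ 2 + ∑ k, (∑ j, (-B) k j * v j) ^ 2 = ∑ j, v j ^ 2 := fun v => by
    rw [← hB v]
    simp
  have hN := measurePreserving_gaussianSeq_of_covariance M (-B) hB'
  set X : (κ → ℝ) → E := fun γ => ∑ k, γ k • ∑ j, M k j • x j with hX
  set G : (ι → ℝ) → E := fun ω => ∑ j, ω j • x j with hG
  have hGm : AEStronglyMeasurable G (gaussianSeq ι) := aestronglyMeasurable_sum_smul _ _ _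
  have hXm : AEStronglyMeasurable X (gaussianSeq κ) := aestronglyMeasurable_sum_smul _ _ _
  have e1 := eLpNorm_comp_measurePreserving (p := 2) hGm hP
  have e2 := eLpNorm_comp_measurePreserving (p := 2) hGm hN
  have e3 := eLpNorm_comp_measurePreserving (p := 2) hXm
    (measurePreserving_fst (μ := gaussianSeq κ) (ν := gaussianSeq ι))
  have m1 := hGm.comp_measurePreserving hP
  have m2 := hGm.comp_measurePreserving hN
  have key : X ∘ Prod.fst = (2⁻¹ : ℝ) •
      ((G ∘ fun (z : (κ → ℝ) × (ι → ℝ)) j => ∑ k, z.1 k * M k j + ∑ k, z.2 k * B k j) +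
      (G ∘ fun (z : (κ → ℝ) × (ι → ℝ)) j => ∑ k, z.1 k * M k j + ∑ k, z.2 k * (-B) k j)) := by
    ext z
    simp only [hX, hG, Function.comp, Pi.smul_apply, Pi.add_apply, ← Finset.sum_add_distrib,
      ← add_smul, Matrix.neg_apply, mul_neg, Finset.sum_neg_distrib]
    simp only [Finset.smul_sum, smul_smul]
    rw [Finset.sum_comm]
    refine Finset.sum_congr rfl fun j _ => ?_
    rw [← Finset.sum_smul]
    congr 1
    ring
  rw [← e3, key, eLpNorm_const_smul]
  refine (mul_le_mul_right (eLpNorm_add_le m1 m2 (by norm_num)) _).trans ?_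
  rw [e1, e2, ← two_mul, ← mul_assoc]
  have : ‖(2⁻¹ : ℝ)‖ₑ * 2 = 1 := by
    rw [enorm_inv (by norm_num), Real.enorm_eq_ofReal (by norm_num)]
    simp [ENNReal.inv_mul_cancel]
  rw [this, one_mul]

theorem coeFn_sum_gaussianTerm (F : Finset ι) (x : ι → E) :
    (∑ j ∈ F, gaussianTerm j (x j) : Lp E 2 (gaussianSeq ι)) =ᵐ[gaussianSeq ι]
      fun ω => ∑ j ∈ F, ω j • x j := by
  have h1 : ∀ j ∈ F, (gaussianTerm j (x j) : Lp E 2 (gaussianSeq ι)) =ᵐ[gaussianSeq ι]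
      fun ω => ω j • x j := fun j _ => MemLp.coeFn_toLp _
  have h2 : ∀ᵐ ω ∂gaussianSeq ι, ∀ j ∈ F,
      (gaussianTerm j (x j) : Lp E 2 (gaussianSeq ι)) ω = ω j • x j :=
    (Filter.eventually_all_finset F).2 h1
  filter_upwards [h2, Lp.coeFn_fun_finsetSum F fun j => gaussianTerm j (x j)] with ω h h'
  rw [h']
  exact Finset.sum_congr rfl h

theorem enorm_sum_gaussianTerm (F : Finset ι) (x : ι → E) :
    ‖(∑ j ∈ F, gaussianTerm j (x j) : Lp E 2 (gaussianSeq ι))‖ₑ =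
      eLpNorm (fun ω : ι → ℝ => ∑ j ∈ F, ω j • x j) 2 (gaussianSeq ι) := by
  rw [Lp.enorm_def, eLpNorm_congr_ae (coeFn_sum_gaussianTerm F x)]

theorem enorm_sum_gaussianTerm_reindex [Fintype κ] {f : κ → ι} (hf : Function.Injective f)
    (x : ι → E) (F : Finset ι) (hF : F = Finset.univ.map ⟨f, hf⟩) :
    ‖(∑ j ∈ F, gaussianTerm j (x j) : Lp E 2 (gaussianSeq ι))‖ₑ =
      eLpNorm (fun ω : κ → ℝ => ∑ k, ω k • x (f k)) 2 (gaussianSeq κ) := by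
  rw [enorm_sum_gaussianTerm, ← eLpNorm_comp_measurePreserving
    (aestronglyMeasurable_sum_smul _ (fun k => x (f k)) _) (measurePreserving_comp_gaussianSeq hf)]
  congr 1
  ext ω
  simp [hF]

/-- Only the coordinates in `F` matter; this reduces infinite families to the matrix comparison. -/
theorem enorm_sum_gaussianTerm_subtype (F : Finset ι) (x : ι → E) :
    ‖(∑ j ∈ F, gaussianTerm j (x j) : Lp E 2 (gaussianSeq ι))‖ₑ =
      eLpNorm (fun ω : F → ℝ => ∑ k, ω k • x k) 2 (gaussianSeq F) :=
  enorm_sum_gaussianTerm_reindex Subtype.val_injective x F (by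
    ext i
    simp)

/-- Comparison of finite Gaussian sums: the norm does not increase under a contraction acting on
the coefficients. -/
theorem norm_sum_gaussianTerm_le (F : Finset ι) (W : Finset κ) (M : κ → ι → ℝ)
    (h : ∀ v : ι → ℝ, ∑ k ∈ W, (∑ j ∈ F, M k j * v j) ^ 2 ≤ ∑ j ∈ F, v j ^ 2) (x : ι → E) :
    ‖(∑ k ∈ W, gaussianTerm k (∑ j ∈ F, M k j • x j) : Lp E 2 (gaussianSeq κ))‖ ≤
      ‖(∑ j ∈ F, gaussianTerm j (x j) : Lp E 2 (gaussianSeq ι))‖ := by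
  rw [← toReal_enorm, ← toReal_enorm]
  refine ENNReal.toReal_mono enorm_ne_top ?_
  rw [enorm_sum_gaussianTerm_subtype, enorm_sum_gaussianTerm_subtype]
  have := eLpNorm_gaussian_le (Matrix.of fun (k : W) (j : F) => M k j) (fun v => ?_)
    fun j : F => x j
  · refine le_trans (le_of_eq ?_) this
    congr 1
    ext γ
    refine Finset.sum_congr rfl fun k _ => ?_
    rw [← Finset.sum_coe_sort F]
    rfl
  · classical
    have := h fun j => if hj : j ∈ F then v ⟨j, hj⟩ else 0
    rw [← Finset.sum_coe_sort F, ← Finset.sum_coe_sort W] at this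
    simp_rw [← Finset.sum_coe_sort F] at this
    simpa using this

theorem norm_gaussianTerm (i : ι) (x : E) :
    ‖(gaussianTerm i x : Lp E 2 (gaussianSeq ι))‖ = ‖x‖ := by
  have h := enorm_sum_gaussianTerm {i} fun _ => x
  simp only [Finset.sum_singleton] at h
  rw [← toReal_enorm, h]
  have hm : MeasurePreserving (Function.eval i) (gaussianSeq ι) (gaussianReal 0 1) :=
    measurePreserving_eval_infinitePi (fun _ : ι => gaussianReal 0 1) i
  have h2 := eLpNorm_comp_measurePreserving (p := 2) (g := fun y : ℝ => y • x)
    (measurable_id.aestronglyMeasurable.smul_const x) hm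
  have h3 : eLpNorm (fun y : ℝ => y • x) 2 (gaussianReal 0 1) = ‖x‖ₑ := by
    rw [eLpNorm_eq_lintegral_rpow_enorm_toReal (by norm_num) (by norm_num)]
    simp only [enorm_smul, ENNReal.toReal_ofNat, ENNReal.rpow_ofNat, mul_pow]
    have hv := variance_id_gaussianReal (μ := 0) (v := 1)
    have hv2 : ∫⁻ y : ℝ, ‖y‖ₑ ^ 2 ∂(gaussianReal 0 1) = 1 := by
      have := ofReal_variance (memLp_id_gaussianReal (μ := 0) (v := 1) 2)
      rw [hv, evariance_eq_lintegral_ofReal] at this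
      simp only [id, integral_id_gaussianReal, sub_zero, NNReal.coe_one, ENNReal.ofReal_one] at this
      rw [this]
      refine lintegral_congr fun y => ?_
      rw [← sq_abs, ENNReal.ofReal_pow (abs_nonneg y), Real.enorm_eq_ofReal_abs]
    rw [lintegral_mul_const _ (by fun_prop), hv2, one_mul, ← ENNReal.rpow_natCast,
      ← ENNReal.rpow_mul]
    norm_num
  change eLpNorm ((fun y : ℝ => y • x) ∘ Function.eval i) 2 (gaussianSeq ι) = _ at h2
  rw [h3] at h2
  change (eLpNorm ((fun y : ℝ => y • x) ∘ Function.eval i) 2 (gaussianSeq ι)).toReal = _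
  rw [h2, toReal_enorm]

end FiniteGaussian

/-! ## Bessel families and radonifying operators -/

section BesselFamilies

variable {ι κ : Type*} {K : Type*} [NormedAddCommGroup K] [InnerProductSpace ℝ K]
variable {E : Type*} [NormedAddCommGroup E] [NormedSpace ℝ E]

/-- A family of functionals `aⱼ` with `∑ (aⱼ f)² ≤ ‖f‖²` for every `f`. -/
def IsBessel (a : ι → StrongDual ℝ K) : Prop :=
  ∀ (F : Finset ι) (f : K), ∑ j ∈ F, a j f ^ 2 ≤ ‖f‖ ^ 2

theorem Orthonormal.isBessel {b : ι → K} (hb : Orthonormal ℝ b) :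
    IsBessel fun j => innerSL ℝ (b j) := fun F f => by
  simpa using hb.sum_inner_products_le f (s := F)

/-- The adjoint of the contraction `f ↦ (aⱼ f)` is a contraction. With `s k = ∑ aⱼ(b k) vⱼ` and `f =
∑ s k • b k`, one has `‖f‖² = ∑ aⱼ(f) vⱼ`, and Cauchy–Schwarz together with Bessel's inequality for
`f` applies. -/
theorem IsBessel.sum_sq_le {a : ι → StrongDual ℝ K} (ha : IsBessel a) {b : κ → K}
    (hb : Orthonormal ℝ b) (F : Finset ι) (W : Finset κ) (v : ι → ℝ) :
    ∑ k ∈ W, (∑ j ∈ F, a j (b k) * v j) ^ 2 ≤ ∑ j ∈ F, v j ^ 2 := by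
  set s : κ → ℝ := fun k => ∑ j ∈ F, a j (b k) * v j with hs
  set f : K := ∑ k ∈ W, s k • b k with hf
  have h1 : ‖f‖ ^ 2 = ∑ k ∈ W, s k ^ 2 := by
    rw [← real_inner_self_eq_norm_sq, hf, hb.inner_sum]
    simp [pow_two]
  have h2 : ∑ k ∈ W, s k ^ 2 = ∑ j ∈ F, a j f * v j := by
    simp only [hf, map_sum, map_smul, smul_eq_mul, Finset.sum_mul]
    rw [Finset.sum_comm]
    refine Finset.sum_congr rfl fun k _ => ?_
    rw [pow_two]
    nth_rewrite 2 [hs]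
    rw [Finset.mul_sum]
    exact Finset.sum_congr rfl fun j _ => by ring
  have h3 := Finset.sum_mul_sq_le_sq_mul_sq F (fun j => a j f) v
  have h4 := ha F f
  rw [← h2] at h3
  rw [h1] at h4
  change ∑ k ∈ W, s k ^ 2 ≤ _
  have h5 : 0 ≤ ∑ k ∈ W, s k ^ 2 := Finset.sum_nonneg fun _ _ => sq_nonneg _
  have h6 : 0 ≤ ∑ j ∈ F, v j ^ 2 := Finset.sum_nonneg fun _ _ => sq_nonneg _
  rcases h5.eq_or_lt with h | h
  · rw [← h]
    exact h6
  -- The estimate so far is `X² ≤ X · ∑ vⱼ²` with `X = ∑ (s k)²`; a factor `X > 0` is cancelled.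
  · refine le_of_mul_le_mul_left ?_ h
    nlinarith [mul_le_mul_of_nonneg_right h4 h6]

theorem IsBessel.norm_sum_gaussianTerm_le {a : ι → StrongDual ℝ K} (ha : IsBessel a) {b : κ → K}
    (hb : Orthonormal ℝ b) (F : Finset ι) (W : Finset κ) (x : ι → E) :
    ‖(∑ k ∈ W, gaussianTerm k (∑ j ∈ F, a j (b k) • x j) : Lp E 2 (gaussianSeq κ))‖ ≤
      ‖(∑ j ∈ F, gaussianTerm j (x j) : Lp E 2 (gaussianSeq ι))‖ :=
  _root_.norm_sum_gaussianTerm_le F W (fun k j => a j (b k)) (ha.sum_sq_le hb F W) x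

theorem gaussianTerm_zero (i : ι) : (gaussianTerm i (0 : E) : Lp E 2 (gaussianSeq ι)) = 0 := by
  simpa using gaussianTerm_smul i 0 (0 : E)

variable (E) in
/-- The linear isometry `x ↦ gᵢ x`. -/
def gaussianTermL (i : ι) : E →ₗᵢ[ℝ] Lp E 2 (gaussianSeq ι) where
  toFun := gaussianTerm i
  map_add' := gaussianTerm_add i
  map_smul' := gaussianTerm_smul i
  norm_map' := norm_gaussianTerm i

theorem continuous_gaussianTerm (i : ι) :
    Continuous (gaussianTerm i : E → Lp E 2 (gaussianSeq ι)) :=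
  (gaussianTermL E i).continuous

/-- Discarding terms is the contraction given by a coordinate projection. -/
theorem norm_sum_gaussianTerm_mono {F G : Finset ι} (h : F ⊆ G) (x : ι → E) :
    ‖(∑ j ∈ F, gaussianTerm j (x j) : Lp E 2 (gaussianSeq ι))‖ ≤
      ‖(∑ j ∈ G, gaussianTerm j (x j) : Lp E 2 (gaussianSeq ι))‖ := by
  classical
  have := norm_sum_gaussianTerm_le G F (fun k j => if k = j then (1 : ℝ) else 0) (fun v => ?_) x
  · refine le_trans (le_of_eq ?_) this
    congr 1
    refine Finset.sum_congr rfl fun k hk => ?_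
    simp [ite_smul, h hk]
  · refine le_trans (le_of_eq ?_)
      (Finset.sum_le_sum_of_subset_of_nonneg h fun _ _ _ => sq_nonneg _)
    refine Finset.sum_congr rfl fun k hk => ?_
    simp [h hk]

theorem norm_sum_gaussianTerm_le_tsum {x : ι → E}
    (hx : Summable fun j => (gaussianTerm j (x j) : Lp E 2 (gaussianSeq ι))) (F : Finset ι) :
    ‖(∑ j ∈ F, gaussianTerm j (x j) : Lp E 2 (gaussianSeq ι))‖ ≤
      ‖(∑' j, gaussianTerm j (x j) : Lp E 2 (gaussianSeq ι))‖ := by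
  refine ge_of_tendsto hx.hasSum.norm ?_
  filter_upwards [Filter.eventually_ge_atTop F] with G hG
  exact norm_sum_gaussianTerm_mono hG x

/-- The Gaussian comparison for the one-element orthonormal family `f / ‖f‖`; it turns Gaussian
bounds into operator norm bounds. -/
theorem IsBessel.norm_sum_smul_le {a : ι → StrongDual ℝ K} (ha : IsBessel a) (F : Finset ι)
    (x : ι → E) (f : K) : ‖∑ j ∈ F, a j f • x j‖ ≤
      ‖(∑ j ∈ F, gaussianTerm j (x j) : Lp E 2 (gaussianSeq ι))‖ * ‖f‖ := by
  rcases eq_or_ne f 0 with rfl | hf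
  · simp
  have hb : Orthonormal ℝ fun _ : Unit => ‖f‖⁻¹ • f := by
    refine ⟨fun _ => by simp [norm_smul, hf], fun i j h => (h rfl).elim⟩
  have h := ha.norm_sum_gaussianTerm_le hb F Finset.univ x
  simp only [Finset.univ_unique, Finset.sum_singleton, norm_gaussianTerm, map_smul, smul_assoc,
    ← Finset.smul_sum] at h
  rw [norm_smul, norm_inv, norm_norm, inv_mul_le_iff₀ (norm_pos_iff.2 hf)] at h
  linarith

/-- `∑ c k g_k` is a Gaussian variable of variance `s = ∑ (c k)²`. This is obtained by comparison
with the single term `√s • x` through the unit column `c / √s`. -/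
theorem norm_sum_gaussianTerm_smul_le (W : Finset κ) (c : κ → ℝ) (x : E) :
    ‖(∑ k ∈ W, gaussianTerm k (c k • x) : Lp E 2 (gaussianSeq κ))‖ ≤
      Real.sqrt (∑ k ∈ W, c k ^ 2) * ‖x‖ := by
  set s := ∑ k ∈ W, c k ^ 2 with hs
  have hs0 : 0 ≤ s := Finset.sum_nonneg fun _ _ => sq_nonneg _
  rcases hs0.eq_or_lt with h0 | h0
  · have : ∀ k ∈ W, c k = 0 := fun k hk => by
      have := (Finset.sum_eq_zero_iff_of_nonneg fun k _ => sq_nonneg (c k)).1 h0.symm k hk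
      simpa using this
    rw [Finset.sum_eq_zero fun k hk => by rw [this k hk, zero_smul, gaussianTerm_zero], norm_zero]
    positivity
  have hq : Real.sqrt s ≠ 0 := (Real.sqrt_pos.2 h0).ne'
  have := norm_sum_gaussianTerm_le (Finset.univ : Finset Unit) W
    (fun k _ => c k / Real.sqrt s) (fun v => ?_) fun _ => Real.sqrt s • x
  · simp only [Finset.univ_unique, Finset.sum_singleton, norm_gaussianTerm, smul_smul,
      div_mul_cancel₀ _ hq, norm_smul, Real.norm_of_nonneg (Real.sqrt_nonneg s)] at this
    exact this
  · simp only [Finset.univ_unique, Finset.sum_singleton, mul_pow, div_pow, Real.sq_sqrt hs0,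
      ← Finset.sum_mul, ← Finset.sum_div]
    rw [← hs, div_self h0.ne', one_mul]

theorem isRadonifying_smulRight [CompleteSpace K] [CompleteSpace E] (a : StrongDual ℝ K) (x : E) :
    IsRadonifying (a.smulRight x) := by
  intro w b
  have hs : Summable fun k => a (b k) ^ 2 := by
    have := b.orthonormal.inner_products_summable ((InnerProductSpace.toDual ℝ K).symm a)
    refine this.congr fun k => ?_
    rw [real_inner_comm, InnerProductSpace.toDual_symm_apply, Real.norm_eq_abs, sq_abs]
  rw [summable_iff_vanishing_norm] at hs ⊢
  intro ε hε
  obtain ⟨s, h⟩ := hs ((ε / (‖x‖ + 1)) ^ 2) (by positivity)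
  refine ⟨s, fun t ht => ?_⟩
  have h1 := h t ht
  rw [Real.norm_of_nonneg (Finset.sum_nonneg fun _ _ => sq_nonneg _)] at h1
  refine (norm_sum_gaussianTerm_smul_le t (fun k => a (b k)) x).trans_lt ?_
  have h2 : Real.sqrt (∑ k ∈ t, a (b k) ^ 2) < ε / (‖x‖ + 1) :=
    (Real.sqrt_lt' (by positivity)).2 h1
  calc Real.sqrt (∑ k ∈ t, a (b k) ^ 2) * ‖x‖
      ≤ Real.sqrt (∑ k ∈ t, a (b k) ^ 2) * (‖x‖ + 1) := by gcongr; linarith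
    _ < ε / (‖x‖ + 1) * (‖x‖ + 1) := by gcongr
    _ = ε := div_mul_cancel₀ _ (by positivity)

/-- A radonifying operator as an element of `γ(K, E)`. -/
def Gamma.mk (R : K →L[ℝ] E) (h : IsRadonifying R) : Gamma K E := ⟨R, h⟩

@[simp]
theorem Gamma.toCLM_mk (R : K →L[ℝ] E) (h : IsRadonifying R) : (Gamma.mk R h).toCLM = R := rfl

/-- Radonifying operators are closed under limits that are uniform over all finite Gaussian sums.
This serves both for series of rank one operators and for completeness of `γ(K, E)`. -/
theorem IsRadonifying.of_approx [CompleteSpace E] {R : K →L[ℝ] E}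
    (h : ∀ ε > 0, ∃ S : K →L[ℝ] E, IsRadonifying S ∧ ∀ (w : Set K) (b : HilbertBasis w ℝ K)
      (W : Finset w),
      ‖(∑ k ∈ W, gaussianTerm k ((R - S) (b k)) : Lp E 2 (gaussianSeq w))‖ ≤ ε) :
    IsRadonifying R := by
  intro w b
  rw [summable_iff_vanishing_norm]
  intro ε hε
  obtain ⟨S, hS, hRS⟩ := h (ε / 2) (by positivity)
  obtain ⟨s, hs⟩ := summable_iff_vanishing_norm.1 (hS w b) (ε / 2) (by positivity)
  refine ⟨s, fun t ht => ?_⟩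
  have e : (∑ k ∈ t, gaussianTerm k (R (b k)) : Lp E 2 (gaussianSeq w)) =
      ∑ k ∈ t, gaussianTerm k ((R - S) (b k)) + ∑ k ∈ t, gaussianTerm k (S (b k)) := by
    rw [← Finset.sum_add_distrib]
    refine Finset.sum_congr rfl fun k _ => ?_
    rw [← gaussianTerm_add]
    simp
  rw [e]
  linarith [norm_add_le (∑ k ∈ t, gaussianTerm k ((R - S) (b k)) : Lp E 2 (gaussianSeq w))
    (∑ k ∈ t, gaussianTerm k (S (b k))), hRS w b t, hs t ht]

theorem IsBessel.norm_sum_gaussianTerm_le_tsum {a : ι → StrongDual ℝ K} (ha : IsBessel a)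
    {x : ι → E} (hx : Summable fun j => (gaussianTerm j (x j) : Lp E 2 (gaussianSeq ι)))
    {R : K → E} (hR : ∀ f, HasSum (fun j => a j f • x j) (R f)) {b : κ → K}
    (hb : Orthonormal ℝ b) (W : Finset κ) :
    ‖(∑ k ∈ W, gaussianTerm k (R (b k)) : Lp E 2 (gaussianSeq κ))‖ ≤
      ‖(∑' j, gaussianTerm j (x j) : Lp E 2 (gaussianSeq ι))‖ := by
  have h1 : Filter.Tendsto (fun F : Finset ι =>
      (∑ k ∈ W, gaussianTerm k (∑ j ∈ F, a j (b k) • x j) : Lp E 2 (gaussianSeq κ)))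
      Filter.atTop (nhds (∑ k ∈ W, gaussianTerm k (R (b k)))) :=
    tendsto_finsetSum _ fun k _ => ((continuous_gaussianTerm k).tendsto _).comp (hR (b k))
  exact le_of_tendsto' h1.norm fun F =>
    (ha.norm_sum_gaussianTerm_le hb F W x).trans (_root_.norm_sum_gaussianTerm_le_tsum hx F)

theorem Gamma.norm_le [CompleteSpace K] (R : Gamma K E) {C : ℝ}
    (h : ∀ W : Finset (basisSet K), ‖(∑ k ∈ W, gaussianTerm k (R.toCLM (stdBasis K k)) :
      Lp E 2 (gaussianSeq (basisSet K)))‖ ≤ C) : ‖R‖ ≤ C :=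
  le_of_tendsto' (R.isRadonifying _ (stdBasis K)).hasSum.norm h

/-- Construction of `∑ aⱼ ⊗ xⱼ`. Every tail of the operator series is dominated by the corresponding
tail of the Gaussian series, so the partial sums, of finite rank, approximate it in the sense of
`IsRadonifying.of_approx`. The `aⱼ` need not come from a basis. -/
theorem exists_gamma_of_isBessel [CompleteSpace K] [CompleteSpace E] {a : ι → StrongDual ℝ K}
    (ha : IsBessel a) {x : ι → E}
    (hx : Summable fun j => (gaussianTerm j (x j) : Lp E 2 (gaussianSeq ι))) :
    ∃ R : Gamma K E, (∀ f, HasSum (fun j => a j f • x j) (R.toCLM f)) ∧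
      ‖R‖ ≤ ‖(∑' j, gaussianTerm j (x j) : Lp E 2 (gaussianSeq ι))‖ := by
  classical
  have hsum : ∀ f, Summable fun j => a j f • x j := fun f => by
    rw [summable_iff_vanishing_norm]
    intro ε hε
    obtain ⟨s, hs⟩ := summable_iff_vanishing_norm.1 hx (ε / (‖f‖ + 1)) (by positivity)
    refine ⟨s, fun t ht => (ha.norm_sum_smul_le t x f).trans_lt ?_⟩
    calc _ ≤ ‖(∑ j ∈ t, gaussianTerm j (x j) : Lp E 2 (gaussianSeq ι))‖ * (‖f‖ + 1) := by
          gcongr; linarith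
      _ < ε / (‖f‖ + 1) * (‖f‖ + 1) := by gcongr; exact hs t ht
      _ = ε := div_mul_cancel₀ _ (by positivity)
  let R : K →L[ℝ] E := LinearMap.mkContinuous
    { toFun := fun f => ∑' j, a j f • x j
      map_add' := fun f g => by
        rw [← (hsum f).tsum_add (hsum g)]
        simp [add_smul]
      map_smul' := fun c f => by
        simp only [RingHom.id_apply]
        rw [← (hsum f).tsum_const_smul c]
        simp [mul_smul] }
    ‖(∑' j, gaussianTerm j (x j) : Lp E 2 (gaussianSeq ι))‖ fun f => by
      refine le_of_tendsto' (hsum f).hasSum.norm fun F => (ha.norm_sum_smul_le F x f).trans ?_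
      gcongr
      exact _root_.norm_sum_gaussianTerm_le_tsum hx F
  have hR : ∀ f, HasSum (fun j => a j f • x j) (R f) := fun f => (hsum f).hasSum
  have hrad : IsRadonifying R := by
    refine IsRadonifying.of_approx fun ε hε => ?_
    obtain ⟨s, hs⟩ := summable_iff_vanishing_norm.1 hx ε hε
    refine ⟨∑ j ∈ s, (a j).smulRight (x j), ?_, fun w b W => ?_⟩
    · exact (radonifyingSubmodule K E).sum_mem fun j _ => isRadonifying_smulRight (a j) (x j)
    -- The remainder `R - ∑_{j ∈ s} aⱼ ⊗ xⱼ` is a series of the same kind, with the coefficients in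
    -- `s` replaced by zero.
    set y : ι → E := fun j => if j ∈ s then 0 else x j with hy
    have hgy : ∀ j, (gaussianTerm j (y j) : Lp E 2 (gaussianSeq ι)) =
        ((s : Set ι)ᶜ).indicator (fun j => gaussianTerm j (x j)) j := fun j => by
      by_cases hj : j ∈ s <;> simp [hy, hj, gaussianTerm_zero]
    have hsy : Summable fun j => (gaussianTerm j (y j) : Lp E 2 (gaussianSeq ι)) := by
      simp_rw [hgy]
      exact hx.indicator _
    have hRy : ∀ f, HasSum (fun j => a j f • y j) ((R - ∑ j ∈ s, (a j).smulRight (x j)) f) := by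
      intro f
      have h1 : HasSum (fun j => if j ∈ s then a j f • x j else 0) (∑ j ∈ s, a j f • x j) := by
        have h2 : ∑ j ∈ s, a j f • x j = ∑ j ∈ s, if j ∈ s then a j f • x j else 0 :=
          Finset.sum_congr rfl fun j hj => (if_pos hj).symm
        rw [h2]
        exact hasSum_sum_of_ne_finset_zero fun j hj => if_neg hj
      convert (hR f).sub h1 using 1
      · ext j
        by_cases hj : j ∈ s <;> simp [hy, hj]
      · simp
    refine (ha.norm_sum_gaussianTerm_le_tsum hsy hRy b.orthonormal W).trans ?_
    refine le_of_tendsto' hsy.hasSum.norm fun F => ?_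
    have : (∑ j ∈ F, gaussianTerm j (y j) : Lp E 2 (gaussianSeq ι)) =
        ∑ j ∈ F \ s, gaussianTerm j (x j) := by
      rw [Finset.sdiff_eq_filter, Finset.sum_filter]
      refine Finset.sum_congr rfl fun j _ => ?_
      by_cases hj : j ∈ s <;> simp [hy, hj, gaussianTerm_zero]
    rw [this]
    exact (hs _ Finset.sdiff_disjoint).le
  refine ⟨Gamma.mk R hrad, hR, Gamma.norm_le _ fun W => ?_⟩
  exact ha.norm_sum_gaussianTerm_le_tsum hx hR (stdBasis K).orthonormal W

/-! ### Orthonormal families, completeness and rank one operators in `γ(K, E)`. -/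

variable [CompleteSpace K]

theorem HilbertBasis.hasSum_apply {w : Type*} (b : HilbertBasis w ℝ K) (R : K →L[ℝ] E) (f : K) :
    HasSum (fun j => innerSL ℝ (b j) f • R (b j)) (R f) := by
  have := (b.hasSum_repr f).mapL R
  simpa [b.repr_apply_apply] using this

/-- The coordinate functionals of the fixed basis form a Bessel family, so any other orthonormal
system gives Gaussian sums that are no larger. -/
theorem Gamma.norm_sum_gaussianTerm_le (R : Gamma K E) {b : κ → K} (hb : Orthonormal ℝ b)
    (W : Finset κ) :
    ‖(∑ k ∈ W, gaussianTerm k (R.toCLM (b k)) : Lp E 2 (gaussianSeq κ))‖ ≤ ‖R‖ :=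
  (Orthonormal.isBessel (stdBasis K).orthonormal).norm_sum_gaussianTerm_le_tsum
    (R.isRadonifying _ (stdBasis K)) ((stdBasis K).hasSum_apply R.toCLM) hb W

variable [CompleteSpace E]

theorem Gamma.norm_apply_le (R : Gamma K E) (f : K) : ‖R.toCLM f‖ ≤ ‖R‖ * ‖f‖ := by
  rcases eq_or_ne f 0 with rfl | hf
  · simp
  have hb : Orthonormal ℝ fun _ : Unit => ‖f‖⁻¹ • f := by
    refine ⟨fun _ => by simp [norm_smul, hf], fun i j h => (h rfl).elim⟩
  have h := R.norm_sum_gaussianTerm_le hb Finset.univ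
  simp only [Finset.univ_unique, Finset.sum_singleton, norm_gaussianTerm, map_smul] at h
  rw [norm_smul, norm_inv, norm_norm, inv_mul_le_iff₀ (norm_pos_iff.2 hf)] at h
  linarith

variable (K E) in
/-- The contractive inclusion of the radonifying operators into the bounded operators. -/
def Gamma.toCLML : Gamma K E →L[ℝ] (K →L[ℝ] E) :=
  Gamma.toCLM.mkContinuous 1 fun R => by
    rw [one_mul]
    exact ContinuousLinearMap.opNorm_le_bound _ (norm_nonneg _) R.norm_apply_le

/-- Completeness is needed for Bochner integrals of `γ(H, E)`-valued functions, hence for their Haar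
coefficients. The limit exists in operator norm, and bounds on finite Gaussian sums pass to it. -/
instance instCompleteSpaceGamma : CompleteSpace (Gamma K E) := by
  refine Metric.complete_of_cauchySeq_tendsto fun u hu => ?_
  obtain ⟨R, hR⟩ := cauchySeq_tendsto_of_complete ((Gamma.toCLML K E).lipschitz.cauchySeq_comp hu)
  have hlim : ∀ ε > 0, ∃ N, ∀ n ≥ N, ∀ (w : Set K) (b : HilbertBasis w ℝ K) (W : Finset w),
      ‖(∑ k ∈ W, gaussianTerm k ((R - (u n).toCLM) (b k)) : Lp E 2 (gaussianSeq w))‖ ≤ ε := by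
    intro ε hε
    obtain ⟨N, hN⟩ := Metric.cauchySeq_iff.1 hu ε hε
    refine ⟨N, fun n hn w b W => ?_⟩
    have h1 : Filter.Tendsto (fun m => (∑ k ∈ W,
        gaussianTerm k ((u m - u n).toCLM (b k)) : Lp E 2 (gaussianSeq w))) Filter.atTop
        (nhds (∑ k ∈ W, gaussianTerm k ((R - (u n).toCLM) (b k)))) := by
      refine tendsto_finsetSum _ fun k _ => ((continuous_gaussianTerm k).tendsto _).comp ?_
      have h2 : Filter.Tendsto (fun m => (u m).toCLM (b k) - (u n).toCLM (b k)) Filter.atTop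
          (nhds (R (b k) - (u n).toCLM (b k))) :=
        ((ContinuousLinearMap.apply ℝ E (b k)).continuous.tendsto R).comp hR |>.sub_const _
      refine h2.congr fun m => ?_
      rw [map_sub]
      rfl
    refine le_of_tendsto h1.norm ?_
    filter_upwards [Filter.eventually_ge_atTop N] with m hm
    refine ((u m - u n).norm_sum_gaussianTerm_le b.orthonormal W).trans ?_
    rw [← dist_eq_norm]
    exact (hN m hm n hn).le
  have hrad : IsRadonifying R := IsRadonifying.of_approx fun ε hε => by
    obtain ⟨N, hN⟩ := hlim ε hε
    exact ⟨(u N).toCLM, (u N).isRadonifying, hN N le_rfl⟩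
  refine ⟨Gamma.mk R hrad, Metric.tendsto_atTop.2 fun ε hε => ?_⟩
  obtain ⟨N, hN⟩ := hlim (ε / 2) (by positivity)
  refine ⟨N, fun n hn => ?_⟩
  rw [dist_comm, dist_eq_norm]
  refine lt_of_le_of_lt (Gamma.norm_le _ fun W => ?_) (half_lt_self hε)
  rw [map_sub, Gamma.toCLM_mk]
  exact hN n hn _ (stdBasis K) W

/-- The rank one operator `h ↦ ⟪y, h⟫ x`. -/
def Gamma.rankOne (y : K) (x : E) : Gamma K E :=
  Gamma.mk ((innerSL ℝ y).smulRight x) (isRadonifying_smulRight _ x)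

@[simp]
theorem Gamma.rankOne_apply (y : K) (x : E) (f : K) :
    (Gamma.rankOne y x).toCLM f = inner ℝ y f • x := rfl

theorem Gamma.norm_rankOne_le {y : K} (hy : ‖y‖ = 1) (x : E) : ‖Gamma.rankOne y x‖ ≤ ‖x‖ := by
  refine Gamma.norm_le _ fun W => ?_
  refine (norm_sum_gaussianTerm_smul_le W (fun k => inner ℝ y (stdBasis K k)) x).trans ?_
  refine mul_le_of_le_one_left (norm_nonneg x) (Real.sqrt_le_one.2 ?_)
  have := (stdBasis K).orthonormal.sum_inner_products_le y (s := W)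
  simpa [hy, real_inner_comm] using this

end BesselFamilies

/-! ## Type and Gaussian sums -/

section TypeGaussian

variable {E : Type*} [NormedAddCommGroup E] [NormedSpace ℝ E]

variable (E) in
/-- The type `p` inequality with constant `C`, for all finite families. -/
def TypeBound (p C : ℝ) : Prop :=
  ∀ (α : Type) [Fintype α] [DecidableEq α] (x : α → E),
    ∑ r : α → ℤˣ, ‖∑ n, (((r n : ℤ) : ℝ)) • x n‖ ^ 2 ≤
      2 ^ Fintype.card α * (C * (∑ n, ‖x n‖ ^ p) ^ (1 / p)) ^ 2

/-- The constant becomes nonnegative and the index type arbitrary, so that subsets of the Haar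
indices can be used directly. -/
theorem HasType.exists_typeBound {p : ℝ} (h : HasType E p) :
    ∃ C : ℝ, 0 ≤ C ∧ TypeBound E p C := by
  obtain ⟨C, hC⟩ := h
  refine ⟨|C|, abs_nonneg C, fun α _ _ x => ?_⟩
  have e := Fintype.equivFin α
  have h1 := hC _ fun n => x (e.symm n)
  have h2 : ∑ n, ‖x (e.symm n)‖ ^ p = ∑ n, ‖x n‖ ^ p :=
    e.symm.sum_comp fun n => ‖x n‖ ^ p
  have h3 : ∑ r : Fin (Fintype.card α) → ℤˣ, ‖∑ n, (((r n : ℤ) : ℝ)) • x (e.symm n)‖ ^ 2 =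
      ∑ r : α → ℤˣ, ‖∑ n, (((r n : ℤ) : ℝ)) • x n‖ ^ 2 := by
    rw [← (e.arrowCongr (Equiv.refl ℤˣ)).sum_comp]
    refine Finset.sum_congr rfl fun r _ => ?_
    rw [← e.symm.sum_comp fun n => (((r n : ℤ) : ℝ)) • x n]
    rfl
  rw [h2, h3] at h1
  have h5 : 0 ≤ (∑ n, ‖x n‖ ^ p) ^ (1 / p) := by positivity
  have h4 := h1.trans (mul_le_mul_of_nonneg_right (le_abs_self C) h5)
  rw [Real.sqrt_le_left (by positivity), inv_mul_le_iff₀ (by positivity)] at h4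
  exact h4

theorem eLpNorm_two_sq {F Ω : Type*} [NormedAddCommGroup F] [MeasurableSpace Ω] (f : Ω → F)
    (μ : Measure Ω) : eLpNorm f 2 μ ^ 2 = ∫⁻ ω, ‖f ω‖ₑ ^ 2 ∂μ := by
  rw [eLpNorm_eq_lintegral_rpow_enorm_toReal (by norm_num) (by norm_num)]
  simp only [ENNReal.toReal_ofNat, ENNReal.rpow_ofNat]
  rw [← ENNReal.rpow_natCast, ← ENNReal.rpow_mul]
  norm_num

variable {J : Type} {w : Type*}

/-- The `L²`-norm of the sum does not change under signs, so it may be averaged over all of them.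
The type inequality is then applied pointwise, and Minkowski's inequality in `L^(2/p)` moves the
norm inside `∑ ‖X j‖^p`. -/
theorem eLpNorm_sum_le_of_type {p : ℝ} (hp1 : 1 ≤ p) (hp2 : p < 2) {C : ℝ} (hC0 : 0 ≤ C)
    (hC : TypeBound E p C)
    {α : Type} [Fintype α] {Ω : Type*} [MeasurableSpace Ω] {μ : Measure Ω} {X : α → Ω → E}
    (hX : ∀ j, AEStronglyMeasurable (X j) μ)
    (hsign : ∀ r : α → ℤˣ, eLpNorm (fun ω => ∑ j, (((r j : ℤ) : ℝ)) • X j ω) 2 μ =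
      eLpNorm (fun ω => ∑ j, X j ω) 2 μ) :
    eLpNorm (fun ω => ∑ j, X j ω) 2 μ ≤
      ENNReal.ofReal C * (∑ j, eLpNorm (X j) 2 μ ^ p) ^ (1 / p) := by
  classical
  have hp0 : 0 < p := by linarith
  set Y : Ω → ℝ := fun ω => ∑ j, ‖X j ω‖ ^ p with hY
  have hY0 : ∀ ω, 0 ≤ Y ω := fun ω => by positivity
  have hpoint : ∀ ω, ∑ r : α → ℤˣ, ‖∑ j, (((r j : ℤ) : ℝ)) • X j ω‖ₑ ^ 2 ≤
      2 ^ Fintype.card α * (ENNReal.ofReal C ^ 2 * ‖Y ω‖ₑ ^ (2 / p)) := fun ω => by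
    have h := ENNReal.ofReal_le_ofReal (hC α fun j => X j ω)
    rw [ENNReal.ofReal_sum_of_nonneg fun _ _ => by positivity] at h
    simp only [ENNReal.ofReal_pow (norm_nonneg _), ofReal_norm] at h
    refine h.trans (le_of_eq ?_)
    rw [ENNReal.ofReal_mul (by positivity), ENNReal.ofReal_pow (by positivity),
      ENNReal.ofReal_pow (by positivity), ENNReal.ofReal_mul hC0, mul_pow,
      ENNReal.ofReal_ofNat, Real.enorm_of_nonneg (hY0 ω),
      ← ENNReal.ofReal_rpow_of_nonneg (hY0 ω) (by positivity), ← ENNReal.rpow_natCast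
      (ENNReal.ofReal (Y ω) ^ (1 / p)), ← ENNReal.rpow_mul]
    congr 3
    push_cast
    ring
  have hmeas : ∀ r : α → ℤˣ, AEMeasurable (fun ω => ‖∑ j, (((r j : ℤ) : ℝ)) • X j ω‖ₑ ^ 2) μ :=
    fun r => ((Finset.aestronglyMeasurable_fun_sum _ fun j _ =>
      (hX j).const_smul (((r j : ℤ) : ℝ))).enorm).pow_const 2
  have hYm : AEStronglyMeasurable Y μ :=
    Finset.aestronglyMeasurable_fun_sum _ fun j _ =>
      ((hX j).norm.aemeasurable.pow_const p).aestronglyMeasurable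
  have h1 : 2 ^ Fintype.card α * eLpNorm (fun ω => ∑ j, X j ω) 2 μ ^ 2 ≤
      2 ^ Fintype.card α * (ENNReal.ofReal C ^ 2 * ∫⁻ ω, ‖Y ω‖ₑ ^ (2 / p) ∂μ) := by
    calc 2 ^ Fintype.card α * eLpNorm (fun ω => ∑ j, X j ω) 2 μ ^ 2
        = ∑ r : α → ℤˣ, eLpNorm (fun ω => ∑ j, (((r j : ℤ) : ℝ)) • X j ω) 2 μ ^ 2 := by
          simp [hsign]
      _ = ∫⁻ ω, ∑ r : α → ℤˣ, ‖∑ j, (((r j : ℤ) : ℝ)) • X j ω‖ₑ ^ 2 ∂μ := by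
          rw [lintegral_finsetSum' _ fun r _ => hmeas r]
          simp_rw [eLpNorm_two_sq]
      _ ≤ ∫⁻ ω, 2 ^ Fintype.card α * (ENNReal.ofReal C ^ 2 * ‖Y ω‖ₑ ^ (2 / p)) ∂μ :=
          lintegral_mono hpoint
      _ = _ := by
          rw [lintegral_const_mul'' _ ((hYm.enorm.pow_const _).const_mul _),
            lintegral_const_mul'' _ (hYm.enorm.pow_const _)]
  rw [ENNReal.mul_le_mul_iff_right (by positivity) (by simp)] at h1
  have hq : (1 : ℝ≥0∞) ≤ ENNReal.ofReal (2 / p) := by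
    rw [ENNReal.one_le_ofReal, one_le_div hp0]
    exact hp2.le
  -- Minkowski in `L^(2/p)`, a norm because `p ≤ 2`; the `L^(2/p)`-norm of `‖X j‖^p` is the `p`-th
  -- power of the `L²`-norm of `X j`.
  have h2 : eLpNorm Y (ENNReal.ofReal (2 / p)) μ ≤ ∑ j, eLpNorm (X j) 2 μ ^ p := by
    have e : Y = ∑ j, fun ω => ‖X j ω‖ ^ p := by
      ext ω
      simp [hY]
    rw [e]
    refine (eLpNorm_sum_le (fun j _ => ((hX j).norm.aemeasurable.pow_const p).aestronglyMeasurable)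
      hq).trans (le_of_eq ?_)
    refine Finset.sum_congr rfl fun j _ => ?_
    rw [eLpNorm_norm_rpow _ hp0, ← ENNReal.ofReal_mul (by positivity), div_mul_cancel₀ _ hp0.ne']
    simp
  rw [eLpNorm_eq_lintegral_rpow_enorm_toReal (by simpa using hp0) (by simp),
    ENNReal.toReal_ofReal (by positivity)] at h2
  have h3 := ENNReal.rpow_le_rpow h2 (by positivity : 0 ≤ 2 / p)
  rw [← ENNReal.rpow_mul, one_div_mul_cancel (by positivity), ENNReal.rpow_one] at h3
  rw [← ENNReal.pow_le_pow_left_iff two_ne_zero, mul_pow]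
  refine h1.trans ?_
  gcongr
  refine h3.trans (le_of_eq ?_)
  rw [← ENNReal.rpow_natCast (_ ^ (1 / p)), ← ENNReal.rpow_mul]
  congr 1
  push_cast
  ring

/-- In a space of type `p`, the Gaussian sum over a union of independent blocks is controlled by the
`ℓ^p`-norm of the Gaussian sums over the blocks. -/
theorem norm_sum_sigma_gaussianTerm_le {p : ℝ} (hp1 : 1 ≤ p) (hp2 : p < 2) {C : ℝ} (hC0 : 0 ≤ C)
    (hC : TypeBound E p C)
    (A : Finset J) (W : J → Finset w) (x : J → w → E) :
    ‖(∑ q ∈ A.sigma W, gaussianTerm q (x q.1 q.2) : Lp E 2 (gaussianSeq ((_ : J) × w)))‖ ≤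
      C * (∑ j ∈ A, ‖(∑ i ∈ W j, gaussianTerm i (x j i) : Lp E 2 (gaussianSeq w))‖ ^ p) ^ (1 / p)
        := by
  set X : A → (((_ : J) × w) → ℝ) → E := fun j ω => ∑ i ∈ W j, ω ⟨j, i⟩ • x j i with hX
  have hXm : ∀ j : A, AEStronglyMeasurable (X j) (gaussianSeq ((_ : J) × w)) := fun j =>
    Finset.aestronglyMeasurable_fun_sum _ fun i _ =>
      (measurable_pi_apply _).aestronglyMeasurable.smul_const (x j i)
  have hXn : ∀ j : A, eLpNorm (X j) 2 (gaussianSeq ((_ : J) × w)) =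
      ‖(∑ i ∈ W j, gaussianTerm i (x j i) : Lp E 2 (gaussianSeq w))‖ₑ := fun j => by
    rw [enorm_sum_gaussianTerm, ← eLpNorm_comp_measurePreserving
      (aestronglyMeasurable_sum_smul _ _ _)
      (measurePreserving_comp_gaussianSeq (sigma_mk_injective (β := fun _ : J => w) (i := j.1)))]
    rfl
  have hG : ∀ ω : ((_ : J) × w) → ℝ,
      ∑ q ∈ A.sigma W, ω q • x q.1 q.2 = ∑ j : A, X j ω := fun ω => by
    rw [Finset.sum_sigma, ← Finset.sum_coe_sort A]
  have hsign : ∀ r : A → ℤˣ, eLpNorm (fun ω => ∑ j, (((r j : ℤ) : ℝ)) • X j ω) 2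
      (gaussianSeq ((_ : J) × w)) = eLpNorm (fun ω => ∑ j, X j ω) 2 (gaussianSeq ((_ : J) × w)) := by
    classical
    intro r
    -- One sign for all Gaussians of a block. Outside the blocks in `A` the value `1` is immaterial.
    have hs : MeasurePreserving (fun (ω : ((_ : J) × w) → ℝ) q =>
        (if h : q.1 ∈ A then (((r ⟨q.1, h⟩ : ℤ) : ℝ)) else 1) * ω q)
        (gaussianSeq ((_ : J) × w)) (gaussianSeq ((_ : J) × w)) := by
      refine measurePreserving_sign_gaussianSeq fun q => ?_
      by_cases h : q.1 ∈ A
      · rcases Int.units_eq_one_or (r ⟨q.1, h⟩) with h' | h' <;> simp [h, h']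
      · simp [h]
    rw [← eLpNorm_comp_measurePreserving
      (Finset.aestronglyMeasurable_fun_sum _ fun j _ => hXm j) hs]
    congr 1
    ext ω
    refine Finset.sum_congr rfl fun j _ => ?_
    simp [hX, Finset.smul_sum, smul_smul]
  have h := eLpNorm_sum_le_of_type hp1 hp2 hC0 hC hXm hsign
  simp_rw [← hG, ← enorm_sum_gaussianTerm, hXn] at h
  rw [Finset.sum_coe_sort A fun j =>
    ‖(∑ i ∈ W j, gaussianTerm i (x j i) : Lp E 2 (gaussianSeq w))‖ₑ ^ p] at h
  have h3 : ENNReal.ofReal C * (∑ j ∈ A,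
      ‖(∑ i ∈ W j, gaussianTerm i (x j i) : Lp E 2 (gaussianSeq w))‖ₑ ^ p) ^ (1 / p) =
      ENNReal.ofReal (C * (∑ j ∈ A,
        ‖(∑ i ∈ W j, gaussianTerm i (x j i) : Lp E 2 (gaussianSeq w))‖ ^ p) ^ (1 / p)) := by
    rw [ENNReal.ofReal_mul hC0, ← ENNReal.ofReal_rpow_of_nonneg (by positivity) (by positivity),
      ENNReal.ofReal_sum_of_nonneg fun _ _ => by positivity]
    congr 3
    ext j
    rw [← ENNReal.ofReal_rpow_of_nonneg (by positivity) (by positivity), ofReal_norm]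
  rw [h3, ← ofReal_norm] at h
  exact (ENNReal.ofReal_le_ofReal_iff (by positivity)).1 h

variable {H : Type*} [NormedAddCommGroup H] [InnerProductSpace ℝ H] [CompleteSpace H]
  [CompleteSpace E]

/-- Cauchy's criterion in two stages: outside a finite set of blocks the sum of `‖S j‖^p` is small,
and inside each of these blocks the tail of the Gaussian series of `S j` is small. -/
theorem summable_sigma_gaussianTerm {p : ℝ} (hp1 : 1 ≤ p) (hp2 : p < 2) {C : ℝ} (hC0 : 0 ≤ C)
    (hC : TypeBound E p C)
    {w : Set H} (b : HilbertBasis w ℝ H) {S : J → Gamma H E}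
    (hS : Summable fun j => ‖S j‖ ^ p) :
    Summable (fun q : (_ : J) × w => (gaussianTerm q ((S q.1).toCLM (b q.2)) :
        Lp E 2 (gaussianSeq ((_ : J) × w)))) ∧
      ‖(∑' q : (_ : J) × w, gaussianTerm q ((S q.1).toCLM (b q.2)) :
        Lp E 2 (gaussianSeq ((_ : J) × w)))‖ ≤ C * (∑' j, ‖S j‖ ^ p) ^ (1 / p) := by
  classical
  have hp0 : 0 < p := by linarith
  -- By monotonicity `t` may be enlarged to a union of full blocks, still avoiding `W0`, to which
  -- the block estimate applies.
  have hblock : ∀ (t : Finset ((_ : J) × w)) (W0 : J → Finset w),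
      (∀ q ∈ t, q.2 ∉ W0 q.1) → ∃ W : J → Finset w, (∀ j, Disjoint (W j) (W0 j)) ∧
      ‖(∑ q ∈ t, gaussianTerm q ((S q.1).toCLM (b q.2)) : Lp E 2 (gaussianSeq ((_ : J) × w)))‖ ≤
      C * (∑ j ∈ t.image Sigma.fst, ‖(∑ i ∈ W j, gaussianTerm i ((S j).toCLM (b i)) :
        Lp E 2 (gaussianSeq w))‖ ^ p) ^ (1 / p) := by
    intro t W0 ht
    refine ⟨fun j => t.image Sigma.snd \ W0 j, fun j => Finset.sdiff_disjoint, ?_⟩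
    refine le_trans (norm_sum_gaussianTerm_mono (fun q hq => ?_) _)
      (norm_sum_sigma_gaussianTerm_le hp1 hp2 hC0 hC _ _ fun j i => (S j).toCLM (b i))
    simp only [Finset.mem_sigma, Finset.mem_sdiff]
    exact ⟨Finset.mem_image_of_mem _ hq, Finset.mem_image_of_mem _ hq, ht q hq⟩
  have hsum : Summable (fun q : (_ : J) × w => (gaussianTerm q ((S q.1).toCLM (b q.2)) :
        Lp E 2 (gaussianSeq ((_ : J) × w)))) := by
    rw [summable_iff_vanishing_norm]
    intro ε hε
    -- The blocks inside and outside `A0` may each contribute `δ`. Below, `η` is chosen so that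
    -- `A0.card` blocks of size `η` contribute at most `δ`; adding `1` avoids division by zero.
    set δ : ℝ := (ε / (C + 1)) ^ p / 2 with hδ
    have hδ0 : 0 < δ := by positivity
    obtain ⟨A0, hA0⟩ := summable_iff_vanishing_norm.1 hS δ hδ0
    set η : ℝ := (δ / (A0.card + 1)) ^ (1 / p) with hη
    have hη0 : 0 < η := by positivity
    choose V hV using fun j => summable_iff_vanishing_norm.1 ((S j).isRadonifying w b) η hη0
    refine ⟨A0.sigma V, fun t ht => ?_⟩
    obtain ⟨W, hW, hle⟩ := hblock t (fun j => if j ∈ A0 then V j else ∅) fun q hq => by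
      by_cases hqA : q.1 ∈ A0
      · rw [if_pos hqA]
        intro hqV
        exact Finset.disjoint_left.1 ht hq (Finset.mem_sigma.2 ⟨hqA, hqV⟩)
      · simp [hqA]
    refine hle.trans_lt ?_
    set a : J → ℝ := fun j => ‖(∑ i ∈ W j, gaussianTerm i ((S j).toCLM (b i)) :
        Lp E 2 (gaussianSeq w))‖ ^ p with ha
    have ha0 : ∀ j, 0 ≤ a j := fun j => by positivity
    have h1 : ∑ j ∈ t.image Sigma.fst, a j ≤
        ∑ j ∈ A0, a j + ∑ j ∈ t.image Sigma.fst \ A0, a j := by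
      rw [← Finset.sum_union Finset.disjoint_sdiff]
      refine Finset.sum_le_sum_of_subset_of_nonneg ?_ fun j _ _ => ha0 j
      rw [Finset.union_sdiff_self_eq_union]
      exact Finset.subset_union_right
    have h2 : ∑ j ∈ A0, a j ≤ δ := by
      have : ∀ j ∈ A0, a j ≤ δ / (A0.card + 1) := fun j hj => by
        have hd := hW j
        rw [if_pos hj] at hd
        calc a j ≤ η ^ p := Real.rpow_le_rpow (norm_nonneg _) (hV j _ hd).le hp0.le
          _ = _ := by rw [hη, ← Real.rpow_mul (by positivity), one_div_mul_cancel hp0.ne',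
            Real.rpow_one]
      refine (Finset.sum_le_sum this).trans ?_
      rw [Finset.sum_const, nsmul_eq_mul, ← mul_div_assoc, div_le_iff₀ (by positivity)]
      nlinarith
    have h3 : ∑ j ∈ t.image Sigma.fst \ A0, a j < δ := by
      refine lt_of_le_of_lt (Finset.sum_le_sum fun j _ => ?_) ((le_abs_self _).trans_lt
        (hA0 (t.image Sigma.fst \ A0) Finset.sdiff_disjoint))
      exact Real.rpow_le_rpow (norm_nonneg _)
        ((S j).norm_sum_gaussianTerm_le b.orthonormal (W j)) hp0.le
    have h4 : (∑ j ∈ t.image Sigma.fst, a j) ^ (1 / p) ≤ ε / (C + 1) := by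
      calc _ ≤ ((ε / (C + 1)) ^ p) ^ (1 / p) := by
            refine Real.rpow_le_rpow (Finset.sum_nonneg fun j _ => ha0 j) ?_ (by positivity)
            linarith
        _ = _ := by rw [← Real.rpow_mul (by positivity), mul_one_div_cancel hp0.ne', Real.rpow_one]
    calc _ ≤ C * (ε / (C + 1)) := by gcongr
      _ < (C + 1) * (ε / (C + 1)) := by gcongr; linarith
      _ = ε := mul_div_cancel₀ _ (by positivity)
  refine ⟨hsum, le_of_tendsto' hsum.hasSum.norm fun t => ?_⟩
  obtain ⟨W, -, hle⟩ := hblock t (fun _ => ∅) fun q _ => Finset.notMem_empty _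
  refine hle.trans (mul_le_mul_of_nonneg_left ?_ hC0)
  refine Real.rpow_le_rpow (Finset.sum_nonneg fun j _ => by positivity) ?_ (by positivity)
  refine le_trans (Finset.sum_le_sum fun j _ => ?_)
    (hS.sum_le_tsum (t.image Sigma.fst) fun j _ => by positivity)
  exact Real.rpow_le_rpow (norm_nonneg _)
    ((S j).norm_sum_gaussianTerm_le b.orthonormal (W j)) hp0.le

end TypeGaussian

/-! ## Rademacher sums are dominated by Gaussian sums -/

section Rademacher

variable {E : Type*} [NormedAddCommGroup E] [NormedSpace ℝ E] [CompleteSpace E]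

theorem integral_abs_gaussianReal_pos : 0 < ∫ y : ℝ, |y| ∂(gaussianReal 0 1) := by
  have hi : Integrable (fun y : ℝ => |y|) (gaussianReal 0 1) :=
    (memLp_one_iff_integrable.1 (memLp_id_gaussianReal (μ := 0) (v := 1) 1)).abs
  have hna : NullSingletonClass (gaussianReal 0 1) := nullSingletonClass_gaussianReal one_ne_zero
  rw [integral_pos_iff_support_of_nonneg (fun y => abs_nonneg y) hi]
  have : Function.support (fun y : ℝ => |y|) = {0}ᶜ := by
    ext y
    simp
  rw [this, prob_compl_eq_one_sub (measurableSet_singleton 0), measure_singleton]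
  simp

variable {α : Type*} [Fintype α]

/-- Since `|ω n|` has mean `m`, the vector `m ∑ rₙ xₙ` is the expectation of `∑ rₙ |ω n| xₙ`; the
norm of a mean is at most the `L²`-norm. -/
theorem sq_enorm_sum_sign_le (x : α → E) (r : α → ℤˣ) :
    ENNReal.ofReal (∫ y : ℝ, |y| ∂(gaussianReal 0 1)) ^ 2 *
      ‖∑ n, (((r n : ℤ) : ℝ)) • x n‖ₑ ^ 2 ≤
      ∫⁻ ω, ‖∑ n, (((r n : ℤ) : ℝ)) • |ω n| • x n‖ₑ ^ 2 ∂(gaussianSeq α) := by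
  set m := ∫ y : ℝ, |y| ∂(gaussianReal 0 1) with hm
  have hi : ∀ n : α, Integrable (fun ω : α → ℝ => |ω n|) (gaussianSeq α) := fun n =>
    ((memLp_coord_gaussianSeq n).integrable (by norm_num)).abs
  have hmean : ∀ n : α, ∫ ω, |ω n| ∂(gaussianSeq α) = m := fun n => by
    have h1 : MeasurePreserving (Function.eval n) (gaussianSeq α) (gaussianReal 0 1) :=
      measurePreserving_eval_infinitePi (fun _ : α => gaussianReal 0 1) n
    have h := integral_map h1.measurable.aemeasurable
      (f := fun y : ℝ => |y|) (by fun_prop) (μ := gaussianSeq α)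
    rw [h1.map_eq] at h
    exact h.symm
  have hint : ∀ n ∈ (Finset.univ : Finset α),
      Integrable (fun ω : α → ℝ => (((r n : ℤ) : ℝ)) • |ω n| • x n) (gaussianSeq α) :=
    fun n _ => ((hi n).smul_const (x n)).smul (((r n : ℤ) : ℝ))
  have e : m • ∑ n, (((r n : ℤ) : ℝ)) • x n =
      ∫ ω, ∑ n, (((r n : ℤ) : ℝ)) • |ω n| • x n ∂(gaussianSeq α) := by
    rw [integral_finsetSum _ hint, Finset.smul_sum]
    refine Finset.sum_congr rfl fun n _ => ?_
    rw [integral_smul, integral_smul_const, hmean, smul_comm]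
  have hsm : AEStronglyMeasurable (fun ω : α → ℝ => ∑ n, (((r n : ℤ) : ℝ)) • |ω n| • x n)
      (gaussianSeq α) := (integrable_finsetSum _ hint).1
  rw [← eLpNorm_two_sq, ← mul_pow]
  refine pow_le_pow_left' ?_ 2
  rw [← Real.enorm_of_nonneg integral_abs_gaussianReal_pos.le, ← enorm_smul, ← hm, e]
  refine (enorm_integral_le_lintegral_enorm _).trans ?_
  rw [← eLpNorm_one_eq_lintegral_enorm]
  exact eLpNorm_le_eLpNorm_of_exponent_le (by norm_num) hsm

/-- Averaging over all signs absorbs the signs of the `ω n`, so `|ω n|` may be replaced by `ω n`.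
For fixed signs the Gaussian law is then invariant. -/
theorem sum_sign_le_gaussian (N : ℕ) (x : Fin N → E) :
    (∫ y : ℝ, |y| ∂(gaussianReal 0 1)) ^ 2 *
      ((2 ^ N : ℝ)⁻¹ * ∑ r : Fin N → ℤˣ, ‖∑ n, (((r n : ℤ) : ℝ)) • x n‖ ^ 2) ≤
      ‖(∑ n, gaussianTerm n (x n) : Lp E 2 (gaussianSeq (Fin N)))‖ ^ 2 := by
  set m := ∫ y : ℝ, |y| ∂(gaussianReal 0 1) with hm
  have hm0 : 0 ≤ m := integral_abs_gaussianReal_pos.le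
  have hmeas : ∀ r : Fin N → ℤˣ,
      Measurable fun ω : Fin N → ℝ => ‖∑ n, (((r n : ℤ) : ℝ)) • ω n • x n‖ₑ ^ 2 := fun r => by
    refine Measurable.pow_const (StronglyMeasurable.enorm ?_) 2
    refine Finset.stronglyMeasurable_fun_sum _ fun n _ => StronglyMeasurable.const_smul ?_ _
    exact (measurable_pi_apply n).stronglyMeasurable.smul_const (x n)
  have hmeas' : ∀ r : Fin N → ℤˣ,
      Measurable fun ω : Fin N → ℝ => ‖∑ n, (((r n : ℤ) : ℝ)) • |ω n| • x n‖ₑ ^ 2 := fun r =>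
    (hmeas r).comp (by fun_prop : Measurable fun (ω : Fin N → ℝ) n => |ω n|)
  have hflip : ∀ ω : Fin N → ℝ,
      ∑ r : Fin N → ℤˣ, ‖∑ n, (((r n : ℤ) : ℝ)) • |ω n| • x n‖ₑ ^ 2 =
      ∑ r : Fin N → ℤˣ, ‖∑ n, (((r n : ℤ) : ℝ)) • ω n • x n‖ₑ ^ 2 := fun ω => by
    -- Multiplication by the sign vector of `ω` permutes the choices of signs.
    rw [← Equiv.sum_comp (Equiv.mulRight fun n => if ω n < 0 then (-1 : ℤˣ) else 1)]
    refine Finset.sum_congr rfl fun r _ => ?_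
    congr 2
    refine Finset.sum_congr rfl fun n _ => ?_
    by_cases h : ω n < 0
    · simp [h, abs_of_neg h]
    · simp [h, abs_of_nonneg (not_lt.1 h)]
  have hsign : ∀ r : Fin N → ℤˣ,
      ∫⁻ ω, ‖∑ n, (((r n : ℤ) : ℝ)) • ω n • x n‖ₑ ^ 2 ∂(gaussianSeq (Fin N)) =
      ‖(∑ n, gaussianTerm n (x n) : Lp E 2 (gaussianSeq (Fin N)))‖ₑ ^ 2 := fun r => by
    have hs := measurePreserving_sign_gaussianSeq (s := fun n : Fin N => (((r n : ℤ) : ℝ)))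
      fun n => by rcases Int.units_eq_one_or (r n) with h | h <;> simp [h]
    rw [← eLpNorm_two_sq, enorm_sum_gaussianTerm,
      ← eLpNorm_comp_measurePreserving (aestronglyMeasurable_sum_smul _ _ _) hs]
    simp only [Function.comp_def, mul_smul]
  have key : ENNReal.ofReal m ^ 2 *
      ∑ r : Fin N → ℤˣ, ‖∑ n, (((r n : ℤ) : ℝ)) • x n‖ₑ ^ 2 ≤
      2 ^ N * ‖(∑ n, gaussianTerm n (x n) : Lp E 2 (gaussianSeq (Fin N)))‖ₑ ^ 2 := by
    rw [Finset.mul_sum]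
    refine (Finset.sum_le_sum fun r _ => sq_enorm_sum_sign_le x r).trans (le_of_eq ?_)
    rw [← lintegral_finsetSum _ fun r _ => hmeas' r]
    simp_rw [hflip]
    rw [lintegral_finsetSum _ fun r _ => hmeas r]
    simp [hsign]
  have h2 : (2 : ℝ≥0∞) ^ N = ENNReal.ofReal (2 ^ N) := by
    rw [ENNReal.ofReal_pow (by norm_num), ENNReal.ofReal_ofNat]
  simp only [← ofReal_norm, ← ENNReal.ofReal_pow (norm_nonneg _)] at key
  rw [← ENNReal.ofReal_sum_of_nonneg fun _ _ => by positivity, ← ENNReal.ofReal_pow hm0,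
    ← ENNReal.ofReal_mul (by positivity), h2, ← ENNReal.ofReal_mul (by positivity),
    ENNReal.ofReal_le_ofReal_iff (by positivity)] at key
  rw [mul_left_comm, inv_mul_le_iff₀ (by positivity)]
  exact key

end Rademacher

/-! ## The Haar system -/

section HaarAlgebra

variable {F G : Type*} [NormedAddCommGroup F] [NormedSpace ℝ F]

/-- The dyadic points `T n / 2^K`. -/
def dyadicPoint (T : ℝ) (K n : ℕ) : ℝ := T * n / 2 ^ K

/-- The increment of `P` over the `n`-th dyadic interval of generation `K`. -/
def dyadicIncr (T : ℝ) (P : ℝ → F) (K n : ℕ) : F :=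
  P (dyadicPoint T K (n + 1)) - P (dyadicPoint T K n)

/-- The Haar coefficients of the function on `(0, T)` with primitive `P`. The coefficient of the
constant function has index `(0, 0)`; the coefficients of generation `k` have first index `k + 1`. -/
def haarIncr (T : ℝ) (P : ℝ → F) : ℕ → ℕ → F
  | 0, n => if n = 0 then (Real.sqrt T)⁻¹ • (P T - P 0) else 0
  | k + 1, n => if n < 2 ^ k then
      Real.sqrt (2 ^ k / T) • (dyadicIncr T P (k + 1) (2 * n) - dyadicIncr T P (k + 1) (2 * n + 1))
    else 0

theorem dyadicPoint_zero (T : ℝ) (K : ℕ) : dyadicPoint T K 0 = 0 := by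
  simp [dyadicPoint]

theorem dyadicPoint_two_pow (T : ℝ) (K : ℕ) : dyadicPoint T K (2 ^ K) = T := by
  simp [dyadicPoint]

theorem dyadicPoint_mul_two_pow (T : ℝ) (K m l : ℕ) :
    dyadicPoint T (K + l) (m * 2 ^ l) = dyadicPoint T K m := by
  unfold dyadicPoint
  push_cast
  rw [pow_add]
  field_simp

theorem dyadicPoint_succ_two_mul (T : ℝ) (K n : ℕ) :
    dyadicPoint T (K + 1) (2 * n) = dyadicPoint T K n := by
  simpa [mul_comm] using dyadicPoint_mul_two_pow T K n 1

theorem dyadicPoint_succ_right (T : ℝ) (K n : ℕ) :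
    dyadicPoint T K (n + 1) = dyadicPoint T K n + T / 2 ^ K := by
  unfold dyadicPoint
  push_cast
  ring

theorem dyadicPoint_mono {T : ℝ} (hT : 0 < T) (K : ℕ) : Monotone (dyadicPoint T K) := by
  intro m n h
  unfold dyadicPoint
  gcongr

theorem dyadicPoint_mem {T : ℝ} (hT : 0 < T) {K n : ℕ} (hn : n ≤ 2 ^ K) :
    dyadicPoint T K n ∈ Icc 0 T :=
  ⟨by unfold dyadicPoint; positivity, by
    simpa [dyadicPoint_two_pow] using dyadicPoint_mono hT K hn⟩

theorem dyadicIncr_eq_add (T : ℝ) (P : ℝ → F) (K n : ℕ) :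
    dyadicIncr T P K n = dyadicIncr T P (K + 1) (2 * n) + dyadicIncr T P (K + 1) (2 * n + 1) := by
  unfold dyadicIncr
  rw [show 2 * n + 1 + 1 = 2 * (n + 1) by ring, dyadicPoint_succ_two_mul, dyadicPoint_succ_two_mul]
  abel

theorem haarIncr_of_le (T : ℝ) (P : ℝ → F) {k n : ℕ} (h : 2 ^ k ≤ n) : haarIncr T P k n = 0 := by
  cases k with
  | zero => exact if_neg (by simp at h; omega)
  | succ k => exact if_neg (by rw [pow_succ] at h; have := Nat.pos_of_neZero (2 ^ k); omega)

theorem haarIncr_map [NormedAddCommGroup G] [NormedSpace ℝ G] (T : ℝ) (P : ℝ → F) (L : F →L[ℝ] G)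
    (k n : ℕ) : haarIncr T (fun t => L (P t)) k n = L (haarIncr T P k n) := by
  cases k <;> simp only [haarIncr, dyadicIncr] <;> split_ifs <;> simp

theorem sum_range_two_mul {M : Type*} [AddCommMonoid M] (f : ℕ → M) (n : ℕ) :
    ∑ i ∈ Finset.range (2 * n), f i = ∑ i ∈ Finset.range n, (f (2 * i) + f (2 * i + 1)) := by
  induction n with
  | zero => simp
  | succ n ih =>
    rw [Finset.sum_range_succ, ← ih, mul_add, mul_one, Finset.sum_range_succ, Finset.sum_range_succ,
      add_assoc]

/-- Row `k + 1` has only `2 ^ k` possibly nonzero entries. Summing to `2 ^ (k + 1)` lets the single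
entry of row `0` fit the same pattern; `√(2 ^ k / T)` is the `L²`-normalization on an interval of
length `T / 2 ^ k`. -/
theorem sum_haarIncr_row {M : Type*} [AddCommMonoid M] {T : ℝ} {P : ℝ → F} (φ : ℕ → F → M)
    (h0 : ∀ n, φ n 0 = 0) (k : ℕ) :
    ∑ n ∈ Finset.range (2 ^ (k + 1)), φ n (haarIncr T P (k + 1) n) =
      ∑ n ∈ Finset.range (2 ^ k), φ n (Real.sqrt (2 ^ k / T) •
        (dyadicIncr T P (k + 1) (2 * n) - dyadicIncr T P (k + 1) (2 * n + 1))) := by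
  rw [← Finset.sum_subset (Finset.range_mono (Nat.pow_le_pow_right two_pos k.le_succ))]
  · refine Finset.sum_congr rfl fun n hn => ?_
    simp [haarIncr, Finset.mem_range.1 hn]
  · intro n _ hn
    have : haarIncr T P (k + 1) n = 0 := if_neg (by simpa using hn)
    rw [this, h0]

variable [NormedAddCommGroup G] [InnerProductSpace ℝ G]

/-- The Parseval identity for the Haar system: the Haar coefficients of generation less than `K`
carry the same information as the averages over the dyadic intervals of generation `K`. -/
theorem sum_inner_haarIncr {T : ℝ} (hT : 0 < T) (P Q : ℝ → G) (K : ℕ) :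
    ∑ k ∈ Finset.range (K + 1), ∑ n ∈ Finset.range (2 ^ k),
      inner ℝ (haarIncr T P k n) (haarIncr T Q k n) =
    (2 ^ K / T) * ∑ n ∈ Finset.range (2 ^ K),
      inner ℝ (dyadicIncr T P K n) (dyadicIncr T Q K n) := by
  induction K with
  | zero =>
    have h : (Real.sqrt T)⁻¹ * (Real.sqrt T)⁻¹ = T⁻¹ := by
      rw [← mul_inv, Real.mul_self_sqrt hT.le]
    simp [haarIncr, dyadicIncr, dyadicPoint, inner_smul_left, inner_smul_right, ← h, mul_assoc]
  | succ K ih =>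
    rw [Finset.sum_range_succ, ih]
    have h : Real.sqrt (2 ^ K / T) * Real.sqrt (2 ^ K / T) = 2 ^ K / T :=
      Real.mul_self_sqrt (by positivity)
    have hrow : ∑ n ∈ Finset.range (2 ^ (K + 1)),
        inner ℝ (haarIncr T P (K + 1) n) (haarIncr T Q (K + 1) n) =
        (2 ^ K / T) * ∑ n ∈ Finset.range (2 ^ K),
          inner ℝ (dyadicIncr T P (K + 1) (2 * n) - dyadicIncr T P (K + 1) (2 * n + 1))
            (dyadicIncr T Q (K + 1) (2 * n) - dyadicIncr T Q (K + 1) (2 * n + 1)) := by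
      rw [sum_haarIncr_row (fun n y => inner ℝ y (haarIncr T Q (K + 1) n)) (by simp),
        Finset.mul_sum]
      refine Finset.sum_congr rfl fun n hn => ?_
      simp only [haarIncr, if_pos (Finset.mem_range.1 hn), inner_smul_left, inner_smul_right,
        conj_trivial]
      rw [← mul_assoc, h]
    rw [hrow, pow_succ' (2 : ℝ), pow_succ' 2, sum_range_two_mul, ← mul_add, ← Finset.sum_add_distrib,
      mul_div_assoc, mul_comm (2 : ℝ) (2 ^ K / T), mul_assoc (2 ^ K / T)]
    congr 1
    rw [Finset.mul_sum]
    refine Finset.sum_congr rfl fun n _ => ?_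
    -- Polarized parallelogram law for the two halves: sums and differences together give twice the
    -- pairings of the halves.
    rw [dyadicIncr_eq_add T P K, dyadicIncr_eq_add T Q K]
    simp only [inner_add_left, inner_add_right, inner_sub_left, inner_sub_right]
    ring

/-- The pairing of the averages of a function with those of the indicator of a dyadic interval
starting at `0`. -/
theorem sum_inner_dyadicIncr_min {T : ℝ} (hT : 0 < T) {P : ℝ → G} (Q : ℝ → G) (h : G) {K M : ℕ}
    (hM : M ≤ 2 ^ K) (hP : ∀ t ∈ Icc 0 T, P t = min t (dyadicPoint T K M) • h) :
    (2 ^ K / T) * ∑ n ∈ Finset.range (2 ^ K),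
      inner ℝ (dyadicIncr T P K n) (dyadicIncr T Q K n) =
      inner ℝ h (Q (dyadicPoint T K M) - Q 0) := by
  rw [← Finset.sum_subset (Finset.range_mono hM)]
  · have h1 : ∀ n ∈ Finset.range M, inner ℝ (dyadicIncr T P K n) (dyadicIncr T Q K n) =
        (T / 2 ^ K) * inner ℝ h (dyadicIncr T Q K n) := fun n hn => by
      have hn' := Finset.mem_range.1 hn
      have e : dyadicIncr T P K n = (T / 2 ^ K) • h := by
        rw [dyadicIncr, hP _ (dyadicPoint_mem hT (by omega)), hP _ (dyadicPoint_mem hT (by omega)),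
          min_eq_left (dyadicPoint_mono hT K (by omega)),
          min_eq_left (dyadicPoint_mono hT K (by omega)), ← sub_smul, dyadicPoint_succ_right,
          add_sub_cancel_left]
      rw [e, inner_smul_left]
      rfl
    rw [Finset.sum_congr rfl h1, ← Finset.mul_sum, ← mul_assoc,
      div_mul_div_cancel₀ hT.ne', div_self (by positivity), one_mul, ← inner_sum]
    congr 1
    simp only [dyadicIncr]
    rw [Finset.sum_range_sub fun n => Q (dyadicPoint T K n), dyadicPoint_zero]
  · intro n hn hn'
    have h1 := Finset.mem_range.1 hn
    have h2 : M ≤ n := by simpa using hn'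
    have e : dyadicIncr T P K n = 0 := by
      rw [dyadicIncr, hP _ (dyadicPoint_mem hT (by omega)), hP _ (dyadicPoint_mem hT (by omega)),
        min_eq_right (dyadicPoint_mono hT K (by omega)),
        min_eq_right (dyadicPoint_mono hT K (by omega)), sub_self]
    rw [e, inner_zero_left]

theorem eq_zero_of_dyadicPoint {T : ℝ} (hT : 0 < T) {D : ℝ → F} (hD : ContinuousOn D (Icc 0 T))
    (h : ∀ K m : ℕ, m ≤ 2 ^ K → D (dyadicPoint T K m) = 0) {t : ℝ} (ht : t ∈ Icc 0 T) :
    D t = 0 := by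
  have h0 : 0 ≤ t / T := div_nonneg ht.1 hT.le
  have hle : ∀ K : ℕ, ⌊t / T * 2 ^ K⌋₊ ≤ 2 ^ K := fun K => by
    refine Nat.floor_le_of_le ?_
    push_cast
    exact mul_le_of_le_one_left (by positivity) (div_le_one_of_le₀ ht.2 hT.le)
  have h1 : Filter.Tendsto (fun K : ℕ => dyadicPoint T K ⌊t / T * 2 ^ K⌋₊) Filter.atTop
      (nhds t) := by
    have h2 := (tendsto_nat_floor_mul_div_atTop h0).comp
      (tendsto_pow_atTop_atTop_of_one_lt (one_lt_two (α := ℝ)))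
    have h3 := h2.const_mul T
    rw [mul_div_cancel₀ _ hT.ne'] at h3
    refine h3.congr fun K => ?_
    simp [dyadicPoint, mul_div_assoc]
  have h4 : Filter.Tendsto (fun K : ℕ => dyadicPoint T K ⌊t / T * 2 ^ K⌋₊) Filter.atTop
      (nhdsWithin t (Icc 0 T)) :=
    tendsto_nhdsWithin_iff.2 ⟨h1, Filter.Eventually.of_forall fun K =>
      dyadicPoint_mem hT (hle K)⟩
  refine tendsto_nhds_unique ((hD t ht).tendsto.comp h4) ?_
  refine tendsto_const_nhds.congr fun K => ?_
  exact (h K _ (hle K)).symm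

end HaarAlgebra

/-! ## Haar coefficients of functions -/

section HaarFunctions

variable {F : Type*} [NormedAddCommGroup F] [NormedSpace ℝ F]

/-- The primitive of `f` vanishing at `0`. -/
def primitive (f : ℝ → F) (t : ℝ) : F := ∫ s in (0 : ℝ)..t, f s

theorem intervalIntegrable_of_intervalMeasure {T : ℝ} {f : ℝ → F}
    (hf : Integrable f (intervalMeasure T)) {a b : ℝ} (ha : a ∈ Icc 0 T) (hb : b ∈ Icc 0 T) :
    IntervalIntegrable f volume a b := by
  rw [intervalIntegrable_iff']
  have h1 : IntegrableOn f (Icc 0 T) := (integrableOn_Icc_iff_integrableOn_Ioo).2 hf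
  exact h1.mono_set (uIcc_subset_Icc ha hb)

theorem primitive_sub {T : ℝ} {f : ℝ → F} (hf : Integrable f (intervalMeasure T)) {a b : ℝ}
    (ha : a ∈ Icc 0 T) (hb : b ∈ Icc 0 T) :
    primitive f b - primitive f a = ∫ s in a..b, f s := by
  have h0 : (0 : ℝ) ∈ Icc 0 T := ⟨le_rfl, ha.1.trans ha.2⟩
  exact intervalIntegral.integral_interval_sub_left
    (intervalIntegrable_of_intervalMeasure hf h0 hb)
    (intervalIntegrable_of_intervalMeasure hf h0 ha)

theorem continuousOn_primitive {T : ℝ} {f : ℝ → F}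
    (hf : Integrable f (intervalMeasure T)) : ContinuousOn (primitive f) (Icc 0 T) := by
  rcases le_or_gt 0 T with hT | hT
  · have h1 : IntegrableOn f (uIcc 0 T) := by
      rw [uIcc_of_le hT]
      exact (integrableOn_Icc_iff_integrableOn_Ioo).2 hf
    have := intervalIntegral.continuousOn_primitive_interval h1
    rwa [uIcc_of_le hT] at this
  · simp [Icc_eq_empty hT.not_ge]

theorem primitive_congr_ae {T : ℝ} {f g : ℝ → F} (h : f =ᵐ[intervalMeasure T] g) {t : ℝ}
    (ht : t ∈ Icc 0 T) : primitive f t = primitive g t := by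
  have h1 : f =ᵐ[volume.restrict (Ioc 0 T)] g := by
    rwa [Measure.restrict_congr_set Ioo_ae_eq_Ioc.symm]
  refine intervalIntegral.integral_congr_ae_restrict ?_
  rw [uIoc_of_le ht.1]
  exact ae_restrict_of_ae_restrict_of_subset (Ioc_subset_Ioc_right ht.2) h1

theorem primitive_add {T : ℝ} {f g : ℝ → F} (hf : Integrable f (intervalMeasure T))
    (hg : Integrable g (intervalMeasure T)) {t : ℝ} (ht : t ∈ Icc 0 T) :
    primitive (f + g) t = primitive f t + primitive g t := by
  have h0 : (0 : ℝ) ∈ Icc 0 T := ⟨le_rfl, ht.1.trans ht.2⟩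
  exact intervalIntegral.integral_add (intervalIntegrable_of_intervalMeasure hf h0 ht)
    (intervalIntegrable_of_intervalMeasure hg h0 ht)

theorem primitive_smul (c : ℝ) (f : ℝ → F) (t : ℝ) :
    primitive (c • f) t = c • primitive f t :=
  intervalIntegral.integral_smul c f

theorem haarIncr_congr {T : ℝ} (hT : 0 < T) {P Q : ℝ → F} (h : ∀ t ∈ Icc 0 T, P t = Q t)
    (k n : ℕ) : haarIncr T P k n = haarIncr T Q k n := by
  cases k with
  | zero => simp only [haarIncr, h T ⟨hT.le, le_rfl⟩, h 0 ⟨le_rfl, hT.le⟩]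
  | succ k =>
    simp only [haarIncr, dyadicIncr]
    split_ifs with hn
    · have hn' : 2 * n + 1 + 1 ≤ 2 ^ (k + 1) := by rw [pow_succ]; omega
      rw [h _ (dyadicPoint_mem hT hn'), h _ (dyadicPoint_mem hT (by omega : 2 * n + 1 ≤ _)),
        h _ (dyadicPoint_mem hT (by omega : 2 * n ≤ _))]
    · rfl

theorem haarIncr_add (T : ℝ) (P Q : ℝ → F) (k n : ℕ) :
    haarIncr T (fun t => P t + Q t) k n = haarIncr T P k n + haarIncr T Q k n := by
  cases k <;> simp only [haarIncr, dyadicIncr] <;> split_ifs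
  · rw [← smul_add]
    congr 1
    abel
  · simp
  · rw [← smul_add]
    congr 1
    abel
  · simp

theorem haarIncr_smul (T c : ℝ) (P : ℝ → F) (k n : ℕ) :
    haarIncr T (fun t => c • P t) k n = c • haarIncr T P k n :=
  haarIncr_map T P (c • ContinuousLinearMap.id ℝ F) k n

/-- Cauchy–Schwarz, obtained by integrating the square of `(b - a) g - I`. -/
theorem sq_intervalIntegral_le {g : ℝ → ℝ} {a b : ℝ} (hab : a ≤ b)
    (hg : IntervalIntegrable g volume a b)
    (hg2 : IntervalIntegrable (fun t => g t ^ 2) volume a b) :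
    (∫ t in a..b, g t) ^ 2 ≤ (b - a) * ∫ t in a..b, g t ^ 2 := by
  rcases hab.eq_or_lt with rfl | hlt
  · simp
  set I := ∫ t in a..b, g t with hI
  have h1 : 0 ≤ ∫ t in a..b, ((b - a) * g t - I) ^ 2 :=
    intervalIntegral.integral_nonneg hab fun t _ => sq_nonneg _
  have h2 : ∫ t in a..b, ((b - a) * g t - I) ^ 2 =
      (b - a) ^ 2 * (∫ t in a..b, g t ^ 2) - 2 * (b - a) * I * I + (b - a) * I ^ 2 := by
    have e : ∀ t, ((b - a) * g t - I) ^ 2 =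
        (b - a) ^ 2 * g t ^ 2 - 2 * (b - a) * I * g t + I ^ 2 := fun t => by ring
    simp_rw [e]
    rw [intervalIntegral.integral_add ((hg2.const_mul _).sub (hg.const_mul _))
      intervalIntegrable_const, intervalIntegral.integral_sub (hg2.const_mul _) (hg.const_mul _),
      intervalIntegral.integral_const_mul, intervalIntegral.integral_const_mul,
      intervalIntegral.integral_const, smul_eq_mul]
  rw [h2] at h1
  have h3 : 0 ≤ (b - a) * ((b - a) * (∫ t in a..b, g t ^ 2) - I ^ 2) := by linarith
  have h4 := nonneg_of_mul_nonneg_right h3 (sub_pos.2 hlt)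
  linarith

variable {H : Type*} [NormedAddCommGroup H] [InnerProductSpace ℝ H]

theorem integrable_coe_Lp_two {T : ℝ} (f : Lp H 2 (intervalMeasure T)) :
    Integrable f (intervalMeasure T) :=
  (Lp.memLp f).integrable (by norm_num)

theorem dyadicIncr_primitive {T : ℝ} (hT : 0 < T) {f : ℝ → F}
    (hf : Integrable f (intervalMeasure T)) {K n : ℕ} (hn : n < 2 ^ K) :
    dyadicIncr T (primitive f) K n =
      ∫ t in dyadicPoint T K n..dyadicPoint T K (n + 1), f t :=
  primitive_sub hf (dyadicPoint_mem hT hn.le) (dyadicPoint_mem hT hn)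

/-- By the Parseval identity the left side is the squared `L²`-norm of the function averaged over
dyadic intervals of generation `K`, and averaging is contractive by Cauchy–Schwarz. -/
theorem sum_norm_sq_haarIncr_le {T : ℝ} (hT : 0 < T) (f : Lp H 2 (intervalMeasure T)) (K : ℕ) :
    ∑ k ∈ Finset.range (K + 1), ∑ n ∈ Finset.range (2 ^ k),
      ‖haarIncr T (primitive f) k n‖ ^ 2 ≤ ‖f‖ ^ 2 := by
  have hf1 := integrable_coe_Lp_two f
  have hf2 : Integrable (fun t => ‖f t‖ ^ 2) (intervalMeasure T) :=
    (Lp.memLp f).integrable_norm_pow (by norm_num)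
  simp_rw [← real_inner_self_eq_norm_sq]
  rw [sum_inner_haarIncr hT, L2.inner_def, Finset.mul_sum]
  simp_rw [real_inner_self_eq_norm_sq]
  have h1 : ∀ n ∈ Finset.range (2 ^ K), 2 ^ K / T * ‖dyadicIncr T (primitive f) K n‖ ^ 2 ≤
      ∫ t in dyadicPoint T K n..dyadicPoint T K (n + 1), ‖f t‖ ^ 2 := fun n hn => by
    have hn' := Finset.mem_range.1 hn
    have m1 := dyadicPoint_mem hT hn'.le
    have m2 := dyadicPoint_mem hT (show n + 1 ≤ 2 ^ K from hn')
    have hle := dyadicPoint_mono hT K n.le_succ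
    rw [dyadicIncr_primitive hT hf1 hn']
    have h2 := sq_intervalIntegral_le hle
      (intervalIntegrable_of_intervalMeasure hf1.norm m1 m2)
      (intervalIntegrable_of_intervalMeasure hf2 m1 m2)
    have h3 : ‖∫ t in dyadicPoint T K n..dyadicPoint T K (n + 1), f t‖ ^ 2 ≤
        (∫ t in dyadicPoint T K n..dyadicPoint T K (n + 1), ‖f t‖) ^ 2 := by
      gcongr
      exact intervalIntegral.norm_integral_le_integral_norm hle
    have hlen : dyadicPoint T K (n + 1) - dyadicPoint T K n = T / 2 ^ K := by
      rw [dyadicPoint_succ_right, add_sub_cancel_left]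
    have h4 := h3.trans h2
    rw [Nat.succ_eq_add_one, hlen] at h4
    calc _ ≤ 2 ^ K / T * (T / 2 ^ K *
          ∫ t in dyadicPoint T K n..dyadicPoint T K (n + 1), ‖f t‖ ^ 2) := by gcongr
      _ = _ := by
        rw [← mul_assoc, div_mul_div_cancel₀ hT.ne', div_self (by positivity), one_mul]
  refine (Finset.sum_le_sum h1).trans (le_of_eq ?_)
  rw [intervalIntegral.sum_integral_adjacent_intervals fun n hn =>
    intervalIntegrable_of_intervalMeasure hf2 (dyadicPoint_mem hT hn.le) (dyadicPoint_mem hT hn),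
    dyadicPoint_zero, dyadicPoint_two_pow, intervalIntegral.integral_of_le hT.le,
    integral_Ioc_eq_integral_Ioo]

theorem sum_haarIncr_le {T : ℝ} {P : ℝ → F} (φ : F → ℝ) (h0 : φ 0 = 0) (hφ : ∀ y, 0 ≤ φ y)
    (A : Finset ((_ : ℕ) × ℕ)) : ∃ K : ℕ, ∑ j ∈ A, φ (haarIncr T P j.1 j.2) ≤
      ∑ k ∈ Finset.range (K + 1), ∑ n ∈ Finset.range (2 ^ k), φ (haarIncr T P k n) := by
  refine ⟨A.sup Sigma.fst, ?_⟩
  rw [← Finset.sum_sigma (Finset.range (A.sup Sigma.fst + 1)) (fun k => Finset.range (2 ^ k))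
    fun j : (_ : ℕ) × ℕ => φ (haarIncr T P j.1 j.2)]
  classical
  rw [← Finset.sum_filter_ne_zero]
  refine Finset.sum_le_sum_of_subset_of_nonneg (fun j hj => ?_) fun _ _ _ => hφ _
  obtain ⟨hj, hne⟩ := Finset.mem_filter.1 hj
  rw [Finset.mem_sigma, Finset.mem_range, Finset.mem_range, Nat.lt_succ_iff]
  refine ⟨Finset.le_sup (f := Sigma.fst) hj, ?_⟩
  by_contra hn
  exact hne (by rw [haarIncr_of_le T P (not_lt.1 hn), h0])

theorem sum_norm_sq_haarIncr_finset_le {T : ℝ} (hT : 0 < T) (f : Lp H 2 (intervalMeasure T))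
    (A : Finset ((_ : ℕ) × ℕ)) :
    ∑ j ∈ A, ‖haarIncr T (primitive f) j.1 j.2‖ ^ 2 ≤ ‖f‖ ^ 2 := by
  obtain ⟨K, hK⟩ := sum_haarIncr_le (T := T) (P := primitive f) (fun y => ‖y‖ ^ 2) (by simp)
    (fun _ => by positivity) A
  exact hK.trans (sum_norm_sq_haarIncr_le hT f K)

/-- The Haar coefficient as a bounded operator on `L²(0, T; H)`. -/
def haarCoeff (H : Type*) [NormedAddCommGroup H] [InnerProductSpace ℝ H] {T : ℝ} (hT : 0 < T)
    (j : (_ : ℕ) × ℕ) : Lp H 2 (intervalMeasure T) →L[ℝ] H :=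
  LinearMap.mkContinuous
    { toFun := fun f => haarIncr T (primitive f) j.1 j.2
      map_add' := fun f g => by
        rw [← haarIncr_add]
        refine haarIncr_congr hT (fun t ht => ?_) _ _
        rw [primitive_congr_ae (Lp.coeFn_add f g) ht,
          primitive_add (integrable_coe_Lp_two f) (integrable_coe_Lp_two g) ht]
      map_smul' := fun c f => by
        rw [RingHom.id_apply, ← haarIncr_smul]
        refine haarIncr_congr hT (fun t ht => ?_) _ _
        rw [primitive_congr_ae (Lp.coeFn_smul c f) ht, primitive_smul] }
    1 fun f => by
      have := sum_norm_sq_haarIncr_finset_le hT f {j}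
      rw [Finset.sum_singleton] at this
      rw [one_mul]
      exact (sq_le_sq₀ (norm_nonneg _) (norm_nonneg f)).1 this

/-- Tensor product of two Bessel families: Bessel's inequality in `H` for each Haar coefficient,
then the inequality for the coefficients. -/
theorem isBessel_haarCoeff {T : ℝ} (hT : 0 < T) {w : Type*} {b : w → H} (hb : Orthonormal ℝ b) :
    IsBessel fun q : (_ : (_ : ℕ) × ℕ) × w => (innerSL ℝ (b q.2)) ∘L haarCoeff H hT q.1 := by
  classical
  intro A f
  have hsub : A ⊆ (A.image Sigma.fst).sigma fun _ => A.image Sigma.snd := fun q hq =>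
    Finset.mem_sigma.2 ⟨Finset.mem_image_of_mem _ hq, Finset.mem_image_of_mem _ hq⟩
  refine (Finset.sum_le_sum_of_subset_of_nonneg hsub fun _ _ _ => sq_nonneg _).trans ?_
  rw [Finset.sum_sigma]
  refine le_trans (Finset.sum_le_sum fun j _ => ?_)
    (sum_norm_sq_haarIncr_finset_le hT f (A.image Sigma.fst))
  exact Orthonormal.isBessel hb (A.image Sigma.snd) (haarCoeff H hT j f)

/-- Lebesgue's differentiation theorem. -/
theorem ae_eq_zero_of_primitive [CompleteSpace F] {T : ℝ} (hT : 0 < T) {f : ℝ → F}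
    (hf : Integrable f (intervalMeasure T)) (h : ∀ t ∈ Icc 0 T, primitive f t = 0) :
    f =ᵐ[intervalMeasure T] 0 := by
  have hi := intervalIntegrable_of_intervalMeasure hf ⟨le_rfl, hT.le⟩ ⟨hT.le, le_rfl⟩
  have h1 := hi.ae_hasDerivAt_integral
  refine (ae_restrict_iff' measurableSet_Ioo).2 ?_
  filter_upwards [h1] with t ht htm
  have h0 : (0 : ℝ) ∈ uIcc 0 T := left_mem_uIcc
  have htm' : t ∈ uIcc 0 T := by
    rw [uIcc_of_le hT.le]
    exact Ioo_subset_Icc_self htm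
  have h2 := ht htm' 0 h0
  have h3 : HasDerivAt (fun x => ∫ s in (0 : ℝ)..x, f s) 0 t := by
    refine (hasDerivAt_const t (0 : F)).congr_of_eventuallyEq ?_
    filter_upwards [isOpen_Ioo.mem_nhds htm] with x hx
    exact h x (Ioo_subset_Icc_self hx)
  exact h2.unique h3

variable [CompleteSpace H]

theorem primitive_indicatorConstLp {T : ℝ} {a : ℝ} (h : H) {t : ℝ} (ht : t ∈ Icc 0 T)
    (ha : a ∈ Icc 0 T) :
    primitive (indicatorConstLp 2 (measurableSet_Ioc (a := (0 : ℝ)) (b := a))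
      (measure_ne_top (intervalMeasure T) _) h) t = min t a • h := by
  rw [primitive_congr_ae indicatorConstLp_coeFn ht, primitive, intervalIntegral.integral_of_le ht.1,
    setIntegral_indicator measurableSet_Ioc, setIntegral_const, Ioc_inter_Ioc]
  simp [ht.1, ha.1]

theorem setIntegral_intervalMeasure {T a : ℝ} (ha : a ∈ Icc 0 T) (f : ℝ → F) :
    ∫ t in Ioc 0 a, f t ∂(intervalMeasure T) = primitive f a := by
  rw [primitive, intervalIntegral.integral_of_le ha.1, intervalMeasure,
    Measure.restrict_congr_set Ioo_ae_eq_Ioc, Measure.restrict_restrict measurableSet_Ioc,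
    inter_eq_left.2 (Ioc_subset_Ioc_right ha.2)]

/-- An integrable function whose Haar coefficients are those of an `L²`-function is equal to it. -/
theorem ae_eq_of_hasSum_haarIncr {T : ℝ} (hT : 0 < T) {ψ : ℝ → H}
    (hψ : Integrable ψ (intervalMeasure T)) (u : Lp H 2 (intervalMeasure T))
    (h : ∀ f : Lp H 2 (intervalMeasure T), HasSum (fun j : (_ : ℕ) × ℕ =>
      inner ℝ (haarIncr T (primitive f) j.1 j.2) (haarIncr T (primitive ψ) j.1 j.2))
      (inner ℝ f u)) : ψ =ᵐ[intervalMeasure T] u := by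
  have hu := integrable_coe_Lp_two u
  have key : ∀ K M : ℕ, M ≤ 2 ^ K → primitive ψ (dyadicPoint T K M) =
      primitive u (dyadicPoint T K M) := by
    intro K M hM
    set a := dyadicPoint T K M with ha
    have ham : a ∈ Icc 0 T := dyadicPoint_mem hT hM
    refine ext_inner_left ℝ fun y => ?_
    -- The test function is `y` on `(0, a]`; pairing with it yields the primitive at `a`.
    set f : Lp H 2 (intervalMeasure T) :=
      indicatorConstLp 2 (measurableSet_Ioc (a := (0 : ℝ)) (b := a))
        (measure_ne_top (intervalMeasure T) _) y with hf
    have h1 : inner ℝ f u = inner ℝ y (primitive u a) := by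
      rw [hf, L2.inner_indicatorConstLp_eq_inner_setIntegral, setIntegral_intervalMeasure ham]
    have h2 := (h f).sigma (g := fun k => ∑ n ∈ Finset.range (2 ^ k),
        inner ℝ (haarIncr T (primitive f) k n) (haarIncr T (primitive ψ) k n)) fun k =>
      hasSum_sum_of_ne_finset_zero fun n hn => by
        rw [haarIncr_of_le T _ (by simpa using hn), inner_zero_left]
    have h3 := (h2.tendsto_sum_nat.comp (Filter.tendsto_add_atTop_nat 1)).comp
      (Filter.tendsto_add_atTop_nat K)
    -- The point `a` is dyadic of every generation `l + K`, so the partial sums over full rows are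
    -- constant from row `K` on. Their limit is known without any convergence theorem for the Haar
    -- series of `ψ`.
    have h4 : ∀ l : ℕ, ∑ k ∈ Finset.range (l + K + 1), ∑ n ∈ Finset.range (2 ^ k),
        inner ℝ (haarIncr T (primitive f) k n) (haarIncr T (primitive ψ) k n) =
        inner ℝ y (primitive ψ a) := fun l => by
      have e : dyadicPoint T (l + K) (M * 2 ^ l) = a := by
        rw [add_comm, dyadicPoint_mul_two_pow]
      rw [sum_inner_haarIncr hT, sum_inner_dyadicIncr_min hT (M := M * 2 ^ l) _ y, e]
      · simp [primitive]
      · rw [pow_add, mul_comm]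
        gcongr
      · intro t ht
        rw [e, hf, primitive_indicatorConstLp y ht ham]
    have h5 : Filter.Tendsto (fun _ : ℕ => inner ℝ y (primitive ψ a)) Filter.atTop
        (nhds (inner ℝ f u)) := h3.congr h4
    rw [← h1]
    exact tendsto_nhds_unique tendsto_const_nhds h5
  have hsub : ∀ t ∈ Icc 0 T, primitive (fun t => ψ t - u t) t = primitive ψ t - primitive u t := by
    intro t ht
    have h0 : (0 : ℝ) ∈ Icc 0 T := ⟨le_rfl, hT.le⟩
    exact intervalIntegral.integral_sub (intervalIntegrable_of_intervalMeasure hψ h0 ht)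
      (intervalIntegrable_of_intervalMeasure hu h0 ht)
  have hd : Integrable (fun t => ψ t - u t) (intervalMeasure T) := hψ.sub hu
  have h0 := ae_eq_zero_of_primitive hT hd fun t ht =>
    eq_zero_of_dyadicPoint hT (continuousOn_primitive hd) (fun K M hM => by
      rw [hsub _ (dyadicPoint_mem hT hM), key K M hM, sub_self]) ht
  filter_upwards [h0] with t ht
  exact sub_eq_zero.1 ht

end HaarFunctions

/-! ## Haar coefficients and the Besov norm -/

section HaarBesov

variable {F : Type*} [NormedAddCommGroup F]

theorem eLpNorm_rpow_toReal {ε α : Type*} [TopologicalSpace ε] [ContinuousENorm ε]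
    [MeasurableSpace α] {p : ℝ≥0∞} (hp0 : p ≠ 0) (hp : p ≠ ∞) (f : α → ε) (μ : Measure α) :
    eLpNorm f p μ ^ p.toReal = ∫⁻ x, ‖f x‖ₑ ^ p.toReal ∂μ := by
  rw [eLpNorm_eq_lintegral_rpow_enorm_toReal hp0 hp, ← ENNReal.rpow_mul,
    one_div_mul_cancel (ENNReal.toReal_pos hp0 hp).ne', ENNReal.rpow_one]

theorem measurableSet_shiftDomain (T h : ℝ) : MeasurableSet (shiftDomain T h) :=
  measurableSet_Ioo.inter ((by fun_prop : Measurable fun r : ℝ => r + h) measurableSet_Ioo)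

/-- The trivial bound, used for the finitely many generations too coarse for the integral over `(0,
1)` and for step functions at scales above the step length. -/
theorem modulus_le_two_mul_eLpNorm {T : ℝ} {p : ℝ≥0∞} (hp : 1 ≤ p) {f : ℝ → F}
    (hf : StronglyMeasurable f) (t : ℝ) :
    modulus T p f t ≤ 2 * eLpNorm f p (intervalMeasure T) := by
  refine iSup₂_le fun h _ => ?_
  refine (eLpNorm_sub_le (stronglyMeasurable_translateZero T h hf).aestronglyMeasurable
    hf.aestronglyMeasurable hp).trans ?_
  rw [two_mul]
  refine add_le_add ?_ (eLpNorm_mono_measure _ (Measure.restrict_mono (fun r hr => hr.1) le_rfl))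
  have hS : MeasurableSet ((fun r : ℝ => r + h) ⁻¹' Ioo 0 T) :=
    (by fun_prop : Measurable fun r : ℝ => r + h) measurableSet_Ioo
  have h1 : eLpNorm (translateZero T h f) p (volume.restrict (shiftDomain T h)) ≤
      eLpNorm (translateZero T h f) p (volume.restrict ((fun r : ℝ => r + h) ⁻¹' Ioo 0 T)) :=
    eLpNorm_mono_measure _ (Measure.restrict_mono (fun r hr => hr.2) le_rfl)
  refine h1.trans (le_of_eq ?_)
  have h2 := (measurePreserving_add_right volume h).restrict_preimage
    (measurableSet_Ioo (a := (0 : ℝ)) (b := T))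
  rw [← eLpNorm_comp_measurePreserving hf.aestronglyMeasurable h2]
  refine eLpNorm_congr_ae ?_
  filter_upwards [ae_restrict_mem hS] with r hr
  exact indicator_of_mem (s := {t | t + h ∈ Ioo 0 T}) hr _

variable [NormedSpace ℝ F]

/-- The right half of the interval is translated onto the left half; the coefficient becomes an
integral of a difference of step `T / 2 ^ (k + 1)`. -/
theorem dyadicIncr_sub_primitive {T : ℝ} (hT : 0 < T) {f : ℝ → F}
    (hf : Integrable f (intervalMeasure T)) {k n : ℕ} (hn : n < 2 ^ k) :
    dyadicIncr T (primitive f) (k + 1) (2 * n) - dyadicIncr T (primitive f) (k + 1) (2 * n + 1) =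
      ∫ t in Ioo (dyadicPoint T (k + 1) (2 * n)) (dyadicPoint T (k + 1) (2 * n) + T / 2 ^ (k + 1)),
        (f t - f (t + T / 2 ^ (k + 1))) := by
  have hn' : 2 * n + 1 + 1 ≤ 2 ^ (k + 1) := by rw [pow_succ]; omega
  set l := dyadicPoint T (k + 1) (2 * n) with hl
  set τ := T / 2 ^ (k + 1) with hτ
  have hτ0 : 0 < τ := by positivity
  have e1 : dyadicPoint T (k + 1) (2 * n + 1) = l + τ := dyadicPoint_succ_right _ _ _
  have e2 : dyadicPoint T (k + 1) (2 * n + 1 + 1) = l + τ + τ := by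
    rw [dyadicPoint_succ_right, e1]
  have m0 : l ∈ Icc 0 T := dyadicPoint_mem hT (by omega)
  have m1 : l + τ ∈ Icc 0 T := e1 ▸ dyadicPoint_mem hT (by omega)
  have m2 : l + τ + τ ∈ Icc 0 T := e2 ▸ dyadicPoint_mem hT hn'
  have i1 := intervalIntegrable_of_intervalMeasure hf m0 m1
  have i2 := intervalIntegrable_of_intervalMeasure hf m1 m2
  have i3 : IntervalIntegrable (fun t => f (t + τ)) volume l (l + τ) := by
    simpa using i2.comp_add_right τ
  rw [dyadicIncr_primitive hT hf (by omega), dyadicIncr_primitive hT hf (by omega), ← hl, e1, e2,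
    ← intervalIntegral.integral_comp_add_right, ← intervalIntegral.integral_sub i1 i3,
    intervalIntegral.integral_of_le (by linarith), integral_Ioc_eq_integral_Ioo]

theorem enorm_dyadicIncr_sub_rpow_le {T : ℝ} (hT : 0 < T) {p : ℝ≥0∞} (hp : 1 ≤ p) (hp' : p ≠ ∞)
    {f : ℝ → F} (hfm : StronglyMeasurable f)
    (hf : Integrable f (intervalMeasure T)) {k n : ℕ} (hn : n < 2 ^ k) :
    ‖dyadicIncr T (primitive f) (k + 1) (2 * n) -
      dyadicIncr T (primitive f) (k + 1) (2 * n + 1)‖ₑ ^ p.toReal ≤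
      ENNReal.ofReal ((T / 2 ^ (k + 1)) ^ (p.toReal - 1)) *
      ∫⁻ t in Ioo (dyadicPoint T (k + 1) (2 * n)) (dyadicPoint T (k + 1) (2 * n) + T / 2 ^ (k + 1)),
        ‖f (t + T / 2 ^ (k + 1)) - f t‖ₑ ^ p.toReal := by
  rw [dyadicIncr_sub_primitive hT hf hn]
  set l := dyadicPoint T (k + 1) (2 * n) with hl
  set τ := T / 2 ^ (k + 1) with hτ
  have hτ0 : 0 < τ := by positivity
  have hp0 : p ≠ 0 := (one_pos.trans_le hp).ne'
  have hpr : 0 < p.toReal := ENNReal.toReal_pos hp0 hp'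
  have hm : AEStronglyMeasurable (fun t => f t - f (t + τ)) (volume.restrict (Ioo l (l + τ))) :=
    (hfm.sub (hfm.comp_measurable (by fun_prop))).aestronglyMeasurable
  have h1 := eLpNorm_le_eLpNorm_mul_rpow_measure_univ hp hm
  rw [eLpNorm_one_eq_lintegral_enorm] at h1
  have h2 := ENNReal.rpow_le_rpow ((enorm_integral_le_lintegral_enorm _).trans h1) hpr.le
  refine h2.trans (le_of_eq ?_)
  rw [ENNReal.mul_rpow_of_nonneg _ _ hpr.le, eLpNorm_rpow_toReal hp0 hp', mul_comm,
    Measure.restrict_apply_univ, Real.volume_Ioo, ← ENNReal.rpow_mul, add_sub_cancel_left,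
    ENNReal.ofReal_rpow_of_pos hτ0]
  congr 2
  · congr 1
    rw [ENNReal.toReal_one]
    field_simp
  · ext t
    rw [enorm_sub_rev]

/-- Hölder on each left half gives the factor `τ^(p - 1)`. The left halves are disjoint and lie in
`shiftDomain T τ`, so the integrals add up to at most the `p`-th power of the modulus at `τ`. The
normalization contributes `(2τ)^(-p/2) ≤ τ^(-p/2)`. -/
theorem sum_haarIncr_rpow_le {T : ℝ} (hT : 0 < T) {p : ℝ≥0∞} (hp : 1 ≤ p) (hp' : p ≠ ∞)
    {f : ℝ → F} (hfm : StronglyMeasurable f) (hf : Integrable f (intervalMeasure T)) (k : ℕ) :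
    ∑ n ∈ Finset.range (2 ^ (k + 1)), ‖haarIncr T (primitive f) (k + 1) n‖ₑ ^ p.toReal ≤
      ENNReal.ofReal ((T / 2 ^ (k + 1)) ^ (p.toReal / 2 - 1)) *
        modulus T p f (T / 2 ^ (k + 1)) ^ p.toReal := by
  set τ := T / 2 ^ (k + 1) with hτ
  have hτ0 : 0 < τ := by positivity
  have hp0 : p ≠ 0 := (one_pos.trans_le hp).ne'
  have hpr : 0 < p.toReal := ENNReal.toReal_pos hp0 hp'
  have hc : (2 : ℝ) ^ k / T = (2 * τ)⁻¹ := by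
    rw [hτ, pow_succ]
    field_simp
  rw [sum_haarIncr_row (fun _ y => ‖y‖ₑ ^ p.toReal) (by simp [hpr])]
  simp_rw [enorm_smul, ENNReal.mul_rpow_of_nonneg _ _ hpr.le]
  rw [← Finset.mul_sum]
  have h1 := Finset.sum_le_sum fun n (hn : n ∈ Finset.range (2 ^ k)) =>
    enorm_dyadicIncr_sub_rpow_le hT hp hp' hfm hf (Finset.mem_range.1 hn)
  rw [← Finset.mul_sum, ← hτ] at h1
  have h2 : ∑ n ∈ Finset.range (2 ^ k), ∫⁻ t in Ioo (dyadicPoint T (k + 1) (2 * n))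
      (dyadicPoint T (k + 1) (2 * n) + τ), ‖f (t + τ) - f t‖ₑ ^ p.toReal ≤
      modulus T p f τ ^ p.toReal := by
    rw [← lintegral_biUnion_finset]
    · calc _ ≤ ∫⁻ t in shiftDomain T τ, ‖f (t + τ) - f t‖ₑ ^ p.toReal := by
            refine lintegral_mono_set ?_
            refine iUnion₂_subset fun n hn t ht => ?_
            have hn' : 2 * n + 1 + 1 ≤ 2 ^ (k + 1) := by
              have := Finset.mem_range.1 hn
              rw [pow_succ]
              omega
            have m0 := dyadicPoint_mem hT (show 2 * n ≤ 2 ^ (k + 1) by omega)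
            have m2 := dyadicPoint_mem hT hn'
            rw [dyadicPoint_succ_right, dyadicPoint_succ_right, ← hτ] at m2
            exact ⟨⟨m0.1.trans_lt ht.1, by linarith [ht.2, m2.2]⟩,
              by linarith [ht.1, m0.1], by linarith [ht.2, m2.2]⟩
        _ = eLpNorm (fun r => translateZero T τ f r - f r) p
              (volume.restrict (shiftDomain T τ)) ^ p.toReal := by
            rw [eLpNorm_rpow_toReal hp0 hp']
            refine setLIntegral_congr_fun (measurableSet_shiftDomain T τ) fun t ht => ?_
            have : translateZero T τ f t = f (t + τ) :=
              indicator_of_mem (s := {t | t + τ ∈ Ioo 0 T}) ht.2 _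
            simp only [this]
        _ ≤ _ := by
            refine ENNReal.rpow_le_rpow ?_ hpr.le
            exact le_iSup₂_of_le τ (abs_of_pos hτ0).le le_rfl
    · intro m _ n _ hmn
      have key : ∀ m n : ℕ, m < n → dyadicPoint T (k + 1) (2 * m) + τ ≤
          dyadicPoint T (k + 1) (2 * n) := fun m n h => by
        rw [← dyadicPoint_succ_right]
        exact dyadicPoint_mono hT _ (by omega)
      refine disjoint_left.2 fun t h1 h2 => ?_
      rcases lt_or_gt_of_ne hmn with h | h
      · linarith [key m n h, h1.2, h2.1]
      · linarith [key n m h, h2.2, h1.1]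
    · exact fun _ _ => measurableSet_Ioo
  refine (mul_le_mul_right (h1.trans (mul_le_mul_right h2 _)) _).trans ?_
  rw [← mul_assoc]
  refine mul_le_mul_left ?_ _
  rw [hc, Real.enorm_of_nonneg (Real.sqrt_nonneg _), ENNReal.ofReal_rpow_of_nonneg
    (Real.sqrt_nonneg _) hpr.le, ← ENNReal.ofReal_mul (by positivity)]
  refine ENNReal.ofReal_le_ofReal ?_
  have h3 : Real.sqrt (2 * τ)⁻¹ ≤ τ ^ (-(1 / 2) : ℝ) := by
    rw [Real.rpow_neg hτ0.le, ← Real.sqrt_eq_rpow, ← Real.sqrt_inv]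
    refine Real.sqrt_le_sqrt ?_
    gcongr
    linarith
  calc Real.sqrt (2 * τ)⁻¹ ^ p.toReal * τ ^ (p.toReal - 1)
      ≤ (τ ^ (-(1 / 2) : ℝ)) ^ p.toReal * τ ^ (p.toReal - 1) := by gcongr
    _ = τ ^ (p.toReal / 2 - 1) := by
      rw [← Real.rpow_mul hτ0.le, ← Real.rpow_add hτ0]
      congr 1
      ring

/-- The modulus is nondecreasing, so its value at `τ` is controlled on all of `(τ, 2τ)`. There the
weight `t⁻¹ t^(-sp) = t^(p/2 - 2)` is at least `(2τ)^(p/2 - 2)`; multiplied by the length `τ` this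
is at least `τ^(p/2 - 1) / 4`. -/
theorem rpow_mul_modulus_le_lintegral {T : ℝ} {p : ℝ≥0∞} (hp : 1 ≤ p) (hp2 : p < 2)
    (f : ℝ → F) {τ : ℝ} (hτ0 : 0 < τ) :
    ENNReal.ofReal (τ ^ (p.toReal / 2 - 1)) * modulus T p f τ ^ p.toReal ≤
      4 * ∫⁻ t in Ioo τ (2 * τ), ENNReal.ofReal t⁻¹ *
        (ENNReal.ofReal (t ^ (-(1 / p.toReal - 1 / 2))) * modulus T p f t) ^ p.toReal := by
  have hp' : p ≠ ∞ := (hp2.trans (by simp)).ne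
  have hp0 : p ≠ 0 := (one_pos.trans_le hp).ne'
  have hpr : 0 < p.toReal := ENNReal.toReal_pos hp0 hp'
  have hpr2 : p.toReal < 2 := by simpa using (ENNReal.toReal_lt_toReal hp' (by simp)).2 hp2
  have h1 : ∀ t ∈ Ioo τ (2 * τ),
      ENNReal.ofReal ((2 * τ) ^ (p.toReal / 2 - 2)) * modulus T p f τ ^ p.toReal ≤
      ENNReal.ofReal t⁻¹ *
        (ENNReal.ofReal (t ^ (-(1 / p.toReal - 1 / 2))) * modulus T p f t) ^ p.toReal := by
    intro t ht
    have ht0 : 0 < t := hτ0.trans ht.1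
    rw [ENNReal.mul_rpow_of_nonneg _ _ hpr.le, ← mul_assoc,
      ENNReal.ofReal_rpow_of_pos (by positivity), ← ENNReal.ofReal_mul (by positivity)]
    have hmono : modulus T p f τ ≤ modulus T p f t :=
      iSup_mono fun h => iSup_const_mono fun hh => hh.trans ht.1.le
    refine mul_le_mul' (ENNReal.ofReal_le_ofReal ?_) (ENNReal.rpow_le_rpow hmono hpr.le)
    have e : t⁻¹ * (t ^ (-(1 / p.toReal - 1 / 2))) ^ p.toReal = t ^ (p.toReal / 2 - 2) := by
      rw [← Real.rpow_mul ht0.le, ← Real.rpow_neg_one, ← Real.rpow_add ht0]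
      congr 1
      field_simp
      ring
    rw [e]
    exact Real.rpow_le_rpow_of_nonpos ht0 ht.2.le (by linarith)
  have h2 := setLIntegral_mono' (μ := volume) measurableSet_Ioo h1
  rw [setLIntegral_const, Real.volume_Ioo] at h2
  refine le_trans ?_ (mul_le_mul_right h2 4)
  rw [mul_right_comm, ← mul_assoc]
  refine mul_le_mul_left ?_ _
  rw [← ENNReal.ofReal_mul (by positivity), ← ENNReal.ofReal_ofNat, ← ENNReal.ofReal_mul
    (by norm_num)]
  refine ENNReal.ofReal_le_ofReal ?_
  rw [Real.mul_rpow (by norm_num) hτ0.le, show 2 * τ - τ = τ by ring]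
  have e : τ ^ (p.toReal / 2 - 1) = τ ^ (p.toReal / 2 - 2) * τ := by
    rw [← Real.rpow_add_one hτ0.ne']
    congr 1
    ring
  have h3 : (1 / 4 : ℝ) ≤ 2 ^ (p.toReal / 2 - 2) := by
    calc (1 / 4 : ℝ) = 2 ^ (-2 : ℝ) := by
          rw [Real.rpow_neg (by norm_num), Real.rpow_two]
          norm_num
      _ ≤ _ := Real.rpow_le_rpow_of_exponent_le (by norm_num) (by linarith)
  rw [e]
  have h4 : 0 ≤ τ ^ (p.toReal / 2 - 2) * τ := by positivity
  nlinarith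

theorem lintegral_logMeasure (g : ℝ → ℝ≥0∞) (hg : Measurable g) :
    ∫⁻ t, g t ∂logMeasure = ∫⁻ t in Ioo 0 1, ENNReal.ofReal t⁻¹ * g t :=
  lintegral_withDensity_eq_lintegral_mul _ (by fun_prop) hg

/-- If `τ ≤ 1/2`, then `(τ, 2τ)` lies in `(0, 1)` and the integral suffices. Otherwise the trivial
bound is used, with `τ^(p/2 - 1) ≤ (1/2)^(-1) = 2`. -/
theorem haar_row_le {T : ℝ} (hT : 0 < T) {p : ℝ≥0∞} (hp : 1 ≤ p) (hp2 : p < 2)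
    {f : ℝ → F} (hfm : StronglyMeasurable f) (hf : Integrable f (intervalMeasure T)) (k : ℕ) :
    ∑ n ∈ Finset.range (2 ^ (k + 1)), ‖haarIncr T (primitive f) (k + 1) n‖ₑ ^ p.toReal ≤
      (if T / 2 ^ (k + 1) ≤ 1 / 2 then 0 else
        2 * 2 ^ p.toReal * eLpNorm f p (intervalMeasure T) ^ p.toReal) +
      4 * ∫⁻ t in Ioo (T / 2 ^ (k + 1)) (2 * (T / 2 ^ (k + 1))), (Ioo 0 1).indicator
        (fun t => ENNReal.ofReal t⁻¹ *
        (ENNReal.ofReal (t ^ (-(1 / p.toReal - 1 / 2))) * modulus T p f t) ^ p.toReal) t := by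
  have hp' : p ≠ ∞ := (hp2.trans (by simp)).ne
  have hp0 : p ≠ 0 := (one_pos.trans_le hp).ne'
  have hpr : 0 < p.toReal := ENNReal.toReal_pos hp0 hp'
  have hpr2 : p.toReal < 2 := by simpa using (ENNReal.toReal_lt_toReal hp' (by simp)).2 hp2
  have h := sum_haarIncr_rpow_le hT hp hp' hfm hf k
  set τ := T / 2 ^ (k + 1) with hτ
  have hτ0 : 0 < τ := by positivity
  refine h.trans ?_
  split_ifs with hc
  · rw [zero_add]
    refine (rpow_mul_modulus_le_lintegral hp hp2 f hτ0).trans (le_of_eq ?_)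
    congr 1
    refine setLIntegral_congr_fun measurableSet_Ioo fun t ht => ?_
    rw [indicator_of_mem]
    exact ⟨hτ0.trans ht.1, by linarith [ht.2]⟩
  · refine le_add_right ?_
    rw [mul_assoc, ← ENNReal.mul_rpow_of_nonneg _ _ hpr.le]
    refine mul_le_mul' ?_ (ENNReal.rpow_le_rpow (modulus_le_two_mul_eLpNorm hp hfm τ) hpr.le)
    rw [← ENNReal.ofReal_ofNat 2]
    refine ENNReal.ofReal_le_ofReal ?_
    calc τ ^ (p.toReal / 2 - 1) ≤ (1 / 2 : ℝ) ^ (p.toReal / 2 - 1) :=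
          Real.rpow_le_rpow_of_nonpos (by norm_num) (not_le.1 hc).le (by linarith)
      _ ≤ (1 / 2 : ℝ) ^ (-1 : ℝ) :=
          Real.rpow_le_rpow_of_exponent_ge (by norm_num) (by norm_num) (by linarith)
      _ = 2 := by
          rw [Real.rpow_neg_one]
          norm_num

theorem haar_mean_le {T : ℝ} (hT : 0 < T) {p : ℝ≥0∞} (hp : 1 ≤ p) (hp' : p ≠ ∞)
    {f : ℝ → F} (hfm : StronglyMeasurable f) :
    ‖haarIncr T (primitive f) 0 0‖ₑ ^ p.toReal ≤
      (‖(Real.sqrt T)⁻¹‖ₑ * ENNReal.ofReal T ^ (1 - 1 / p.toReal)) ^ p.toReal *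
        eLpNorm f p (intervalMeasure T) ^ p.toReal := by
  have hp0 : p ≠ 0 := (one_pos.trans_le hp).ne'
  have hpr : 0 < p.toReal := ENNReal.toReal_pos hp0 hp'
  rw [← ENNReal.mul_rpow_of_nonneg _ _ hpr.le]
  refine ENNReal.rpow_le_rpow ?_ hpr.le
  have e : haarIncr T (primitive f) 0 0 = (Real.sqrt T)⁻¹ • ∫ t in Ioo 0 T, f t := by
    simp [haarIncr, primitive, intervalIntegral.integral_of_le hT.le, integral_Ioc_eq_integral_Ioo]
  rw [e, enorm_smul, mul_assoc]
  refine mul_le_mul_right ?_ _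
  have h1 := eLpNorm_le_eLpNorm_mul_rpow_measure_univ hp
    (hfm.aestronglyMeasurable (μ := intervalMeasure T))
  rw [eLpNorm_one_eq_lintegral_enorm, Measure.restrict_apply_univ, Real.volume_Ioo, sub_zero,
    ENNReal.toReal_one, one_div_one] at h1
  rw [mul_comm]
  exact (enorm_integral_le_lintegral_enorm _).trans h1

/-- The intervals `(τ, 2τ)` with `τ = T / 2 ^ (k + 1)` are disjoint, so the integrals of all
generations add up to at most the Besov integral over `(0, 1)`; the mean and the coarse generations
are controlled by the `L^p`-norm. -/
theorem tsum_haarIncr_rpow_le {T : ℝ} (hT : 0 < T) {p : ℝ≥0∞} (hp : 1 ≤ p) (hp2 : p < 2) :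
    ∃ C : ℝ≥0∞, C ≠ ∞ ∧ ∀ f : ℝ → F, StronglyMeasurable f → Integrable f (intervalMeasure T) →
      ∑' j : (_ : ℕ) × ℕ, ‖haarIncr T (primitive f) j.1 j.2‖ₑ ^ p.toReal ≤
        C * besovENorm T (1 / p.toReal - 1 / 2) p p f ^ p.toReal := by
  have hp' : p ≠ ∞ := (hp2.trans (by simp)).ne
  have hp0 : p ≠ 0 := (one_pos.trans_le hp).ne'
  have hpr : 0 < p.toReal := ENNReal.toReal_pos hp0 hp'
  obtain ⟨k0, hk0⟩ : ∃ k0 : ℕ, T * 2 < 2 ^ k0 := pow_unbounded_of_one_lt _ one_lt_two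
  set A : ℝ≥0∞ := (‖(Real.sqrt T)⁻¹‖ₑ * ENNReal.ofReal T ^ (1 - 1 / p.toReal)) ^ p.toReal with hA
  set B : ℝ≥0∞ := 2 * 2 ^ p.toReal with hB
  have hAtop : A ≠ ∞ := by
    refine ENNReal.rpow_ne_top_of_nonneg hpr.le (ENNReal.mul_ne_top enorm_ne_top ?_)
    exact (ENNReal.rpow_ne_top_of_ne_zero (by simpa using hT) ENNReal.ofReal_ne_top)
  have hBtop : B ≠ ∞ :=
    ENNReal.mul_ne_top (by simp) (ENNReal.rpow_ne_top_of_nonneg hpr.le (by simp))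
  -- `A` comes from the mean, `B` from each of at most `k0` coarse generations, and `4` from the
  -- integrals.
  refine ⟨A + (k0 * B + 4), by finiteness, fun f hfm hf => ?_⟩
  set N := eLpNorm f p (intervalMeasure T) with hN
  set X := besovENorm T (1 / p.toReal - 1 / 2) p p f with hX
  have hNX : N ^ p.toReal ≤ X ^ p.toReal := ENNReal.rpow_le_rpow le_self_add hpr.le
  set g : ℝ → ℝ≥0∞ := fun t => ENNReal.ofReal t⁻¹ *
        (ENNReal.ofReal (t ^ (-(1 / p.toReal - 1 / 2))) * modulus T p f t) ^ p.toReal with hg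
  have hIX : ∫⁻ t, (Ioo 0 1).indicator g t ≤ X ^ p.toReal := by
    have h1 : eLpNorm (fun t => ENNReal.ofReal (t ^ (-(1 / p.toReal - 1 / 2))) * modulus T p f t) p
        logMeasure ^ p.toReal = ∫⁻ t, (Ioo 0 1).indicator g t := by
      rw [eLpNorm_rpow_toReal hp0 hp', lintegral_indicator measurableSet_Ioo]
      exact lintegral_logMeasure _ ((measurable_weighted_modulus _ _ _ _).pow_const _)
    rw [← h1]
    exact ENNReal.rpow_le_rpow le_add_self hpr.le
  have hrow : ∀ k : ℕ, ∑' n : ℕ, ‖haarIncr T (primitive f) k n‖ₑ ^ p.toReal =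
      ∑ n ∈ Finset.range (2 ^ k), ‖haarIncr T (primitive f) k n‖ₑ ^ p.toReal := fun k => by
    refine tsum_eq_sum fun n hn => ?_
    rw [haarIncr_of_le T _ (by simpa using hn), enorm_zero, ENNReal.zero_rpow_of_pos hpr]
  rw [ENNReal.tsum_sigma' fun j : (_ : ℕ) × ℕ =>
    ‖haarIncr T (primitive f) j.1 j.2‖ₑ ^ p.toReal]
  simp only [hrow]
  rw [tsum_eq_zero_add' ENNReal.summable, add_mul, add_mul]
  refine add_le_add ?_ ?_
  · rw [pow_zero, Finset.sum_range_one]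
    exact (haar_mean_le hT hp hp' hfm).trans (mul_le_mul_right hNX _)
  refine (ENNReal.tsum_le_tsum fun k => haar_row_le hT hp hp2 hfm hf k).trans ?_
  rw [ENNReal.tsum_add]
  refine add_le_add ?_ ?_
  · rw [tsum_eq_sum (s := Finset.range k0) fun k hk => ?_]
    · refine (Finset.sum_le_card_nsmul _ _ (B * X ^ p.toReal) fun k _ => ?_).trans (le_of_eq ?_)
      · split_ifs
        · exact zero_le
        · exact mul_le_mul_right hNX _
      · rw [Finset.card_range, nsmul_eq_mul, mul_assoc (k0 : ℝ≥0∞) B]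
    · rw [if_pos]
      have hk' : k0 ≤ k := by simpa using hk
      rw [div_le_iff₀ (by positivity)]
      have : (2 : ℝ) ^ k0 ≤ 2 ^ (k + 1) := pow_le_pow_right₀ (by norm_num) (by omega)
      linarith
  · rw [ENNReal.tsum_mul_left]
    refine mul_le_mul_right (le_trans ?_ hIX) _
    rw [← lintegral_iUnion]
    · exact setLIntegral_le_lintegral _ _
    · exact fun _ => measurableSet_Ioo
    · intro m n hmn
      have key : ∀ m n : ℕ, m < n → 2 * (T / 2 ^ (n + 1)) ≤ T / 2 ^ (m + 1) := fun m n h => by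
        have : (2 : ℝ) ^ (m + 1) ≤ 2 ^ n := pow_le_pow_right₀ (by norm_num) (by omega)
        calc 2 * (T / 2 ^ (n + 1)) = T / 2 ^ n := by rw [pow_succ]; field_simp
          _ ≤ _ := by gcongr
      refine disjoint_left.2 fun t h1 h2 => ?_
      rcases lt_or_gt_of_ne hmn with h | h
      · linarith [key m n h, h1.1, h2.2]
      · linarith [key n m h, h2.1, h1.2]

end HaarBesov

/-! ## Operators represented by functions -/

section Representation

variable {H E : Type*} [NormedAddCommGroup H] [InnerProductSpace ℝ H] [CompleteSpace H]
  [NormedAddCommGroup E] [NormedSpace ℝ E]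

theorem Represents.congr_ae {T : ℝ} {Φ Ψ : ℝ → H →L[ℝ] E}
    {R : Lp H 2 (intervalMeasure T) →L[ℝ] E} (h : Represents T Φ R)
    (hΦΨ : Φ =ᵐ[intervalMeasure T] Ψ) : Represents T Ψ R := by
  refine ⟨fun y => (h.1 y).congr ?_, fun x' => ⟨(h.2 x').1.ae_eq ?_, fun f => ?_⟩⟩
  · filter_upwards [hΦΨ] with t ht
    rw [ht]
  · filter_upwards [hΦΨ] with t ht
    rw [ht]
  · rw [(h.2 x').2 f]
    refine integral_congr_ae ?_
    filter_upwards [hΦΨ] with t ht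
    rw [ht]

theorem Represents.integrable_inner {T : ℝ} {Φ : ℝ → H →L[ℝ] E}
    {R : Lp H 2 (intervalMeasure T) →L[ℝ] E} (h : Represents T Φ R) (x' : StrongDual ℝ E)
    (f : Lp H 2 (intervalMeasure T)) :
    Integrable (fun t => inner ℝ (f t) ((InnerProductSpace.toDual ℝ H).symm (x' ∘L Φ t)))
      (intervalMeasure T) :=
  (L2.integrable_inner f (h.2 x').1.toLp).congr (by
    filter_upwards [(h.2 x').1.coeFn_toLp] with t ht
    rw [ht])

theorem Represents.add {T : ℝ} {Φ Ψ : ℝ → H →L[ℝ] E}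
    {R S : Lp H 2 (intervalMeasure T) →L[ℝ] E} (hR : Represents T Φ R) (hS : Represents T Ψ S) :
    Represents T (Φ + Ψ) (R + S) := by
  have e : ∀ (x' : StrongDual ℝ E) (t : ℝ),
      (InnerProductSpace.toDual ℝ H).symm (x' ∘L (Φ + Ψ) t) =
      (InnerProductSpace.toDual ℝ H).symm (x' ∘L Φ t) +
      (InnerProductSpace.toDual ℝ H).symm (x' ∘L Ψ t) := fun x' t => by
    rw [Pi.add_apply, ContinuousLinearMap.comp_add, map_add]
  refine ⟨fun y => (hR.1 y).add (hS.1 y), fun x' => ⟨?_, fun f => ?_⟩⟩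
  · simp_rw [e]
    exact (hR.2 x').1.add (hS.2 x').1
  · simp_rw [e, inner_add_right]
    rw [integral_add (hR.integrable_inner x' f) (hS.integrable_inner x' f),
      add_apply, map_add, (hR.2 x').2, (hS.2 x').2]

theorem Represents.smul {T : ℝ} {Φ : ℝ → H →L[ℝ] E}
    {R : Lp H 2 (intervalMeasure T) →L[ℝ] E} (hR : Represents T Φ R) (c : ℝ) :
    Represents T (c • Φ) (c • R) := by
  have e : ∀ (x' : StrongDual ℝ E) (t : ℝ),
      (InnerProductSpace.toDual ℝ H).symm (x' ∘L (c • Φ) t) =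
      c • (InnerProductSpace.toDual ℝ H).symm (x' ∘L Φ t) := fun x' t => by
    rw [Pi.smul_apply, ContinuousLinearMap.comp_smul, map_smulₛₗ]
    rfl
  refine ⟨fun y => (hR.1 y).const_smul c, fun x' => ⟨?_, fun f => ?_⟩⟩
  · simp_rw [e]
    exact (hR.2 x').1.const_smul c
  · simp_rw [e, inner_smul_right]
    rw [integral_const_mul, smul_apply, map_smul, (hR.2 x').2, smul_eq_mul]

theorem Represents.unique {T : ℝ} {Φ : ℝ → H →L[ℝ] E}
    {R S : Lp H 2 (intervalMeasure T) →L[ℝ] E} (hR : Represents T Φ R) (hS : Represents T Φ S) :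
    R = S := by
  ext f
  refine (SeparatingDual.eq_iff_forall_dual_eq (R := ℝ)).2 fun x' => ?_
  rw [(hR.2 x').2, (hS.2 x').2]

/-- `Φ* x'` vanishes almost everywhere, with a null set depending on `x'`. Essential separability of
the range of `Φ y` removes the dependence on functionals, and separability of `H` that on `y`. -/
theorem Represents.ae_eq_zero [TopologicalSpace.SeparableSpace H] {T : ℝ} {Φ : ℝ → H →L[ℝ] E}
    (h : Represents T Φ 0) : Φ =ᵐ[intervalMeasure T] 0 := by
  have h1 : ∀ x' : StrongDual ℝ E, (fun t => (InnerProductSpace.toDual ℝ H).symm (x' ∘L Φ t))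
      =ᵐ[intervalMeasure T] 0 := fun x' => by
    obtain ⟨hm, hi⟩ := h.2 x'
    -- The identity for the zero operator is tested with `f = Φ* x'` itself.
    have h2 : hm.toLp _ = 0 := by
      rw [← inner_self_eq_zero (𝕜 := ℝ), L2.inner_def]
      have := hi (hm.toLp _)
      rw [zero_apply, map_zero] at this
      rw [this]
      refine integral_congr_ae ?_
      filter_upwards [hm.coeFn_toLp] with t ht
      rw [ht]
    exact (MemLp.toLp_eq_toLp_iff hm MemLp.zero').1 (h2.trans (MemLp.toLp_zero _).symm)
  have h3 : ∀ y : H, (fun t => Φ t y) =ᵐ[intervalMeasure T] 0 := fun y => by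
    obtain ⟨s, hs, hsm⟩ := (h.1 y).isSeparable_ae_range
    refine ae_eq_zero_of_forall_dual_of_isSeparable ℝ hs (fun x' => ?_) hsm
    filter_upwards [h1 x'] with t ht
    have := InnerProductSpace.toDual_symm_apply (𝕜 := ℝ) (x := y) (y := x' ∘L Φ t)
    rw [ht, Pi.zero_apply, inner_zero_left] at this
    exact this.symm
  have h4 : ∀ᵐ t ∂(intervalMeasure T), ∀ n, Φ t (TopologicalSpace.denseSeq H n) = 0 :=
    ae_all_iff.2 fun n => h3 _
  filter_upwards [h4] with t ht
  ext y
  exact congrFun (DenseRange.equalizer (TopologicalSpace.denseRange_denseSeq H)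
    (Φ t).continuous continuous_const (funext ht)) y

/-- For `x' ∈ E'`, the operator `S ↦ S' x'` from `γ(H, E)` to `H`. -/
def Gamma.adjointApply [CompleteSpace E] (x' : StrongDual ℝ E) : Gamma H E →L[ℝ] H :=
  LinearMap.mkContinuous
    { toFun := fun S => (InnerProductSpace.toDual ℝ H).symm (x' ∘L S.toCLM)
      map_add' := fun S R => by rw [map_add, ContinuousLinearMap.comp_add, map_add]
      map_smul' := fun c S => by
        rw [map_smul, ContinuousLinearMap.comp_smul, map_smulₛₗ]
        rfl }
    ‖x'‖ fun S => by
      refine ((InnerProductSpace.toDual ℝ H).symm.norm_map _).le.trans ?_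
      refine (x'.opNorm_comp_le _).trans ?_
      gcongr
      exact ContinuousLinearMap.opNorm_le_bound _ (norm_nonneg _) S.norm_apply_le

theorem Gamma.inner_adjointApply [CompleteSpace E] (x' : StrongDual ℝ E) (S : Gamma H E) (y : H) :
    inner ℝ (Gamma.adjointApply x' S) y = x' (S.toCLM y) :=
  InnerProductSpace.toDual_symm_apply

/-- Let `u = R* x' ∈ L²(0, T; H)`. Applying `x'` to the expansion of `R f` shows that `Φ* x'` has
the Haar coefficients of `u`, hence equals `u`. Square integrability of `Φ* x'` is thus a
conclusion. -/
theorem represents_of_hasSum [CompleteSpace E] {T : ℝ} (hT : 0 < T) {Φ : ℝ → Gamma H E}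
    (hΦ : Integrable Φ (intervalMeasure T)) {w : Set H} (b : HilbertBasis w ℝ H)
    (R : Lp H 2 (intervalMeasure T) →L[ℝ] E)
    (hR : ∀ f, HasSum (fun q : (_ : (_ : ℕ) × ℕ) × w =>
      ((innerSL ℝ (b q.2)) ∘L haarCoeff H hT q.1) f •
        (haarIncr T (primitive Φ) q.1.1 q.1.2).toCLM (b q.2)) (R f)) :
    Represents T (fun t => (Φ t).toCLM) R := by
  refine ⟨fun y => ?_, fun x' => ?_⟩
  · exact ((ContinuousLinearMap.apply ℝ E y).continuous.comp
      (Gamma.toCLML H E).continuous).comp_aestronglyMeasurable hΦ.1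
  set L : Gamma H E →L[ℝ] H := Gamma.adjointApply x' with hL
  set u : Lp H 2 (intervalMeasure T) := (InnerProductSpace.toDual ℝ _).symm (x' ∘L R) with hu
  have hψ : Integrable (fun t => L (Φ t)) (intervalMeasure T) := L.integrable_comp hΦ
  have hprim : ∀ j : (_ : ℕ) × ℕ, haarIncr T (primitive fun t => L (Φ t)) j.1 j.2 =
      L (haarIncr T (primitive Φ) j.1 j.2) := fun j => by
    rw [← haarIncr_map]
    refine haarIncr_congr hT (fun t ht => ?_) _ _
    exact L.intervalIntegral_comp_comm
      (intervalIntegrable_of_intervalMeasure hΦ ⟨le_rfl, hT.le⟩ ht)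
  have hfu : ∀ f, inner ℝ f u = x' (R f) := fun f => by
    rw [real_inner_comm, hu, InnerProductSpace.toDual_symm_apply]
    rfl
  have hsum : ∀ f : Lp H 2 (intervalMeasure T), HasSum (fun j : (_ : ℕ) × ℕ =>
      inner ℝ (haarIncr T (primitive f) j.1 j.2)
        (haarIncr T (primitive fun t => L (Φ t)) j.1 j.2)) (inner ℝ f u) := fun f => by
    rw [hfu]
    refine ((hR f).mapL x').sigma fun j => ?_
    rw [hprim]
    -- For each Haar index, summation over the basis of `H` is Parseval's identity in `H`.
    convert b.hasSum_inner_mul_inner (haarIncr T (primitive f) j.1 j.2)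
      (L (haarIncr T (primitive Φ) j.1 j.2)) using 1
    ext i
    rw [real_inner_comm (L _) (b i), Gamma.inner_adjointApply, real_inner_comm, map_smul]
    rfl
  have hae := ae_eq_of_hasSum_haarIncr hT hψ u hsum
  refine ⟨(Lp.memLp u).ae_eq hae.symm, fun f => ?_⟩
  rw [← hfu, L2.inner_def]
  refine integral_congr_ae ?_
  filter_upwards [hae] with t ht
  rw [← ht]
  rfl

end Representation

/-! ## The embedding for spaces of type `p` -/

section Embedding

variable {H E : Type*} [NormedAddCommGroup H] [InnerProductSpace ℝ H] [CompleteSpace H]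
  [NormedAddCommGroup E] [NormedSpace ℝ E] [CompleteSpace E]

theorem HasType.exists_represents {T : ℝ} (hT : 0 < T) {p : ℝ≥0∞} [hp1 : Fact (1 ≤ p)]
    (hp2 : p < 2) (h : HasType E p.toReal) :
    ∃ C : ℝ, ∀ Φ : Besov (Gamma H E) T (1 / p.toReal - 1 / 2) p p,
      ∃ R : Gamma (Lp H 2 (intervalMeasure T)) E,
        Represents T (fun t => (Φ.toLp t).toCLM) R.toCLM ∧ ‖R‖ ≤ C * ‖Φ‖ := by
  have hp : 1 ≤ p := hp1.out
  have hp' : p ≠ ∞ := (hp2.trans (by simp)).ne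
  have hp0 : p ≠ 0 := (one_pos.trans_le hp).ne'
  have hpr : 0 < p.toReal := ENNReal.toReal_pos hp0 hp'
  have hpr1 : 1 ≤ p.toReal := by simpa using ENNReal.toReal_mono hp' hp
  have hpr2 : p.toReal < 2 := by simpa using (ENNReal.toReal_lt_toReal hp' (by simp)).2 hp2
  obtain ⟨C, hC0, hC⟩ := h.exists_typeBound
  obtain ⟨B, hB, hbound⟩ := tsum_haarIncr_rpow_le (F := Gamma H E) hT hp hp2
  refine ⟨C * B.toReal ^ (1 / p.toReal), fun Φ => ?_⟩
  have hi : Integrable Φ.toLp (intervalMeasure T) := (Lp.memLp Φ.toLp).integrable hp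
  have hle := hbound Φ.toLp (Lp.stronglyMeasurable Φ.toLp) hi
  set S : ((_ : ℕ) × ℕ) → Gamma H E := fun j => haarIncr T (primitive Φ.toLp) j.1 j.2 with hS
  have htop : B * besovENorm T (1 / p.toReal - 1 / 2) p p Φ.toLp ^ p.toReal ≠ ∞ :=
    ENNReal.mul_ne_top hB (ENNReal.rpow_ne_top_of_nonneg hpr.le Φ.besovENorm_lt_top.ne)
  have hSn : ∀ j, ‖S j‖ ^ p.toReal = (‖S j‖ₑ ^ p.toReal).toReal := fun j => by
    rw [← ENNReal.toReal_rpow, toReal_enorm]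
  have hsum : Summable fun j => ‖S j‖ ^ p.toReal := by
    simp_rw [hSn]
    exact ENNReal.summable_toReal (ne_top_of_le_ne_top htop hle)
  have htsum : ∑' j, ‖S j‖ ^ p.toReal ≤ B.toReal * ‖Φ‖ ^ p.toReal := by
    simp_rw [hSn]
    rw [← ENNReal.tsum_toReal_eq fun j => ENNReal.rpow_ne_top_of_nonneg hpr.le enorm_ne_top,
      Besov.norm_def, ENNReal.toReal_rpow, ← ENNReal.toReal_mul]
    exact ENNReal.toReal_mono htop hle
  obtain ⟨h1, h2⟩ := summable_sigma_gaussianTerm hpr1 hpr2 hC0 hC (stdBasis H) hsum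
  obtain ⟨R, hR, hRn⟩ := exists_gamma_of_isBessel
    (isBessel_haarCoeff hT (stdBasis H).orthonormal) h1
  refine ⟨R, represents_of_hasSum hT hi (stdBasis H) R.toCLM hR, hRn.trans (h2.trans ?_)⟩
  rw [mul_assoc]
  refine mul_le_mul_of_nonneg_left ?_ hC0
  calc (∑' j, ‖S j‖ ^ p.toReal) ^ (1 / p.toReal)
      ≤ (B.toReal * ‖Φ‖ ^ p.toReal) ^ (1 / p.toReal) :=
        Real.rpow_le_rpow (tsum_nonneg fun j => by positivity) htsum (by positivity)
    _ = _ := by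
        rw [Real.mul_rpow (by positivity) (by positivity), ← Real.rpow_mul (norm_nonneg _),
          mul_one_div_cancel hpr.ne', Real.rpow_one]

/-- The chosen operators depend linearly on `Φ` because a function represents at most one operator.
-/
theorem HasType.exists_embedding [TopologicalSpace.SeparableSpace H] {T : ℝ} (hT : 0 < T)
    {p : ℝ≥0∞} [hp1 : Fact (1 ≤ p)] (hp2 : p < 2) (h : HasType E p.toReal) :
    ∃ J : Besov (Gamma H E) T (1 / p.toReal - 1 / 2) p p →L[ℝ]
        Gamma (Lp H 2 (intervalMeasure T)) E,
      Function.Injective J ∧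
      ∀ Φ : Besov (Gamma H E) T (1 / p.toReal - 1 / 2) p p,
        Represents T (fun t => (Φ.toLp t).toCLM) (J Φ).toCLM := by
  obtain ⟨C, hC⟩ := HasType.exists_represents (H := H) hT hp2 h
  choose J hJ hJn using hC
  let L : Besov (Gamma H E) T (1 / p.toReal - 1 / 2) p p →L[ℝ]
      Gamma (Lp H 2 (intervalMeasure T)) E :=
    LinearMap.mkContinuous
      { toFun := J
        map_add' := fun Φ Ψ => by
          apply Gamma.toCLM_injective
          rw [map_add]
          refine (hJ (Φ + Ψ)).unique (((hJ Φ).add (hJ Ψ)).congr_ae ?_)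
          rw [map_add]
          filter_upwards [Lp.coeFn_add Φ.toLp Ψ.toLp] with t ht
          rw [ht, Pi.add_apply, Pi.add_apply, map_add]
        map_smul' := fun c Φ => by
          apply Gamma.toCLM_injective
          rw [RingHom.id_apply, map_smul]
          refine (hJ (c • Φ)).unique (((hJ Φ).smul c).congr_ae ?_)
          rw [map_smul]
          filter_upwards [Lp.coeFn_smul c Φ.toLp] with t ht
          rw [ht, Pi.smul_apply, Pi.smul_apply, map_smul] }
      C hJn
  refine ⟨L, (injective_iff_map_eq_zero L).2 fun Φ hΦ => ?_, hJ⟩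
  have h0 : Represents T (fun t => (Φ.toLp t).toCLM) 0 := by
    have := hJ Φ
    rwa [show J Φ = 0 from hΦ, map_zero] at this
  apply Besov.toLp_injective
  rw [map_zero]
  refine Lp.eq_zero_iff_ae_eq_zero.2 ?_
  filter_upwards [h0.ae_eq_zero] with t ht
  apply Gamma.toCLM_injective
  rw [ht, Pi.zero_apply, Pi.zero_apply, map_zero]

end Embedding

/-! ## Step functions in Besov spaces -/

section StepFunction

variable {F : Type*} [NormedAddCommGroup F] {N : ℕ}

/-- The `n`-th interval of length `δ`. -/
def stepInterval (δ : ℝ) (n : ℕ) : Set ℝ := Ioc (n * δ) ((n + 1) * δ)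

/-- The function with value `G n` on the `n`-th interval of length `δ`. -/
def stepFun (δ : ℝ) (G : Fin N → F) (t : ℝ) : F :=
  ∑ n : Fin N, (stepInterval δ n).indicator (fun _ => G n) t

theorem measurableSet_stepInterval (δ : ℝ) (n : ℕ) : MeasurableSet (stepInterval δ n) :=
  measurableSet_Ioc

theorem stronglyMeasurable_stepFun (δ : ℝ) (G : Fin N → F) : StronglyMeasurable (stepFun δ G) :=
  Finset.stronglyMeasurable_fun_sum _ fun n _ =>
    stronglyMeasurable_const.indicator (measurableSet_stepInterval δ n)

theorem volume_stepInterval {δ : ℝ} (n : ℕ) : volume (stepInterval δ n) = ENNReal.ofReal δ := by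
  rw [stepInterval, Real.volume_Ioc]
  congr 1
  ring

theorem stepInterval_eq_of_mem {δ : ℝ} (hδ : 0 < δ) {m n : ℕ} {t : ℝ} (hm : t ∈ stepInterval δ m)
    (hn : t ∈ stepInterval δ n) : m = n := by
  have h1 : (m : ℝ) < n + 1 := lt_of_mul_lt_mul_right (hm.1.trans_le hn.2) hδ.le
  have h2 : (n : ℝ) < m + 1 := lt_of_mul_lt_mul_right (hn.1.trans_le hm.2) hδ.le
  norm_cast at h1 h2
  omega

theorem stepFun_of_mem {δ : ℝ} (hδ : 0 < δ) (G : Fin N → F) {n : Fin N} {t : ℝ}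
    (ht : t ∈ stepInterval δ n) : stepFun δ G t = G n := by
  rw [stepFun, Finset.sum_eq_single n, indicator_of_mem ht]
  · intro m _ hmn
    refine indicator_of_notMem (fun hm => hmn ?_) _
    exact Fin.ext (stepInterval_eq_of_mem hδ hm ht)
  · simp

theorem stepFun_of_notMem {δ : ℝ} (G : Fin N → F) {t : ℝ}
    (ht : ∀ n : Fin N, t ∉ stepInterval δ n) : stepFun δ G t = 0 :=
  Finset.sum_eq_zero fun n _ => indicator_of_notMem (ht n) _

theorem stepInterval_subset {T δ : ℝ} (hδ : 0 < δ) (hN : N * δ < T) (n : Fin N) :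
    stepInterval δ n ⊆ Ioo 0 T := by
  intro t ht
  have h1 : ((n : ℕ) : ℝ) + 1 ≤ N := by exact_mod_cast n.2
  refine ⟨lt_of_le_of_lt (by positivity) ht.1, ht.2.trans_lt (lt_of_le_of_lt ?_ hN)⟩
  gcongr

theorem enorm_stepFun_rpow_le {δ q : ℝ} (hδ : 0 < δ) (hq : 0 < q) (G : Fin N → F) (t : ℝ) :
    ‖stepFun δ G t‖ₑ ^ q ≤
      ∑ n : Fin N, (stepInterval δ n).indicator (fun _ => ‖G n‖ₑ ^ q) t := by
  by_cases h : ∃ n : Fin N, t ∈ stepInterval δ n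
  · obtain ⟨n, hn⟩ := h
    rw [stepFun_of_mem hδ G hn]
    refine le_trans (le_of_eq ?_) (Finset.single_le_sum (fun _ _ => zero_le) (Finset.mem_univ n))
    rw [indicator_of_mem hn]
  · push Not at h
    rw [stepFun_of_notMem G h, enorm_zero, ENNReal.zero_rpow_of_pos hq]
    exact zero_le

theorem lintegral_stepFun_rpow_le {δ q : ℝ} (hδ : 0 < δ) (hq : 0 < q) (G : Fin N → F) (T : ℝ) :
    ∫⁻ t in Ioo 0 T, ‖stepFun δ G t‖ₑ ^ q ≤ ENNReal.ofReal δ * ∑ n, ‖G n‖ₑ ^ q := by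
  refine (setLIntegral_le_lintegral _ _).trans ?_
  refine (lintegral_mono fun t => enorm_stepFun_rpow_le hδ hq G t).trans (le_of_eq ?_)
  have hm : ∀ n : Fin N, Measurable ((stepInterval δ n).indicator fun _ => ‖G n‖ₑ ^ q) := fun n =>
    measurable_const.indicator (measurableSet_stepInterval δ n)
  rw [lintegral_finsetSum _ fun n _ => hm n, Finset.mul_sum]
  refine Finset.sum_congr rfl fun n _ => ?_
  rw [lintegral_indicator_const (measurableSet_stepInterval δ n), volume_stepInterval, mul_comm]

/-- The points of `stepInterval δ n` which a translation by `h` moves out of it. -/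
def leaveSet (δ h : ℝ) (n : ℕ) : Set ℝ := {r | r ∈ stepInterval δ n ∧ r + h ∉ stepInterval δ n}

/-- The points outside `stepInterval δ n` which a translation by `h` moves into it. -/
def enterSet (δ h : ℝ) (n : ℕ) : Set ℝ := {r | r ∉ stepInterval δ n ∧ r + h ∈ stepInterval δ n}

theorem measurableSet_leaveSet (δ h : ℝ) (n : ℕ) : MeasurableSet (leaveSet δ h n) :=
  (measurableSet_stepInterval δ n).inter
    ((by fun_prop : Measurable fun r : ℝ => r + h) (measurableSet_stepInterval δ n)).compl

theorem measurableSet_enterSet (δ h : ℝ) (n : ℕ) : MeasurableSet (enterSet δ h n) :=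
  (measurableSet_stepInterval δ n).compl.inter
    ((by fun_prop : Measurable fun r : ℝ => r + h) (measurableSet_stepInterval δ n))

theorem volume_leaveSet_le (δ h : ℝ) (n : ℕ) :
    volume (leaveSet δ h n) ≤ ENNReal.ofReal |h| := by
  rcases le_or_gt 0 h with hh | hh
  · calc volume (leaveSet δ h n) ≤ volume (Icc ((n + 1) * δ - h) ((n + 1) * δ)) := by
          refine measure_mono fun r hr => ⟨?_, hr.1.2⟩
          by_contra hc
          exact hr.2 ⟨by linarith [hr.1.1], by linarith⟩
      _ = _ := by rw [Real.volume_Icc, abs_of_nonneg hh]; congr 1; ring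
  · calc volume (leaveSet δ h n) ≤ volume (Icc (n * δ) (n * δ - h)) := by
          refine measure_mono fun r hr => ⟨hr.1.1.le, ?_⟩
          by_contra hc
          exact hr.2 ⟨by linarith, by linarith [hr.1.2]⟩
      _ = _ := by rw [Real.volume_Icc, abs_of_neg hh]; congr 1; ring

theorem volume_enterSet_le (δ h : ℝ) (n : ℕ) :
    volume (enterSet δ h n) ≤ ENNReal.ofReal |h| := by
  rcases le_or_gt 0 h with hh | hh
  · calc volume (enterSet δ h n) ≤ volume (Icc (n * δ - h) (n * δ)) := by
          refine measure_mono fun r hr => ⟨by linarith [hr.2.1], ?_⟩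
          by_contra hc
          exact hr.1 ⟨by linarith, by linarith [hr.2.2]⟩
      _ = _ := by rw [Real.volume_Icc, abs_of_nonneg hh]; congr 1; ring
  · calc volume (enterSet δ h n) ≤ volume (Icc ((n + 1) * δ) ((n + 1) * δ - h)) := by
          refine measure_mono fun r hr => ⟨?_, by linarith [hr.2.2]⟩
          by_contra hc
          exact hr.1 ⟨by linarith [hr.2.1], by linarith⟩
      _ = _ := by rw [Real.volume_Icc, abs_of_neg hh]; congr 1; ring

/-- The difference vanishes if `r` and `r + h` share an interval. Otherwise each of the two points
has left or entered its interval, and convexity of the `q`-th power separates the two values. -/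
theorem enorm_stepFun_sub_rpow_le {δ q : ℝ} (hδ : 0 < δ) (hq : 1 ≤ q) (G : Fin N → F)
    (r h : ℝ) : ‖stepFun δ G (r + h) - stepFun δ G r‖ₑ ^ q ≤
      2 ^ q * ∑ n : Fin N, ((enterSet δ h n).indicator (fun _ => ‖G n‖ₑ ^ q) r +
        (leaveSet δ h n).indicator (fun _ => ‖G n‖ₑ ^ q) r) := by
  have hq0 : 0 < q := by linarith
  by_cases hsame : ∃ n : Fin N, r ∈ stepInterval δ n ∧ r + h ∈ stepInterval δ n
  · obtain ⟨n, h1, h2⟩ := hsame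
    rw [stepFun_of_mem hδ G h1, stepFun_of_mem hδ G h2, sub_self, enorm_zero,
      ENNReal.zero_rpow_of_pos hq0]
    exact zero_le
  push Not at hsame
  have h1 : ‖stepFun δ G (r + h)‖ₑ ^ q ≤
      ∑ n : Fin N, (enterSet δ h n).indicator (fun _ => ‖G n‖ₑ ^ q) r := by
    refine (enorm_stepFun_rpow_le hδ hq0 G (r + h)).trans (Finset.sum_le_sum fun n _ => ?_)
    by_cases hn : r + h ∈ stepInterval δ n
    · have : r ∈ enterSet δ h n := ⟨fun hr => hsame n hr hn, hn⟩
      rw [indicator_of_mem hn, indicator_of_mem this]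
    · rw [indicator_of_notMem hn]
      exact zero_le
  have h2 : ‖stepFun δ G r‖ₑ ^ q ≤
      ∑ n : Fin N, (leaveSet δ h n).indicator (fun _ => ‖G n‖ₑ ^ q) r := by
    refine (enorm_stepFun_rpow_le hδ hq0 G r).trans (Finset.sum_le_sum fun n _ => ?_)
    by_cases hn : r ∈ stepInterval δ n
    · have : r ∈ leaveSet δ h n := ⟨hn, hsame n hn⟩
      rw [indicator_of_mem hn, indicator_of_mem this]
    · rw [indicator_of_notMem hn]
      exact zero_le
  rw [Finset.sum_add_distrib]
  calc ‖stepFun δ G (r + h) - stepFun δ G r‖ₑ ^ q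
      ≤ (‖stepFun δ G (r + h)‖ₑ + ‖stepFun δ G r‖ₑ) ^ q :=
        ENNReal.rpow_le_rpow (enorm_sub_le) hq0.le
    _ ≤ 2 ^ (q - 1) * (‖stepFun δ G (r + h)‖ₑ ^ q + ‖stepFun δ G r‖ₑ ^ q) :=
        ENNReal.rpow_add_le_mul_rpow_add_rpow _ _ hq
    _ ≤ _ := by
        refine mul_le_mul' ?_ (add_le_add h1 h2)
        exact ENNReal.rpow_le_rpow_of_exponent_le (by norm_num) (by linarith)

/-- For `t ≤ δ` each value matters only on two sets of measure at most `t`, where a translation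
enters or leaves its interval. For `t ≥ δ` the trivial bound is used. -/
theorem modulus_stepFun_rpow_le {T δ : ℝ} (hδ : 0 < δ) {p : ℝ≥0∞} (hp : 1 ≤ p) (hp' : p ≠ ∞)
    (G : Fin N → F) (t : ℝ) :
    modulus T p (stepFun δ G) t ^ p.toReal ≤
      2 * 2 ^ p.toReal * ENNReal.ofReal (min t δ) * ∑ n, ‖G n‖ₑ ^ p.toReal := by
  have hp0 : p ≠ 0 := (one_pos.trans_le hp).ne'
  have hpr : 0 < p.toReal := ENNReal.toReal_pos hp0 hp'
  have hpr1 : 1 ≤ p.toReal := by simpa using ENNReal.toReal_mono hp' hp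
  set S := ∑ n, ‖G n‖ₑ ^ p.toReal with hS
  rcases le_total t δ with htδ | htδ
  · rw [min_eq_left htδ, ← ENNReal.le_rpow_inv_iff hpr]
    refine iSup₂_le fun h hh => ?_
    rw [ENNReal.le_rpow_inv_iff hpr, eLpNorm_rpow_toReal hp0 hp']
    calc ∫⁻ r in shiftDomain T h,
          ‖translateZero T h (stepFun δ G) r - stepFun δ G r‖ₑ ^ p.toReal
        = ∫⁻ r in shiftDomain T h, ‖stepFun δ G (r + h) - stepFun δ G r‖ₑ ^ p.toReal := by
          refine setLIntegral_congr_fun (measurableSet_shiftDomain T h) fun r hr => ?_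
          have : translateZero T h (stepFun δ G) r = stepFun δ G (r + h) :=
            indicator_of_mem (s := {t | t + h ∈ Ioo 0 T}) hr.2 _
          simp only [this]
      _ ≤ ∫⁻ r, ‖stepFun δ G (r + h) - stepFun δ G r‖ₑ ^ p.toReal :=
          setLIntegral_le_lintegral _ _
      _ ≤ ∫⁻ r, 2 ^ p.toReal * ∑ n : Fin N,
          ((enterSet δ h n).indicator (fun _ => ‖G n‖ₑ ^ p.toReal) r +
          (leaveSet δ h n).indicator (fun _ => ‖G n‖ₑ ^ p.toReal) r) :=
          lintegral_mono fun r => enorm_stepFun_sub_rpow_le hδ hpr1 G r h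
      _ = 2 ^ p.toReal * ∑ n : Fin N, (‖G n‖ₑ ^ p.toReal * volume (enterSet δ h n) +
          ‖G n‖ₑ ^ p.toReal * volume (leaveSet δ h n)) := by
          have hm : ∀ n : Fin N,
              Measurable ((enterSet δ h n).indicator fun _ => ‖G n‖ₑ ^ p.toReal) := fun n =>
            measurable_const.indicator (measurableSet_enterSet δ h n)
          have hm' : ∀ n : Fin N,
              Measurable ((leaveSet δ h n).indicator fun _ => ‖G n‖ₑ ^ p.toReal) := fun n =>
            measurable_const.indicator (measurableSet_leaveSet δ h n)
          have hadd : ∀ n : Fin N,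
              Measurable fun r => (enterSet δ h n).indicator (fun _ => ‖G n‖ₑ ^ p.toReal) r +
                (leaveSet δ h n).indicator (fun _ => ‖G n‖ₑ ^ p.toReal) r := fun n =>
            (hm n).add (hm' n)
          rw [lintegral_const_mul _ (Finset.measurable_fun_sum _ fun n _ => hadd n),
            lintegral_finsetSum _ fun n _ => hadd n]
          congr 1
          refine Finset.sum_congr rfl fun n _ => ?_
          rw [lintegral_add_left (hm n), lintegral_indicator_const (measurableSet_enterSet δ h n),
            lintegral_indicator_const (measurableSet_leaveSet δ h n)]
      _ ≤ 2 ^ p.toReal * ∑ n : Fin N, (‖G n‖ₑ ^ p.toReal * ENNReal.ofReal t +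
          ‖G n‖ₑ ^ p.toReal * ENNReal.ofReal t) := by
          gcongr with n
          · exact (volume_enterSet_le δ h n).trans (ENNReal.ofReal_le_ofReal hh)
          · exact (volume_leaveSet_le δ h n).trans (ENNReal.ofReal_le_ofReal hh)
      _ = 2 * 2 ^ p.toReal * ENNReal.ofReal t * S := by
          simp only [← two_mul, ← Finset.mul_sum, ← Finset.sum_mul, ← hS]
          ring
  · rw [min_eq_right htδ]
    have h1 := ENNReal.rpow_le_rpow
      (modulus_le_two_mul_eLpNorm (T := T) hp (stronglyMeasurable_stepFun δ G) t) hpr.le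
    rw [ENNReal.mul_rpow_of_nonneg _ _ hpr.le, eLpNorm_rpow_toReal hp0 hp'] at h1
    refine h1.trans ((mul_le_mul_right (lintegral_stepFun_rpow_le hδ hpr G T) _).trans ?_)
    rw [← mul_assoc, mul_assoc 2]
    refine mul_le_mul_left ?_ _
    exact le_mul_of_one_le_left zero_le (by norm_num)

/-- Split at `δ`: near `0` the integrand is `t^(q/2 - 1)`, integrable as `q > 0`; beyond `δ` it is
`δ t^(q/2 - 2)`, integrable as `q < 2`. Both pieces scale as `δ^(q/2)`. -/
theorem lintegral_min_rpow_le {δ q : ℝ} (hδ : 0 < δ) (hq : 0 < q) (hq2 : q < 2) :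
    ∫⁻ t in Ioi 0, ENNReal.ofReal (t ^ (q / 2 - 2) * min t δ) ≤
      ENNReal.ofReal ((2 / q + 1 / (1 - q / 2)) * δ ^ (q / 2)) := by
  have h1 : ∫⁻ t in Ioc 0 δ, ENNReal.ofReal (t ^ (q / 2 - 2) * min t δ) ≤
      ENNReal.ofReal (2 / q * δ ^ (q / 2)) := by
    have hi : IntegrableOn (fun t : ℝ => t ^ (q / 2 - 1)) (Ioc 0 δ) :=
      (intervalIntegrable_iff_integrableOn_Ioc_of_le hδ.le).1
        (intervalIntegral.intervalIntegrable_rpow' (by linarith))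
    have e : ∫ t in Ioc 0 δ, t ^ (q / 2 - 1) = 2 / q * δ ^ (q / 2) := by
      rw [← intervalIntegral.integral_of_le hδ.le, integral_rpow (Or.inl (by linarith)),
        sub_add_cancel, Real.zero_rpow (by positivity), sub_zero]
      field_simp
    rw [← e, ofReal_integral_eq_lintegral_ofReal hi ((ae_restrict_mem measurableSet_Ioc).mono
      fun t ht => Real.rpow_nonneg ht.1.le _)]
    refine setLIntegral_mono' measurableSet_Ioc fun t ht => ENNReal.ofReal_le_ofReal ?_
    rw [min_eq_left ht.2, ← Real.rpow_add_one ht.1.ne']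
    refine le_of_eq ?_
    congr 1
    ring
  have h2 : ∫⁻ t in Ioi δ, ENNReal.ofReal (t ^ (q / 2 - 2) * min t δ) ≤
      ENNReal.ofReal (1 / (1 - q / 2) * δ ^ (q / 2)) := by
    have hi : IntegrableOn (fun t : ℝ => t ^ (q / 2 - 2)) (Ioi δ) :=
      integrableOn_Ioi_rpow_of_lt (by linarith) hδ
    have e : ∫ t in Ioi δ, t ^ (q / 2 - 2) * δ = 1 / (1 - q / 2) * δ ^ (q / 2) := by
      rw [integral_mul_const, integral_Ioi_rpow_of_lt (by linarith) hδ]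
      obtain ⟨a, ha⟩ : ∃ a, q / 2 = a + 1 := ⟨q / 2 - 1, by ring⟩
      have ha0 : a ≠ 0 := by linarith
      rw [ha, show a + 1 - 2 + 1 = a by ring, show 1 - (a + 1) = -a by ring,
        Real.rpow_add_one hδ.ne']
      field_simp
    rw [← e, ofReal_integral_eq_lintegral_ofReal (hi.mul_const δ)
      ((ae_restrict_mem measurableSet_Ioi).mono fun t ht =>
        mul_nonneg (Real.rpow_nonneg (hδ.le.trans (le_of_lt ht)) _) hδ.le)]
    refine setLIntegral_mono' measurableSet_Ioi fun t ht => ENNReal.ofReal_le_ofReal ?_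
    rw [min_eq_right (le_of_lt ht)]
  have h0 : 0 < 1 - q / 2 := by linarith
  rw [← Ioc_union_Ioi_eq_Ioi hδ.le, add_mul, ENNReal.ofReal_add (by positivity) (by positivity)]
  exact (lintegral_union_le _ _ _).trans (add_le_add h1 h2)

/-- The factor `√δ` is the `q`-th root of `δ^(q/2)` in the integral of `min t δ`; it later cancels
the normalization of the indicators. In the constant, `1` belongs to the `L^p`-norm and `c ^ (1 /
q)` to the seminorm. -/
theorem besovENorm_stepFun_le {p : ℝ≥0∞} (hp : 1 ≤ p) (hp2 : p < 2) :
    ∃ C : ℝ, 0 ≤ C ∧ ∀ (T δ : ℝ), 0 < δ → δ ≤ 1 → ∀ (N : ℕ) (G : Fin N → F),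
      besovENorm T (1 / p.toReal - 1 / 2) p p (stepFun δ G) ≤
        ENNReal.ofReal (C * Real.sqrt δ * (∑ n, ‖G n‖ ^ p.toReal) ^ (1 / p.toReal)) := by
  have hp' : p ≠ ∞ := (hp2.trans (by simp)).ne
  have hp0 : p ≠ 0 := (one_pos.trans_le hp).ne'
  have hpr : 0 < p.toReal := ENNReal.toReal_pos hp0 hp'
  have hpr2 : p.toReal < 2 := by simpa using (ENNReal.toReal_lt_toReal hp' (by simp)).2 hp2
  set q := p.toReal with hq
  set c : ℝ := 2 * 2 ^ q * (2 / q + 1 / (1 - q / 2)) with hc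
  have hq2 : 0 < 1 - q / 2 := by linarith
  have hc0 : 0 ≤ c := by positivity
  refine ⟨1 + c ^ (1 / q), by positivity, fun T δ hδ hδ1 N G => ?_⟩
  set S : ℝ := ∑ n, ‖G n‖ ^ q with hS
  have hS0 : 0 ≤ S := by positivity
  have hSe : ∑ n, ‖G n‖ₑ ^ q = ENNReal.ofReal S := by
    rw [hS, ENNReal.ofReal_sum_of_nonneg fun _ _ => by positivity]
    refine Finset.sum_congr rfl fun n _ => ?_
    rw [← ENNReal.ofReal_rpow_of_nonneg (norm_nonneg _) hpr.le, ofReal_norm]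
  have h1 : eLpNorm (stepFun δ G) p (intervalMeasure T) ≤
      ENNReal.ofReal (Real.sqrt δ * S ^ (1 / q)) := by
    have h2 := lintegral_stepFun_rpow_le hδ hpr G T
    rw [hSe, ← ENNReal.ofReal_mul hδ.le] at h2
    rw [← ENNReal.rpow_le_rpow_iff hpr, eLpNorm_rpow_toReal hp0 hp']
    refine h2.trans ?_
    rw [ENNReal.ofReal_rpow_of_nonneg (by positivity) hpr.le]
    refine ENNReal.ofReal_le_ofReal ?_
    rw [Real.mul_rpow (by positivity) (by positivity), ← Real.rpow_mul hS0,
      one_div_mul_cancel hpr.ne', Real.rpow_one, Real.sqrt_eq_rpow, ← Real.rpow_mul hδ.le]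
    gcongr
    -- Only here is `δ ≤ 1` used: the `L^p`-norm scales as `δ^(1/q)`, which is at most `√δ`.
    calc δ = δ ^ (1 : ℝ) := (Real.rpow_one δ).symm
      _ ≤ δ ^ (1 / 2 * q) := Real.rpow_le_rpow_of_exponent_ge hδ hδ1 (by linarith)
  have h3 : eLpNorm (fun t => ENNReal.ofReal (t ^ (-(1 / q - 1 / 2))) *
      modulus T p (stepFun δ G) t) p logMeasure ≤
      ENNReal.ofReal (c ^ (1 / q) * (Real.sqrt δ * S ^ (1 / q))) := by
    rw [← ENNReal.rpow_le_rpow_iff hpr, eLpNorm_rpow_toReal hp0 hp', lintegral_logMeasure _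
      ((measurable_weighted_modulus _ _ _ _).enorm.pow_const _)]
    simp only [enorm_eq_self]
    calc ∫⁻ t in Ioo 0 1, ENNReal.ofReal t⁻¹ * (ENNReal.ofReal (t ^ (-(1 / q - 1 / 2))) *
          modulus T p (stepFun δ G) t) ^ q
        ≤ ∫⁻ t in Ioo 0 1, 2 * 2 ^ q * ENNReal.ofReal S *
            ENNReal.ofReal (t ^ (q / 2 - 2) * min t δ) := by
          refine setLIntegral_mono' measurableSet_Ioo fun t ht => ?_
          have ht0 := ht.1
          have hm := modulus_stepFun_rpow_le (T := T) hδ hp hp' G t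
          rw [hSe] at hm
          have e : ENNReal.ofReal t⁻¹ * ENNReal.ofReal (t ^ (-(1 / q - 1 / 2))) ^ q =
              ENNReal.ofReal (t ^ (q / 2 - 2)) := by
            rw [ENNReal.ofReal_rpow_of_pos (by positivity), ← ENNReal.ofReal_mul (by positivity),
              ← Real.rpow_mul ht0.le, ← Real.rpow_neg_one, ← Real.rpow_add ht0]
            congr 2
            field_simp
            ring
          rw [ENNReal.mul_rpow_of_nonneg _ _ hpr.le, ← mul_assoc, e,
            ENNReal.ofReal_mul (by positivity)]
          refine (mul_le_mul_right hm _).trans (le_of_eq ?_)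
          ring
      _ ≤ ∫⁻ t in Ioi 0, 2 * 2 ^ q * ENNReal.ofReal S *
            ENNReal.ofReal (t ^ (q / 2 - 2) * min t δ) := lintegral_mono_set fun t ht => ht.1
      _ ≤ 2 * 2 ^ q * ENNReal.ofReal S *
            ENNReal.ofReal ((2 / q + 1 / (1 - q / 2)) * δ ^ (q / 2)) := by
          rw [lintegral_const_mul _ (by fun_prop)]
          gcongr
          exact lintegral_min_rpow_le hδ hpr hpr2
      _ = _ := by
          have h2 : (2 : ℝ≥0∞) * 2 ^ q = ENNReal.ofReal (2 * 2 ^ q) := by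
            rw [ENNReal.ofReal_mul (by norm_num), ENNReal.ofReal_ofNat,
              ← ENNReal.ofReal_rpow_of_pos (by norm_num), ENNReal.ofReal_ofNat]
          rw [h2, ENNReal.ofReal_rpow_of_nonneg (by positivity) hpr.le,
            ← ENNReal.ofReal_mul (by positivity), ← ENNReal.ofReal_mul (by positivity)]
          congr 1
          rw [Real.mul_rpow (Real.rpow_nonneg hc0 _) (by positivity),
            Real.mul_rpow (Real.sqrt_nonneg δ) (by positivity), ← Real.rpow_mul hS0,
            ← Real.rpow_mul hc0, one_div_mul_cancel hpr.ne', Real.rpow_one, Real.rpow_one,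
            Real.sqrt_eq_rpow, ← Real.rpow_mul hδ.le, hc, show 1 / 2 * q = q / 2 by ring]
          ring
  refine (add_le_add h1 h3).trans (le_of_eq ?_)
  rw [← ENNReal.ofReal_add (by positivity) (by positivity)]
  congr 1
  ring

end StepFunction

/-! ## The converse -/

section Converse

variable {H E : Type*} [NormedAddCommGroup H] [InnerProductSpace ℝ H] [CompleteSpace H]
  [NormedAddCommGroup E] [NormedSpace ℝ E] [CompleteSpace E]

/-- The normalized indicator functions of the intervals of length `δ`, with value `y`. -/
def stepVector (T δ : ℝ) (y : H) (n : ℕ) : Lp H 2 (intervalMeasure T) :=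
  indicatorConstLp 2 (measurableSet_stepInterval δ n) (measure_ne_top (intervalMeasure T) _)
    ((Real.sqrt δ)⁻¹ • y)

theorem measureReal_stepInterval {T δ : ℝ} (hδ : 0 < δ) {N : ℕ} (hN : N * δ < T) (n : Fin N) :
    (intervalMeasure T).real (stepInterval δ n) = δ := by
  rw [measureReal_restrict_apply (measurableSet_stepInterval δ n),
    inter_eq_left.2 (stepInterval_subset hδ hN n), measureReal_def, volume_stepInterval,
    ENNReal.toReal_ofReal hδ.le]

theorem orthonormal_stepVector {T δ : ℝ} (hδ : 0 < δ) {N : ℕ} (hN : N * δ < T) {y : H}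
    (hy : ‖y‖ = 1) : Orthonormal ℝ fun n : Fin N => stepVector T δ y n := by
  classical
  rw [orthonormal_iff_ite]
  intro m n
  rw [stepVector, stepVector, L2.inner_indicatorConstLp_indicatorConstLp]
  split_ifs with h
  · subst h
    rw [inter_self, measureReal_stepInterval hδ hN, inner_smul_left, inner_smul_right,
      real_inner_self_eq_norm_sq, hy, conj_trivial, smul_eq_mul, one_pow, mul_one, ← mul_inv,
      Real.mul_self_sqrt hδ.le, mul_inv_cancel₀ hδ.ne']
  · have : stepInterval δ m ∩ stepInterval δ n = ∅ := by
      refine Set.eq_empty_of_forall_notMem fun t ht => h ?_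
      exact Fin.ext (stepInterval_eq_of_mem hδ ht.1 ht.2)
    rw [this, measureReal_empty, zero_smul]

/-- The integral of `(√δ)⁻¹ x'(x n)` over an interval of length `δ`. -/
theorem Represents.apply_stepVector {T δ : ℝ} (hδ : 0 < δ) {N : ℕ} (hN : N * δ < T)
    {y : H} (hy : ‖y‖ = 1) (x : Fin N → E) {R : Lp H 2 (intervalMeasure T) →L[ℝ] E}
    (hR : Represents T (fun t => (stepFun δ (fun n => Gamma.rankOne y (x n)) t).toCLM) R)
    (n : Fin N) : R (stepVector T δ y n) = Real.sqrt δ • x n := by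
  refine (SeparatingDual.eq_iff_forall_dual_eq (R := ℝ)).2 fun x' => ?_
  rw [(hR.2 x').2]
  have e : (fun t => inner ℝ (stepVector T δ y n t) ((InnerProductSpace.toDual ℝ H).symm
      (x' ∘L (stepFun δ (fun n => Gamma.rankOne y (x n)) t).toCLM))) =ᵐ[intervalMeasure T]
      (stepInterval δ n).indicator fun _ => (Real.sqrt δ)⁻¹ * x' (x n) := by
    filter_upwards [indicatorConstLp_coeFn (p := 2) (hs := measurableSet_stepInterval δ n)
      (hμs := measure_ne_top (intervalMeasure T) _) (c := (Real.sqrt δ)⁻¹ • y)] with t ht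
    rw [stepVector, ht]
    by_cases hn : t ∈ stepInterval δ n
    · rw [indicator_of_mem hn, indicator_of_mem hn, stepFun_of_mem hδ _ hn, real_inner_comm,
        InnerProductSpace.toDual_symm_apply]
      simp [hy]
    · rw [indicator_of_notMem hn, indicator_of_notMem hn, inner_zero_left]
  rw [integral_congr_ae e, integral_indicator_const _ (measurableSet_stepInterval δ n),
    measureReal_stepInterval hδ hN, map_smul, smul_eq_mul, smul_eq_mul, ← mul_assoc]
  congr 1
  nth_rewrite 1 [← Real.mul_self_sqrt hδ.le]
  rw [mul_assoc, mul_inv_cancel₀ (Real.sqrt_pos.2 hδ).ne', mul_one]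

variable {F : Type*} [NormedAddCommGroup F] [NormedSpace ℝ F]

theorem exists_besov_of_besovENorm_lt_top {T s : ℝ} {p q : ℝ≥0∞} [Fact (1 ≤ p)] [Fact (1 ≤ q)]
    {φ : ℝ → F} (hφ : AEStronglyMeasurable φ (intervalMeasure T))
    (h : besovENorm T s p q φ < ∞) :
    ∃ Φ : Besov F T s p q, Φ.toLp =ᵐ[intervalMeasure T] φ ∧
      ‖Φ‖ = (besovENorm T s p q φ).toReal := by
  have hm : MemLp φ p (intervalMeasure T) := ⟨hφ, le_self_add.trans_lt h⟩
  have he : besovENorm T s p q (hm.toLp φ) = besovENorm T s p q φ :=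
    besovENorm_congr_ae hm.coeFn_toLp
  have hmem : hm.toLp φ ∈ besovSubmodule F T s p q := he.trans_lt h
  obtain ⟨Φ, hΦ⟩ : ∃ Φ : Besov F T s p q, Φ.toLp = hm.toLp φ := ⟨⟨_, hmem⟩, rfl⟩
  refine ⟨Φ, ?_, ?_⟩
  · rw [hΦ]
    exact hm.coeFn_toLp
  · rw [Besov.norm_def, hΦ, he]

/-- The step function with rank one values `⟪y, ·⟫ x n` tests the embedding. The norm of its image
dominates the Gaussian sum over the orthonormal step vectors, that is, `√δ` times the Gaussian sum
of the `x n`. -/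
theorem hasType_of_embedding [Nontrivial H] {T : ℝ} (hT : 0 < T) {p : ℝ≥0∞}
    [hp1 : Fact (1 ≤ p)] (hp2 : p < 2)
    (J : Besov (Gamma H E) T (1 / p.toReal - 1 / 2) p p →L[ℝ]
      Gamma (Lp H 2 (intervalMeasure T)) E)
    (hJ : ∀ Φ : Besov (Gamma H E) T (1 / p.toReal - 1 / 2) p p,
      Represents T (fun t => (Φ.toLp t).toCLM) (J Φ).toCLM) : HasType E p.toReal := by
  have hp : 1 ≤ p := hp1.out
  obtain ⟨y, hy⟩ := exists_norm_eq H (zero_le_one (α := ℝ))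
  obtain ⟨C, hC0, hC⟩ := besovENorm_stepFun_le (F := Gamma H E) hp hp2
  set m := ∫ y : ℝ, |y| ∂(gaussianReal 0 1) with hm
  have hm0 : 0 < m := integral_abs_gaussianReal_pos
  refine ⟨m⁻¹ * (‖J‖ * C), fun N x => ?_⟩
  -- With `N + 1` in the denominator the `N` intervals fit strictly inside `(0, T)`, and `N = 0` is
  -- allowed.
  set δ : ℝ := min 1 (T / (N + 1)) with hδ
  have hδ0 : 0 < δ := by positivity
  have hN : N * δ < T := by
    calc N * δ < (N + 1) * δ := by gcongr; linarith
      _ ≤ (N + 1) * (T / (N + 1)) := by gcongr; exact min_le_right _ _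
      _ = T := mul_div_cancel₀ _ (by positivity)
  set G : Fin N → Gamma H E := fun n => Gamma.rankOne y (x n) with hG
  have hle := hC T δ hδ0 (min_le_left _ _) N G
  obtain ⟨Φ, hΦ, hΦn⟩ := exists_besov_of_besovENorm_lt_top
    (stronglyMeasurable_stepFun δ G).aestronglyMeasurable (hle.trans_lt ENNReal.ofReal_lt_top)
  have hR : Represents T (fun t => (stepFun δ G t).toCLM) (J Φ).toCLM := by
    refine (hJ Φ).congr_ae ?_
    filter_upwards [hΦ] with t ht
    rw [ht]
  set A := (∑ n, ‖x n‖ ^ p.toReal) ^ (1 / p.toReal) with hA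
  have hΦle : ‖Φ‖ ≤ C * Real.sqrt δ * A := by
    rw [hΦn]
    refine (ENNReal.toReal_mono ENNReal.ofReal_ne_top hle).trans ?_
    rw [ENNReal.toReal_ofReal (by positivity)]
    refine mul_le_mul_of_nonneg_left ?_ (by positivity)
    refine Real.rpow_le_rpow (by positivity) (Finset.sum_le_sum fun n _ => ?_) (by positivity)
    exact Real.rpow_le_rpow (norm_nonneg _) (Gamma.norm_rankOne_le hy (x n)) ENNReal.toReal_nonneg
  have h1 := (J Φ).norm_sum_gaussianTerm_le (orthonormal_stepVector hδ0 hN hy) Finset.univ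
  simp_rw [hR.apply_stepVector hδ0 hN hy, gaussianTerm_smul, ← Finset.smul_sum, norm_smul,
    Real.norm_of_nonneg (Real.sqrt_nonneg δ)] at h1
  have h2 : Real.sqrt δ * ‖(∑ n, gaussianTerm n (x n) : Lp E 2 (gaussianSeq (Fin N)))‖ ≤
      Real.sqrt δ * (‖J‖ * C * A) :=
    h1.trans ((J.le_opNorm Φ).trans ((mul_le_mul_of_nonneg_left hΦle (norm_nonneg J)).trans
      (le_of_eq (by ring))))
  -- The factor `√δ`, the only quantity in the constant that depends on `N`, cancels.
  have h3 := le_of_mul_le_mul_left h2 (Real.sqrt_pos.2 hδ0)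
  have h4 := Real.sqrt_le_sqrt (sum_sign_le_gaussian N x)
  rw [Real.sqrt_sq (norm_nonneg _), Real.sqrt_mul (sq_nonneg _), Real.sqrt_sq hm0.le] at h4
  rw [mul_assoc, le_inv_mul_iff₀ hm0]
  exact h4.trans h3

end Converse

end

theorem mainTheorem6 {H E : Type*}
    [NormedAddCommGroup H] [InnerProductSpace ℝ H] [CompleteSpace H]
    [TopologicalSpace.SeparableSpace H] [Nontrivial H]
    [NormedAddCommGroup E] [NormedSpace ℝ E] [CompleteSpace E]
    (T : ℝ) (hT : 0 < T) (p : ℝ≥0∞) [Fact (1 ≤ p)] (hp : p < 2) :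
    HasType E p.toReal ↔
      ∃ J : Besov (Gamma H E) T (1 / p.toReal - 1 / 2) p p →L[ℝ]
          Gamma (Lp H 2 (intervalMeasure T)) E,
        Function.Injective J ∧
        ∀ Φ : Besov (Gamma H E) T (1 / p.toReal - 1 / 2) p p,
          Represents T (fun t => (Φ.toLp t).toCLM) (J Φ).toCLM :=
  ⟨HasType.exists_embedding hT hp, fun ⟨J, _, hJ⟩ => hasType_of_embedding hT hp J hJ⟩
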